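/- **Conventions.** A *Floyd function* is a function $f:\{1,2,\dots\}\to\mathbb R_{>0}$ with $\sum_{n\ge 1}f(n)<\infty$ for which there is $\lambda>0$ with $f(n)\ge f(n+1)\ge\lambda f(n)$ for all $n\ge1$; put $f(0):=f(1)$. Let $G$ be a group with a finite generating set $S$, and let $d$ be the word metric of the Cayley graph $\Gamma_{G,S}$. Give an edge joining $g$ and $h$ the length $f(d(1,\{g,h\}))$, and let $d_f$ be the associated path metric (the infimum over edge paths of the sum of the lengths of the edges). The *Floyd boundary* $\partial_f(G,S)$ is the complement of $\Gamma_{G,S}$ in the Cauchy completion of $(\Gamma_{G,S},d_f)$, with the subspace topology. The symbol $\simeq$ means homeomorphic. For an amalgamated free product $A*_HB$, the group $H$ is regarded as a subgroup of $A$ and of $B$ through given injective homomorphisms $H\to A$ and $H\to B$. A finitely generated group has *infinitely many ends* if its Cayley graph with respect to a finite generating set does. **Theorem.** Let $f$ be a Floyd function. 1. Let $A$ and $B$ be infinite finitely generated groups, $H$ a finite group and $K=A*_HB$. If $S_A$ and $S_B$ are finite generating sets of $A$ and $B$, each containing $H\setminus\{1\}$, then $$\partial_f(K,S_A\cup S_B)\simeq\partial_f(A*B,S_A\cup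 S_B).$$ If moreover there is $D>0$ with $f(n)\le D f(2n)$ for all $n$, then $\partial_f(K,S)\simeq\partial_f(A*B,T)$ for all finite generating sets $S$ of $K$ and $T$ of $A*B$. 2. Let $A$ be an infinite finitely generated group, $B$ a finite group, $H$ a finite group with $H\ne B$, and $K=A*_HB$. If $S_A$ and $S_B$ are finite generating sets of $A$ and $B$, each containing $H\setminus\{1\}$, then $$\partial_f(K,S_A\cup S_B)\simeq\partial_f(A*A,S_A\cup S_A'),$$ where $S_A'$ is the copy of $S_A$ in the second factor. If moreover there is $D>0$ with $f(n)\le D f(2n)$ for all $n$, then $\partial_f(K,S)\simeq\partial_f(A*A,T)$ for all finite generating sets $S$ of $K$ and $T$ of $A*A$. 3. Let $B$ and $C$ be finite groups and $H$ a finite group such that $B*_HC$ has infinitely many ends. Then $\partial_f(B*_HC,S)$ is homeomorphic to the Cantor set for every finite generating set $S$ of $B*_HC$. -/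

import Mathlib

open Set Topology

noncomputable section

/-- A Floyd function `f`. It takes positive values on the positive integers, is summable and
non-increasing with `f (n + 1) ≥ r * f n` for some `r > 0`; it is extended to `0` by
`f 0 = f 1`. -/
structure FloydFunction where
  toFun : ℕ → ℝ
  pos : ∀ n, 1 ≤ n → 0 < toFun n
  summable : Summable toFun
  antitone_step : ∀ n, 1 ≤ n → toFun (n + 1) ≤ toFun n
  ratio : ∃ r : ℝ, 0 < r ∧ ∀ n, 1 ≤ n → r * toFun n ≤ toFun (n + 1)
  map_zero : toFun 0 = toFun 1

instance : CoeFun FloydFunction (fun _ => ℕ → ℝ) := ⟨FloydFunction.toFun⟩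

/-- The ratios `f n / f (2 * n)` are bounded. -/
def FloydFunction.IsDoubling (f : FloydFunction) : Prop :=
  ∃ D : ℝ, ∀ n, f n ≤ D * f (2 * n)

theorem FloydFunction.pos_all (f : FloydFunction) (n : ℕ) : 0 < f n := by
  rcases Nat.eq_zero_or_pos n with rfl | h
  · rw [f.map_zero]; exact f.pos 1 le_rfl
  · exact f.pos n h

theorem FloydFunction.antitone (f : FloydFunction) : Antitone f := by
  refine antitone_nat_of_succ_le fun n => ?_
  rcases Nat.eq_zero_or_pos n with rfl | h
  · exact f.map_zero.ge
  · exact f.antitone_step n h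

/-- A finite generating set of a group. -/
structure FinGenSet (G : Type*) [Group G] where
  carrier : Set G
  finite : carrier.Finite
  closure_eq : Subgroup.closure carrier = ⊤

namespace FinGenSet

variable {G : Type*} [Group G]

/-- The Cayley graph: `g` and `g * s` are joined by an edge for every generator `s`. -/
def cayley (S : FinGenSet G) : SimpleGraph G := SimpleGraph.mulCayley S.carrier

/-- The word length of `g`, i.e. the distance from `1` to `g` in the Cayley graph. -/
def len (S : FinGenSet G) (g : G) : ℕ := S.cayley.dist 1 g

theorem reachable_mul (S : FinGenSet G) (g s : G) (hs : s ∈ S.carrier) :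
    S.cayley.Reachable g (g * s) := by
  by_cases h : g = g * s
  · rw [← h]
  · exact SimpleGraph.Adj.reachable
      ((SimpleGraph.mulCayley_adj' _ _ _).2 ⟨h, s, hs, Or.inl rfl⟩)

theorem connected (S : FinGenSet G) : S.cayley.Connected := by
  have key : ∀ x : G, ∀ g : G, S.cayley.Reachable g (g * x) := by
    intro x
    have hx : x ∈ Subgroup.closure S.carrier := by rw [S.closure_eq]; trivial
    induction hx using Subgroup.closure_induction with
    | mem s hs => exact fun g => S.reachable_mul g s hs
    | one => intro g; rw [mul_one]
    | mul x y _ _ hx hy => intro g; rw [← mul_assoc]; exact (hx g).trans (hy _)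
    | inv x _ hx =>
      intro g
      have h := (hx (g * x⁻¹)).symm
      rwa [inv_mul_cancel_right] at h
  refine (SimpleGraph.connected_iff _).2 ⟨fun g h => ?_, ⟨1⟩⟩
  have := key (g⁻¹ * h) g
  rwa [mul_inv_cancel_left] at this

/-- The Floyd length of an edge with end points `g` and `h`: the value of `f` at the distance
from `1` to the set `{g, h}`. -/
def edgeLength (f : FloydFunction) (S : FinGenSet G) (g h : G) : ℝ :=
  f (min (S.len g) (S.len h))

/-- The Floyd length of an edge path: the sum of the Floyd lengths of its edges. -/
def walkLength (f : FloydFunction) (S : FinGenSet G) {g h : G} (w : S.cayley.Walk g h) : ℝ :=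
  (w.darts.map fun d => S.edgeLength f d.fst d.snd).sum

/-- The Floyd metric: the infimum of the Floyd lengths of the edge paths from `g` to `h`. -/
def floydDist (f : FloydFunction) (S : FinGenSet G) (g h : G) : ℝ :=
  ⨅ w : S.cayley.Walk g h, S.walkLength f w

theorem walkLength_nonneg (f : FloydFunction) (S : FinGenSet G) {g h : G}
    (w : S.cayley.Walk g h) : 0 ≤ S.walkLength f w := by
  refine List.sum_nonneg fun x hx => ?_
  obtain ⟨d, -, rfl⟩ := List.mem_map.1 hx
  exact (f.pos_all _).le

theorem walkLength_bddBelow (f : FloydFunction) (S : FinGenSet G) (g h : G) :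
    BddBelow (range fun w : S.cayley.Walk g h => S.walkLength f w) :=
  ⟨0, by rintro _ ⟨w, rfl⟩; exact S.walkLength_nonneg f w⟩

theorem floydDist_le (f : FloydFunction) (S : FinGenSet G) {g h : G} (w : S.cayley.Walk g h) :
    S.floydDist f g h ≤ S.walkLength f w :=
  ciInf_le (S.walkLength_bddBelow f g h) w

theorem nonempty_walk (S : FinGenSet G) (g h : G) : Nonempty (S.cayley.Walk g h) :=
  S.connected.preconnected g h

theorem floydDist_nonneg (f : FloydFunction) (S : FinGenSet G) (g h : G) :
    0 ≤ S.floydDist f g h :=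
  Real.iInf_nonneg fun w => S.walkLength_nonneg f w

theorem floydDist_self (f : FloydFunction) (S : FinGenSet G) (g : G) :
    S.floydDist f g g = 0 :=
  le_antisymm ((S.floydDist_le f SimpleGraph.Walk.nil).trans (by simp [walkLength]))
    (S.floydDist_nonneg f g g)

theorem walkLength_reverse (f : FloydFunction) (S : FinGenSet G) {g h : G}
    (w : S.cayley.Walk g h) : S.walkLength f w.reverse = S.walkLength f w := by
  simp only [walkLength, SimpleGraph.Walk.darts_reverse, List.map_reverse, List.sum_reverse,
    List.map_map]
  congr 1
  refine List.map_congr_left fun d _ => ?_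
  simp [edgeLength, min_comm]

theorem floydDist_comm (f : FloydFunction) (S : FinGenSet G) (g h : G) :
    S.floydDist f g h = S.floydDist f h g := by
  have key : ∀ g h : G, S.floydDist f g h ≤ S.floydDist f h g := by
    intro g h
    have := S.nonempty_walk h g
    refine le_ciInf fun w => ?_
    rw [← S.walkLength_reverse f w]
    exact S.floydDist_le f _
  exact le_antisymm (key g h) (key h g)

theorem floydDist_triangle (f : FloydFunction) (S : FinGenSet G) (g h k : G) :
    S.floydDist f g k ≤ S.floydDist f g h + S.floydDist f h k := by
  have := S.nonempty_walk g h
  have := S.nonempty_walk h k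
  refine le_ciInf_add_ciInf fun w w' => ?_
  refine (S.floydDist_le f (w.append w')).trans (le_of_eq ?_)
  simp [walkLength, SimpleGraph.Walk.darts_append]

theorem eq_of_floydDist_eq_zero (f : FloydFunction) (S : FinGenSet G) (g h : G)
    (h0 : S.floydDist f g h = 0) : g = h := by
  by_contra hne
  have := S.nonempty_walk g h
  have : f (S.len g) ≤ S.floydDist f g h := by
    refine le_ciInf fun w => ?_
    cases w with
    | nil => exact absurd rfl hne
    | @cons _ k _ a w =>
      have h1 := S.walkLength_nonneg f w
      have h2 : f (S.len g) ≤ S.edgeLength f g k := f.antitone (min_le_left _ _)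
      simp only [walkLength, SimpleGraph.Walk.darts_cons, List.map_cons, List.sum_cons] at h1 ⊢
      exact h2.trans (le_add_of_nonneg_right h1)
  exact absurd (this.trans h0.le) (not_le.2 (f.pos_all _))

/-- If the images of `A` and `B` generate `K`, then the union of the images of finite generating
sets of `A` and `B` is a finite generating set of `K`. -/
def union {A B K : Type*} [Group A] [Group B] [Group K] (a : A →* K) (b : B →* K)
    (hab : a.range ⊔ b.range = ⊤) (SA : FinGenSet A) (SB : FinGenSet B) : FinGenSet K where
  carrier := a '' SA.carrier ∪ b '' SB.carrier
  finite := (SA.finite.image _).union (SB.finite.image _)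
  closure_eq := by
    rw [Subgroup.closure_union, ← MonoidHom.map_closure, ← MonoidHom.map_closure,
      SA.closure_eq, SB.closure_eq, ← MonoidHom.range_eq_map, ← MonoidHom.range_eq_map, hab]

end FinGenSet

/-- The set of vertices of the Cayley graph of `G` with respect to `S`, to be equipped with the
Floyd metric of `f`. -/
def FloydSpace {G : Type*} [Group G] (_f : FloydFunction) (_S : FinGenSet G) : Type _ := G

instance {G : Type*} [Group G] (f : FloydFunction) (S : FinGenSet G) :
    MetricSpace (FloydSpace f S) where
  dist g h := S.floydDist f g h
  dist_self := S.floydDist_self f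
  dist_comm := S.floydDist_comm f
  dist_triangle := S.floydDist_triangle f
  eq_of_dist_eq_zero := fun {g h} => S.eq_of_floydDist_eq_zero f g h

/-- The Floyd boundary `∂_f(G, S)`: the points of the Cauchy completion that are not in the
space itself, with the subspace topology. (Adding the open edges to the vertex set adds no new
point to the boundary: a Cauchy sequence of points on edges that does not converge in the graph
visits edges whose lengths tend to `0`, so it is equivalent to a sequence of vertices.) -/
def FloydBoundary {G : Type*} [Group G] (f : FloydFunction) (S : FinGenSet G) : Type _ :=
  {x : UniformSpace.Completion (FloydSpace f S) //
    x ∉ range ((↑) : FloydSpace f S → UniformSpace.Completion (FloydSpace f S))}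

instance {G : Type*} [Group G] (f : FloydFunction) (S : FinGenSet G) :
    TopologicalSpace (FloydBoundary f S) :=
  instTopologicalSpaceSubtype

/-- A finitely generated group has infinitely many ends if the Cayley graph of a finite
generating set has infinitely many ends (which set is used does not matter). -/
def HasInfinitelyManyEnds (G : Type*) [Group G] : Prop :=
  ∃ S : FinGenSet G, S.cayley.end.Infinite

section Amalgam

variable {A B H : Type*} [Group A] [Group B] [Group H]

/-- The amalgamated free product `A *_H B` along `i : H →* A` and `j : H →* B`: the quotient of
the free product `A * B` by the normal closure of the elements `i(h) j(h)⁻¹`. -/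
abbrev Amalgam (i : H →* A) (j : H →* B) : Type _ :=
  Monoid.Coprod A B ⧸ Subgroup.normalClosure
    (range fun h : H =>
      (Monoid.Coprod.inl (i h) : Monoid.Coprod A B) * (Monoid.Coprod.inr (j h))⁻¹)

namespace Amalgam

/-- The quotient map from the free product. -/
def mk (i : H →* A) (j : H →* B) : Monoid.Coprod A B →* Amalgam i j :=
  QuotientGroup.mk' _

/-- The canonical map from the left factor. -/
def inl (i : H →* A) (j : H →* B) : A →* Amalgam i j := (mk i j).comp Monoid.Coprod.inl

/-- The canonical map from the right factor. -/
def inr (i : H →* A) (j : H →* B) : B →* Amalgam i j := (mk i j).comp Monoid.Coprod.inr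

theorem range_sup_range (i : H →* A) (j : H →* B) :
    (inl i j).range ⊔ (inr i j).range = ⊤ := by
  rw [inl, inr, MonoidHom.range_comp, MonoidHom.range_comp, ← Subgroup.map_sup,
    Monoid.Coprod.range_inl_sup_range_inr, ← MonoidHom.range_eq_map]
  exact MonoidHom.range_eq_top.2 (QuotientGroup.mk'_surjective _)

end Amalgam

/-- The generating set `S_A ∪ S_B` of the free product `A * B`. -/
def FinGenSet.coprod (SA : FinGenSet A) (SB : FinGenSet B) : FinGenSet (Monoid.Coprod A B) :=
  FinGenSet.union Monoid.Coprod.inl Monoid.Coprod.inr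
    Monoid.Coprod.range_inl_sup_range_inr SA SB

/-- The generating set `S_A ∪ S_B` of the amalgamated free product `A *_H B`. -/
def FinGenSet.amalgam (i : H →* A) (j : H →* B) (SA : FinGenSet A) (SB : FinGenSet B) :
    FinGenSet (Amalgam i j) :=
  FinGenSet.union (Amalgam.inl i j) (Amalgam.inr i j) (Amalgam.range_sup_range i j) SA SB

end Amalgam

end

open Filter

/-! Let `K` be an amalgam over a finite core. Once coset representatives are fixed, every element of
`K` is, up to right multiplication by the core, the product of a unique alternating word, its normal
form. The elements whose normal form extends a word `v` make up the shadow of `v`. An edge across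
the boundary of this shadow lies within a distance of the product of `v` that does not depend on
`v`. Geodesics from `1` therefore enter a shadow near its base point, and summability of `f` makes
shadows small far out; as only finitely many edges leave a shadow, it has positive distance from its
complement. This is `IsAmalgam.isTreeLike`.

Up to uniform equivalence, the metric on a tree-like family is determined by the one-letter
extensions of each word (`IsTreeLike.uniform_comparison`). Up to bounded word distance and finitely
many elements, these form a translate of a factor, on which a retraction shows the Floyd metric of
the factor to be equivalent to the ambient one (`IsAmalgam.floydDist_factor`). The Floyd space of an
infinite factor is discrete and totally bounded, so two finite-to-one, asymptotically dense families
in it can be matched bijectively with distances tending to 0 (`exists_equiv_tendsto_dist`). Matching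
the letters of `A *_H B` with those of `A * B` place by place gives a uniform equivalence of words,
hence a homeomorphism of boundaries. If `B` is finite, a letter from `A` and the next one from `B`
are read as one letter, which is matched with a letter from either copy of `A` in `A * A`.

For doubling `f` a change of generators is Lipschitz, which removes the conditions on the generating
sets. For two finite factors the boundary is the space of infinite normal forms, a product of finite
discrete spaces. Having infinitely many ends excludes the cases with at most one nontrivial letter
on each side, so this product is perfect, and Brouwer's theorem identifies it. -/

/-! ### Shifts and tails of Floyd functions -/

/-- Each step costs at most the inverse of the ratio `r`. This is why displacements bounded in the
word metric change edge lengths only by a bounded factor. -/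
theorem FloydFunction.exists_shift_le (f : FloydFunction) (m : ℕ) :
    ∃ C : ℝ, 0 < C ∧ ∀ n, f (n - m) ≤ C * f n := by
  obtain ⟨r, hr, hf⟩ := f.ratio
  have hr1 : r ≤ 1 := by
    have h1 := (hf 1 le_rfl).trans (f.antitone_step 1 le_rfl)
    exact (mul_le_iff_le_one_left (f.pos 1 le_rfl)).1 h1
  have hf' : ∀ n, f n ≤ r⁻¹ * f (n + 1) := by
    intro n
    rw [inv_mul_eq_div, le_div_iff₀ hr, mul_comm]
    rcases Nat.eq_zero_or_pos n with rfl | h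
    · rw [zero_add, ← f.map_zero]
      exact mul_le_of_le_one_left (f.pos_all 0).le hr1
    · exact hf n h
  have hr2 : 1 ≤ r⁻¹ := (one_le_inv₀ hr).2 hr1
  refine ⟨r⁻¹ ^ m, by positivity, ?_⟩
  induction m with
  | zero => intro n; simp
  | succ m ih =>
    intro n
    -- Subtraction is truncated: for `n ≤ m` nothing changes, and the additional factor `r⁻¹ ≥ 1` is
    -- wasted.
    rcases Nat.eq_zero_or_pos (n - m) with h | h
    · have : n - (m + 1) = n - m := by omega
      rw [this]
      refine (ih n).trans ?_
      rw [pow_succ]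
      have := f.pos_all n
      have : r⁻¹ ^ m * 1 ≤ r⁻¹ ^ m * r⁻¹ := by gcongr
      nlinarith
    · have h1 : n - m = n - (m + 1) + 1 := by omega
      have h2 := hf' (n - (m + 1))
      rw [← h1] at h2
      refine h2.trans ?_
      rw [pow_succ', mul_assoc]
      gcongr
      exact ih n

theorem FloydFunction.tendsto_zero (f : FloydFunction) : Tendsto f atTop (𝓝 0) :=
  f.summable.tendsto_atTop_zero

/-- The tails of the series of a Floyd function. -/
noncomputable def FloydFunction.tail (f : FloydFunction) (n : ℕ) : ℝ := ∑' k, f (k + n)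

theorem FloydFunction.tendsto_tail (f : FloydFunction) : Tendsto f.tail atTop (𝓝 0) :=
  tendsto_sum_nat_add f

theorem FloydFunction.tail_anti (f : FloydFunction) : Antitone f.tail := fun m n h =>
  Summable.tsum_le_tsum (fun k => f.antitone (by omega)) ((summable_nat_add_iff n).2 f.summable)
    ((summable_nat_add_iff m).2 f.summable)

theorem FloydFunction.sum_Ico_le_tail (f : FloydFunction) (m n : ℕ) :
    ∑ k ∈ Finset.Ico m n, f k ≤ f.tail m := by
  rw [Finset.sum_Ico_eq_sum_range]
  simp_rw [add_comm m]
  exact ((summable_nat_add_iff m).2 f.summable).sum_le_tsum _ fun k _ => (f.pos_all _).le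

/-! ### Word metric and Floyd metric -/

/-- The last vertex but one of a geodesic. It drives the inductions on the distance below. -/
theorem SimpleGraph.Connected.exists_adj_dist_eq {V : Type*} {G : SimpleGraph V}
    (hG : G.Connected) {u v : V} {n : ℕ} (h : G.dist u v = n + 1) :
    ∃ w, G.Adj w v ∧ G.dist u w = n := by
  obtain ⟨p, hp⟩ := hG.exists_walk_length_eq_dist v u
  rw [SimpleGraph.dist_comm, h] at hp
  cases p with
  | nil => simp at hp
  | @cons _ w _ hadj q =>
    refine ⟨w, hadj.symm, ?_⟩
    have h1 : G.dist w u ≤ q.length := SimpleGraph.dist_le q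
    have h2 := hG.dist_triangle (u := u) (v := w) (w := v)
    have h3 : G.dist w v = 1 := SimpleGraph.dist_eq_one_iff_adj.2 hadj.symm
    rw [SimpleGraph.Walk.length_cons] at hp
    rw [SimpleGraph.dist_comm] at h1
    omega

namespace FinGenSet

variable {G : Type*} [Group G] (f : FloydFunction) (S : FinGenSet G)

theorem cayley_adj {g h : G} :
    S.cayley.Adj g h ↔ g ≠ h ∧ ∃ s ∈ S.carrier, g * s = h ∨ g = h * s :=
  SimpleGraph.mulCayley_adj' _ _ _

theorem adj_mul_left (k : G) {g h : G} : S.cayley.Adj (k * g) (k * h) ↔ S.cayley.Adj g h :=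
  SimpleGraph.mulCayley_adj_mul_iff_right

theorem adj_iff_inv_mul {g h : G} : S.cayley.Adj g h ↔
    g ≠ h ∧ (g⁻¹ * h ∈ S.carrier ∨ h⁻¹ * g ∈ S.carrier) := by
  rw [cayley_adj]
  refine and_congr_right fun _ => ⟨?_, ?_⟩
  · rintro ⟨s, hs, rfl | rfl⟩
    · left; simpa
    · right; simpa
  · rintro (h | h)
    · exact ⟨_, h, Or.inl (mul_inv_cancel_left _ _)⟩
    · exact ⟨_, h, Or.inr (mul_inv_cancel_left _ _).symm⟩

/-- Left translations do not increase the distance. -/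
theorem dist_mul_left_le (k g h : G) : S.cayley.dist (k * g) (k * h) ≤ S.cayley.dist g h := by
  generalize hn : S.cayley.dist g h = n
  induction n generalizing h with
  | zero =>
    rw [S.connected.dist_eq_zero_iff.1 hn, SimpleGraph.dist_self]
  | succ n ih =>
    obtain ⟨w, hw, hd⟩ := S.connected.exists_adj_dist_eq hn
    have h1 := S.connected.dist_triangle (u := k * g) (v := k * w) (w := k * h)
    have h2 := SimpleGraph.dist_eq_one_iff_adj.2 ((S.adj_mul_left k).2 hw)
    have h3 := ih w hd
    omega

theorem dist_mul_left (k g h : G) : S.cayley.dist (k * g) (k * h) = S.cayley.dist g h := by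
  refine le_antisymm (S.dist_mul_left_le k g h) ?_
  simpa using S.dist_mul_left_le k⁻¹ (k * g) (k * h)

theorem dist_self_mul (g s : G) : S.cayley.dist g (g * s) = S.len s := by
  simpa [len] using S.dist_mul_left g 1 s

@[simp] theorem len_one : S.len 1 = 0 := SimpleGraph.dist_self

theorem len_mul_le (g h : G) : S.len (g * h) ≤ S.len g + S.len h := by
  have := S.connected.dist_triangle (u := 1) (v := g) (w := g * h)
  rwa [S.dist_self_mul] at this

theorem len_inv (g : G) : S.len g⁻¹ = S.len g := by
  have := S.dist_mul_left g 1 g⁻¹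
  rw [mul_inv_cancel, mul_one, SimpleGraph.dist_comm] at this
  exact this.symm

theorem len_le_mul_left (g s : G) : S.len s ≤ S.len (g * s) + S.len g := by
  have := S.len_mul_le g⁻¹ (g * s)
  rw [inv_mul_cancel_left, len_inv] at this
  omega

theorem len_le_add_dist (g h : G) : S.len h ≤ S.len g + S.cayley.dist g h :=
  S.connected.dist_triangle

theorem len_le_succ_of_adj {g h : G} (hgh : S.cayley.Adj g h) : S.len h ≤ S.len g + 1 := by
  have := S.len_le_add_dist g h
  rwa [SimpleGraph.dist_eq_one_iff_adj.2 hgh] at this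

theorem finite_len_le (n : ℕ) : {g : G | S.len g ≤ n}.Finite := by
  induction n with
  | zero =>
    refine (finite_singleton 1).subset fun g hg => ?_
    exact (S.connected.dist_eq_zero_iff.1 (Nat.le_zero.1 hg)).symm
  | succ n ih =>
    have h1 := (Set.Finite.image2 (fun g s => g * s) ih S.finite)
    have h2 := (Set.Finite.image2 (fun g s => g * s⁻¹) ih S.finite)
    refine ((ih.union h1).union h2).subset fun g hg => ?_
    rcases Nat.lt_or_ge n (S.len g) with h | h
    · obtain ⟨w, hw, hd⟩ := S.connected.exists_adj_dist_eq (le_antisymm hg h)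
      obtain ⟨-, s, hs, rfl | rfl⟩ := S.cayley_adj.1 hw
      · exact Or.inl (Or.inr ⟨w, hd.le, s, hs, rfl⟩)
      · exact Or.inr ⟨_, hd.le, s, hs, by simp⟩
    · exact Or.inl (Or.inl h)

theorem tendsto_len : Tendsto S.len cofinite atTop := by
  refine tendsto_atTop.2 fun n => ?_
  refine (S.finite_len_le n).subset fun g hg => ?_
  exact (Nat.lt_of_not_le hg).le

theorem countable (S : FinGenSet G) : Countable G := by
  rw [← Set.countable_univ_iff]
  refine (Set.countable_iUnion fun n => (S.finite_len_le n).countable).mono fun g _ => ?_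
  exact mem_iUnion.2 ⟨S.len g, le_refl (S.len g)⟩

theorem edgeLength_le_left (g h : G) : f (S.len g) ≤ S.edgeLength f g h :=
  f.antitone (min_le_left _ _)

theorem floydDist_le_edgeLength {g h : G} (hgh : S.cayley.Adj g h) :
    S.floydDist f g h ≤ S.edgeLength f g h := by
  refine (S.floydDist_le f hgh.toWalk).trans (le_of_eq ?_)
  simp [walkLength]

/-- A path that leaves `g` begins with an edge at `g`. Hence vertices are isolated, though not
uniformly so. -/
theorem le_floydDist {g h : G} (hne : g ≠ h) : f (S.len g) ≤ S.floydDist f g h := by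
  have := S.nonempty_walk g h
  refine le_ciInf fun w => ?_
  cases w with
  | nil => exact absurd rfl hne
  | @cons _ k _ a w =>
    have h1 := S.walkLength_nonneg f w
    have h2 := S.edgeLength_le_left f g k
    simp only [walkLength, SimpleGraph.Walk.darts_cons, List.map_cons, List.sum_cons] at h1 ⊢
    exact h2.trans (le_add_of_nonneg_right h1)

/-- Points at bounded word distance are close in the Floyd metric if they are far out. -/
theorem exists_floydDist_le (m : ℕ) :
    ∃ C : ℝ, 0 ≤ C ∧ ∀ g h : G, S.cayley.dist g h ≤ m →
      S.floydDist f g h ≤ C * f (S.len g) := by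
  induction m with
  | zero =>
    refine ⟨0, le_rfl, fun g h hd => ?_⟩
    rw [S.connected.dist_eq_zero_iff.1 (Nat.le_zero.1 hd), S.floydDist_self, zero_mul]
  | succ m ih =>
    obtain ⟨C, hC, ih⟩ := ih
    obtain ⟨C', hC', hsh⟩ := f.exists_shift_le (m + 1)
    refine ⟨C + C', by positivity, fun g h hd => ?_⟩
    have hpos := f.pos_all (S.len g)
    rcases Nat.lt_or_ge m (S.cayley.dist g h) with hlt | hle
    · obtain ⟨w, hw, hdw⟩ := S.connected.exists_adj_dist_eq (le_antisymm hd hlt)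
      refine (S.floydDist_triangle f g w h).trans ?_
      rw [add_mul]
      refine add_le_add (ih g w hdw.le) ((S.floydDist_le_edgeLength f hw).trans ?_)
      -- Both ends of the last edge are within `m + 1` of `g`.
      refine le_trans (f.antitone ?_) (hsh _)
      have h1 := S.len_le_add_dist w g
      have h2 := S.len_le_add_dist h g
      rw [SimpleGraph.dist_comm] at h1 h2
      omega
    · refine (ih g h hle).trans ?_
      gcongr
      linarith

/-- A map that sends edges to pairs of points at controlled Floyd distance is Lipschitz. -/
theorem floydDist_map_le {G' : Type*} [Group G'] (f' : FloydFunction) (S' : FinGenSet G')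
    (φ : G → G') (C : ℝ) (hφ : ∀ g h, S.cayley.Adj g h →
      S'.floydDist f' (φ g) (φ h) ≤ C * S.edgeLength f g h) (hC : 0 < C) (g h : G) :
    S'.floydDist f' (φ g) (φ h) ≤ C * S.floydDist f g h := by
  have key : ∀ (g h : G) (w : S.cayley.Walk g h),
      S'.floydDist f' (φ g) (φ h) ≤ C * S.walkLength f w := by
    intro g h w
    induction w with
    | nil => simp [walkLength, S'.floydDist_self]
    | @cons a b c hab w ih =>
      refine (S'.floydDist_triangle f' _ (φ b) _).trans ?_
      have := hφ _ _ hab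
      simp only [walkLength, SimpleGraph.Walk.darts_cons, List.map_cons, List.sum_cons,
        mul_add] at ih ⊢
      exact add_le_add this ih
  have := S.nonempty_walk g h
  rw [← div_le_iff₀' hC]
  refine le_ciInf fun w => ?_
  rw [div_le_iff₀' hC]
  exact key g h w

/-- Left translations are Lipschitz. -/
theorem exists_floydDist_mul_left_le (k : G) : ∃ C : ℝ, 0 < C ∧ ∀ g h : G,
    S.floydDist f (k * g) (k * h) ≤ C * S.floydDist f g h := by
  obtain ⟨C, hC, hsh⟩ := f.exists_shift_le (S.len k)
  refine ⟨C, hC, S.floydDist_map_le f f S _ C (fun g h hgh => ?_) hC⟩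
  refine (S.floydDist_le_edgeLength f ((S.adj_mul_left k).2 hgh)).trans ?_
  refine le_trans (f.antitone ?_) (hsh _)
  have h1 := S.len_le_mul_left k g
  have h2 := S.len_le_mul_left k h
  omega

/-- If `U` does not contain `1`, every point of `U` is close to the place at which a geodesic
from `1` enters `U`. -/
theorem exists_entrance (U : Set G) (h1 : (1 : G) ∉ U) {g : G} (hg : g ∈ U) :
    ∃ k ∈ U, ∃ k', k' ∉ U ∧ S.cayley.Adj k' k ∧ S.len k = S.len k' + 1 ∧
      S.floydDist f k g ≤ f.tail (S.len k) := by
  -- The tail is replaced by the sum over the stretch of the geodesic between `k` and `g`, which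
  -- gains one term per step.
  suffices h : ∃ k ∈ U, ∃ k', k' ∉ U ∧ S.cayley.Adj k' k ∧ S.len k = S.len k' + 1 ∧
      S.len k ≤ S.len g ∧
      S.floydDist f k g ≤ ∑ j ∈ Finset.Ico (S.len k) (S.len g), f j by
    obtain ⟨k, hk, k', hk', ha, hl, -, hd⟩ := h
    exact ⟨k, hk, k', hk', ha, hl, hd.trans (f.sum_Ico_le_tail _ _)⟩
  generalize hn : S.len g = n
  induction n generalizing g with
  | zero => exact absurd (S.connected.dist_eq_zero_iff.1 hn ▸ hg) h1
  | succ n ih =>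
    obtain ⟨w, hw, hd⟩ := S.connected.exists_adj_dist_eq hn
    change S.len w = n at hd
    by_cases hwU : w ∈ U
    · obtain ⟨k, hk, k', hk', ha, hl, hle, hsum⟩ := ih hwU hd
      refine ⟨k, hk, k', hk', ha, hl, by omega, ?_⟩
      rw [Finset.sum_Ico_succ_top hle]
      refine (S.floydDist_triangle f k w g).trans (add_le_add hsum ?_)
      refine (S.floydDist_le_edgeLength f hw).trans (le_of_eq ?_)
      rw [edgeLength, hn, hd, min_eq_left (Nat.le_succ n)]
    · refine ⟨g, hg, w, hwU, hw, by omega, hn.le, ?_⟩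
      rw [S.floydDist_self]
      exact Finset.sum_nonneg fun j _ => (f.pos_all j).le

/-- A lower bound for the lengths of the edges leaving `U` is a lower bound for the distance of
`U` to its complement. -/
theorem le_floydDist_of_crossing (U : Set G) (c : ℝ)
    (hc : ∀ g h, g ∈ U → h ∉ U → S.cayley.Adj g h → c ≤ S.edgeLength f g h) {g h : G}
    (hg : g ∈ U) (hh : h ∉ U) : c ≤ S.floydDist f g h := by
  have := S.nonempty_walk g h
  refine le_ciInf fun w => ?_
  induction w with
  | nil => exact absurd hg hh
  | @cons a b d hab w ih =>
    have h1 := S.walkLength_nonneg f w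
    have h2 : 0 ≤ S.edgeLength f a b := (f.pos_all _).le
    have h3 : S.walkLength f (SimpleGraph.Walk.cons hab w) =
        S.edgeLength f a b + S.walkLength f w := by simp [walkLength]
    rw [h3]
    by_cases hb : b ∈ U
    · linarith [ih hb hh (S.nonempty_walk b d)]
    · linarith [hc a b hg hb hab]

/-- If the Floyd function is doubling, a change of the generating set is Lipschitz. -/
theorem exists_floydDist_le_of_isDoubling (hf : f.IsDoubling) (S' : FinGenSet G) :
    ∃ C : ℝ, 0 < C ∧ ∀ g h : G, S'.floydDist f g h ≤ C * S.floydDist f g h := by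
  have hL : ∃ L : ℕ, ∀ g, S.cayley.dist 1 g ≤ 1 → S'.len g ≤ L := by
    obtain ⟨L, hL⟩ := ((S.finite_len_le 1).image S'.len).bddAbove
    exact ⟨L, fun g hg => hL ⟨g, hg, rfl⟩⟩
  obtain ⟨L, hL⟩ := hL
  have hL' : ∀ g h, S.cayley.Adj g h → S'.cayley.dist g h ≤ L := by
    intro g h hgh
    have h1 := S.dist_self_mul g (g⁻¹ * h)
    have h2 := S'.dist_self_mul g (g⁻¹ * h)
    rw [mul_inv_cancel_left] at h1 h2
    rw [SimpleGraph.dist_eq_one_iff_adj.2 hgh] at h1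
    rw [h2]
    exact hL _ h1.symm.le
  -- The distortion constant is a power of two, so that the doubling inequality can be applied `M`
  -- times.
  have hM : ∃ M : ℕ, ∀ g, S.len g ≤ 2 ^ M * S'.len g := by
    obtain ⟨m, hm⟩ := ((S'.finite_len_le 1).image S.len).bddAbove
    obtain ⟨M, hM⟩ : ∃ M, m ≤ 2 ^ M := ⟨m, Nat.lt_two_pow_self.le⟩
    refine ⟨M, fun g => ?_⟩
    generalize hn : S'.len g = n
    induction n generalizing g with
    | zero =>
      rw [← S'.connected.dist_eq_zero_iff.1 hn, len_one]
      exact Nat.zero_le _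
    | succ n ih =>
      obtain ⟨w, hw, hd⟩ := S'.connected.exists_adj_dist_eq hn
      have h1 := ih w hd
      have h2 : S.len (w⁻¹ * g) ≤ m := by
        refine hm ⟨_, ?_, rfl⟩
        have := S'.dist_self_mul w (w⁻¹ * g)
        rw [mul_inv_cancel_left, SimpleGraph.dist_eq_one_iff_adj.2 hw] at this
        exact this.symm.le
      have h3 := S.len_mul_le w (w⁻¹ * g)
      rw [mul_inv_cancel_left] at h3
      rw [mul_add, mul_one]
      omega
  obtain ⟨M, hM⟩ := hM
  have hD : ∃ D : ℝ, 0 < D ∧ ∀ n, f n ≤ D * f (2 ^ M * n) := by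
    obtain ⟨D, hD⟩ := hf
    -- At `n = 0` doubling compares `f 0 > 0` with `D * f 0`.
    have hD0 : 0 < D := by
      by_contra hneg
      have := hD 0
      have h0 := f.pos_all 0
      simp only [mul_zero] at this
      nlinarith
    refine ⟨D ^ M, by positivity, ?_⟩
    clear hM
    induction M with
    | zero => simp
    | succ M ih =>
      intro n
      refine (ih n).trans ?_
      rw [pow_succ, pow_succ, mul_assoc]
      gcongr
      refine (hD _).trans_eq ?_
      congr 2
      ring
  obtain ⟨D, hD, hfD⟩ := hD
  obtain ⟨C, hC, hdist⟩ := S'.exists_floydDist_le f L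
  -- The summand 1 only makes the constant positive, since `C` may vanish.
  refine ⟨C * D + 1, by positivity, S.floydDist_map_le f f S' id _ (fun g h hgh => ?_)
    (by positivity)⟩
  refine (hdist g h (hL' g h hgh)).trans ?_
  have h1 : f (S'.len g) ≤ D * f (S.len g) :=
    (hfD _).trans (mul_le_mul_of_nonneg_left (f.antitone (hM g)) hD.le)
  have h2 := S.edgeLength_le_left f g h
  have h3 := f.pos_all (S.len g)
  have h4 : 0 ≤ C * D := by positivity
  calc C * f (S'.len g) ≤ C * (D * f (S.len g)) := by gcongr
    _ = C * D * f (S.len g) := by ring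
    _ ≤ C * D * S.edgeLength f g h := by gcongr
    _ ≤ _ := by nlinarith

end FinGenSet

/-! ### The Floyd space is discrete and totally bounded -/

namespace FloydSpace

variable {G : Type*} [Group G] {f : FloydFunction} {S : FinGenSet G}

/-- The point of the Floyd space given by a group element. -/
def of (f : FloydFunction) (S : FinGenSet G) (g : G) : FloydSpace f S := g

theorem dist_of (g h : G) : dist (of f S g) (of f S h) = S.floydDist f g h := rfl

theorem exists_isolated (x : FloydSpace f S) : ∃ δ > 0,
    ∀ y : FloydSpace f S, dist x y < δ → x = y :=
  ⟨f (S.len x), f.pos_all _, fun _ hy => by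
    by_contra hne
    exact absurd (S.le_floydDist f hne) (not_le.2 hy)⟩

/-- Displacements that are bounded in the word metric are asymptotically trivial in the Floyd
metric. -/
theorem tendsto_dist_of_bounded {ι : Type*} {s t : ι → G} (hs : Tendsto s cofinite cofinite)
    (m : ℕ) (hm : ∀ i, S.cayley.dist (s i) (t i) ≤ m) :
    Tendsto (fun i => dist (of f S (s i)) (of f S (t i))) cofinite (𝓝 0) := by
  obtain ⟨C, -, hd⟩ := S.exists_floydDist_le f m
  have h1 : Tendsto (fun i => C * f (S.len (s i))) cofinite (𝓝 (C * 0)) :=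
    ((f.tendsto_zero.comp S.tendsto_len).comp hs).const_mul C
  rw [mul_zero] at h1
  exact squeeze_zero (fun _ => dist_nonneg) (fun i => hd _ _ (hm i)) h1

/-- A geodesic joins every far point to the sphere of radius `N` at cost at most the tail from `N`
on, so a finite ball is an `ε`-net. -/
theorem totallyBounded : TotallyBounded (univ : Set (FloydSpace f S)) := by
  refine Metric.totallyBounded_iff.2 fun ε hε => ?_
  obtain ⟨N, hN⟩ := ((f.tendsto_tail.eventually (gt_mem_nhds hε)).and
    (eventually_ge_atTop 1)).exists
  refine ⟨of f S '' {g : G | S.len g ≤ N}, (S.finite_len_le N).image _, fun (g : G) _ => ?_⟩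
  by_cases hg : S.len g ≤ N
  · exact mem_iUnion₂.2 ⟨of f S g, ⟨g, hg, rfl⟩, Metric.mem_ball_self hε⟩
  -- Since `N ≥ 1`, the identity lies inside, and the geodesic enters the outer region at length
  -- exactly `N`.
  · have h1 : (1 : G) ∉ {g : G | N ≤ S.len g} := fun h => by
      have h : N ≤ S.len 1 := h
      rw [S.len_one] at h
      omega
    obtain ⟨k, hk, k', hk', -, hl, hd⟩ := S.exists_entrance f {g : G | N ≤ S.len g} h1
      (g := g) (show N ≤ S.len g by omega)
    have hk : N ≤ S.len k := hk
    have hk' : ¬ N ≤ S.len k' := hk'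
    refine mem_iUnion₂.2 ⟨of f S k, ⟨k, show S.len k ≤ N by omega, rfl⟩, ?_⟩
    refine Metric.mem_ball'.2 ?_
    exact (hd.trans (f.tail_anti hk)).trans_lt hN.1

end FloydSpace

/-! ### Matching asymptotically dense families -/

/-- In an infinite totally bounded metric space almost all points have infinitely many points
close to them. -/
theorem TotallyBounded.eventually_infinite {Y : Type*} [PseudoMetricSpace Y]
    (hY : TotallyBounded (univ : Set Y)) {ε : ℝ} (hε : 0 < ε) :
    ∀ᶠ y : Y in cofinite, {z | dist y z < ε}.Infinite := by
  obtain ⟨t, ht, hcov⟩ := Metric.totallyBounded_iff.1 hY (ε / 2) (half_pos hε)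
  -- The exceptional points are those covered by the finite balls of the net; any other point shares
  -- a ball of radius `ε / 2` with infinitely many points.
  have hfin : (⋃ y ∈ {y ∈ t | (Metric.ball y (ε / 2)).Finite}, Metric.ball y (ε / 2)).Finite :=
    (ht.subset (sep_subset _ _)).biUnion fun y hy => hy.2
  refine hfin.subset fun y hy => ?_
  obtain ⟨c, hc, hyc⟩ := mem_iUnion₂.1 (hcov (mem_univ y))
  refine mem_iUnion₂.2 ⟨c, ⟨hc, ?_⟩, hyc⟩
  refine (not_infinite.1 hy).subset fun z hz => ?_
  have h1 := dist_triangle_right y z c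
  rw [Metric.mem_ball] at hyc hz
  exact mem_ofPred_eq ▸ (by linarith : dist y z < ε)

/-- Greedy choice along an enumeration: at each stage only finitely many partners have been used. -/
theorem exists_injective_of_infinite_rel {γ δ : Type*} [Countable γ] (Q : γ → δ → Prop)
    (hQ : ∀ a, {b | Q a b}.Infinite) : ∃ g : γ → δ, Function.Injective g ∧ ∀ a, Q a (g a) := by
  obtain ⟨c, hc⟩ := exists_injective_nat γ
  classical
  have hex : ∀ (s : Finset δ) (a : γ), ∃ b, Q a b ∧ b ∉ s := fun s a =>
    (hQ a).exists_notMem_finset s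
  choose pick hpick hnot using hex
  let used : ℕ → Finset δ := fun n => Nat.rec ∅
    (fun n s => if h : ∃ a, c a = n then insert (pick s h.choose) s else s) n
  have hused : ∀ n, used (n + 1) =
    if h : ∃ a, c a = n then insert (pick (used n) h.choose) (used n) else used n := fun _ => rfl
  have hmono : Monotone used := monotone_nat_of_le_succ fun n => by
    rw [hused]
    split
    · exact Finset.subset_insert _ _
    · exact le_rfl
  have hin : ∀ a, pick (used (c a)) a ∈ used (c a + 1) := by
    intro a
    have hex : ∃ a', c a' = c a := ⟨a, rfl⟩
    have : hex.choose = a := hc hex.choose_spec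
    rw [hused, dif_pos hex, this]
    exact Finset.mem_insert_self _ _
  have hne : ∀ a b, c a < c b → pick (used (c a)) a ≠ pick (used (c b)) b := by
    intro a b hab heq
    exact hnot (used (c b)) b (heq ▸ hmono (Nat.succ_le_of_lt hab) (hin a))
  refine ⟨fun a => pick (used (c a)) a, fun a b hab => ?_, fun a => hpick _ _⟩
  rcases lt_trichotomy (c a) (c b) with h | h | h
  · exact absurd hab (hne a b h)
  · exact hc h
  · exact absurd hab.symm (hne b a h)

/-- A relation between two countable sets in which every element is related to infinitely many
elements contains a bijection. -/
theorem exists_equiv_of_infinite_rel {α β : Type*} [Countable α] [Countable β] (R : α → β → Prop)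
    (h1 : ∀ a, {b | R a b}.Infinite) (h2 : ∀ b, {a | R a b}.Infinite) :
    ∃ e : α ≃ β, ∀ a, R a (e a) := by
  obtain ⟨F, hF, hRF⟩ := exists_injective_of_infinite_rel R h1
  obtain ⟨F', hF', hRF'⟩ := exists_injective_of_infinite_rel (fun b a => R a b) h2
  -- The Schröder–Bernstein bijection agrees at each point with `F` or with the inverse of `F'`, so
  -- it stays inside the relation.
  obtain ⟨e, he, hR⟩ := Function.Embedding.schroeder_bernstein_of_rel hF hF' R hRF
    (fun b => hRF' b)
  exact ⟨Equiv.ofBijective e he, hR⟩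

/-- The radius is nearly the infimum of the admissible ones. Boundedness makes some radius
admissible for every point, and by hypothesis any `ε > 0` is admissible for almost all points. -/
theorem exists_radius {D D' Y : Type*} [Countable D] [Infinite D'] [PseudoMetricSpace Y]
    (hY : Bornology.IsBounded (univ : Set Y)) (q : D → Y) (q' : D' → Y)
    (h : ∀ ε > 0, ∀ᶠ x in cofinite, {x' | dist (q x) (q' x') < ε}.Infinite) :
    ∃ r : D → ℝ, Tendsto r cofinite (𝓝 0) ∧ ∀ x, {x' | dist (q x) (q' x') < r x}.Infinite := by
  obtain ⟨c, hc⟩ := exists_injective_nat D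
  obtain ⟨M, hM⟩ := Metric.isBounded_iff.1 hY
  let I : D → Set ℝ := fun x => {r | 0 ≤ r ∧ {x' | dist (q x) (q' x') < r}.Infinite}
  have hI : ∀ x, (I x).Nonempty := by
    intro x
    have h1 : {x' | dist (q x) (q' x') < max M 0 + 1} = univ := by
      refine eq_univ_of_forall fun x' => ?_
      have h2 := hM (mem_univ (q x)) (mem_univ (q' x'))
      have h3 := le_max_left M 0
      exact show dist (q x) (q' x') < max M 0 + 1 by linarith
    exact ⟨max M 0 + 1, by positivity, h1 ▸ infinite_univ⟩
  have hb : ∀ x, BddBelow (I x) := fun x => ⟨0, fun r hr => hr.1⟩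
  have hpos : ∀ x, (0 : ℝ) < 1 / ((c x : ℝ) + 1) := fun x => by positivity
  -- The infimum need not be admissible; a positive summand that tends to 0 along the enumeration
  -- `c` repairs this.
  refine ⟨fun x => sInf (I x) + 1 / ((c x : ℝ) + 1), ?_, fun x => ?_⟩
  · have h1 : Tendsto (fun x => sInf (I x)) cofinite (𝓝 0) := by
      refine Metric.tendsto_nhds.2 fun ε hε => ?_
      filter_upwards [h (ε / 2) (half_pos hε)] with x hx
      rw [Real.dist_0_eq_abs, abs_of_nonneg (Real.sInf_nonneg fun r hr => hr.1)]
      exact (csInf_le (hb x) ⟨(half_pos hε).le, hx⟩).trans_lt (half_lt_self hε)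
    have h2 : Tendsto (fun x => 1 / ((c x : ℝ) + 1)) cofinite (𝓝 0) :=
      tendsto_one_div_add_atTop_nhds_zero_nat.comp
        ((Nat.cofinite_eq_atTop ▸ hc.tendsto_cofinite : Tendsto c cofinite atTop))
    simpa using h1.add h2
  · obtain ⟨r, hr, hlt⟩ := exists_lt_of_csInf_lt (hI x) (lt_add_of_pos_right (sInf (I x)) (hpos x))
    refine hr.2.mono fun x' hx' => ?_
    exact lt_trans (show dist (q x) (q' x') < r from hx') hlt

/-- If only finitely many indices gave points near `y`, these points would be isolated with a common
radius `η`. Almost all of the infinitely many points close to `y` are approximated by the family to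
within `η`, so they would coincide with one of these finitely many points. -/
theorem eventually_infinite_dist_lt {D Y : Type*} [PseudoMetricSpace Y]
    (hY : TotallyBounded (univ : Set Y))
    (hiso : ∀ y : Y, ∃ δ > 0, ∀ z, dist y z < δ → y = z) (q : D → Y)
    (hd : ∀ ε > 0, ∀ᶠ y in cofinite, ∃ x, dist (q x) y < ε) {ε : ℝ} (hε : 0 < ε) :
    ∀ᶠ y in cofinite, {x | dist y (q x) < ε}.Infinite := by
  filter_upwards [hY.eventually_infinite (half_pos hε)] with y hy hfin
  have hfin' := hfin.image q
  choose δ hδ hδ' using hiso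
  obtain ⟨η, hη, hη'⟩ : ∃ η > 0, ∀ z ∈ q '' {x | dist y (q x) < ε}, η ≤ δ z := by
    rcases (q '' {x | dist y (q x) < ε}).eq_empty_or_nonempty with h | h
    · exact ⟨1, one_pos, by simp [h]⟩
    · obtain ⟨z, hz, hmin⟩ := exists_min_image _ δ hfin' h
      exact ⟨δ z, hδ z, hmin⟩
  have hgood := hd (min η (ε / 2)) (lt_min hη (half_pos hε))
  have hinf := hy.sdiff hgood
  refine hinf (hfin'.subset fun z hz => ?_)
  obtain ⟨x, hx⟩ := not_not.1 hz.2
  have hyz : dist y z < ε / 2 := hz.1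
  have h1 := dist_triangle_right y (q x) z
  have h2 := hx.trans_le (min_le_right _ _)
  have hmem : x ∈ {x | dist y (q x) < ε} := show dist y (q x) < ε by linarith
  refine ⟨x, hmem, hδ' _ _ ?_⟩
  exact (hx.trans_le (min_le_left _ _)).trans_le (hη' _ ⟨x, hmem, rfl⟩)

/-- Two families of points of a discrete totally bounded metric space that are finite-to-one and
asymptotically dense can be matched such that matched points are asymptotically close. -/
theorem exists_equiv_tendsto_dist {D D' Y : Type*} [Countable D] [Countable D'] [Infinite D]
    [Infinite D'] [PseudoMetricSpace Y] (hY : TotallyBounded (univ : Set Y))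
    (hiso : ∀ y : Y, ∃ δ > 0, ∀ z, dist y z < δ → y = z) (q : D → Y) (q' : D' → Y)
    (hq : Tendsto q cofinite cofinite) (hq' : Tendsto q' cofinite cofinite)
    (hd : ∀ ε > 0, ∀ᶠ y in cofinite, ∃ x, dist (q x) y < ε)
    (hd' : ∀ ε > 0, ∀ᶠ y in cofinite, ∃ x, dist (q' x) y < ε) :
    ∃ e : D ≃ D', Tendsto (fun x => dist (q x) (q' (e x))) cofinite (𝓝 0) := by
  obtain ⟨r, hr, hrinf⟩ := exists_radius hY.isBounded q q' fun ε hε =>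
    hq.eventually (eventually_infinite_dist_lt hY hiso q' hd' hε)
  obtain ⟨r', hr', hrinf'⟩ := exists_radius hY.isBounded q' q fun ε hε =>
    hq'.eventually (eventually_infinite_dist_lt hY hiso q hd hε)
  -- Allowing the larger of the two radii gives infinitely many partners on both sides, and both
  -- radii tend to 0 along a bijection.
  obtain ⟨e, he⟩ := exists_equiv_of_infinite_rel
    (fun x x' => dist (q x) (q' x') < max (r x) (r' x'))
    (fun x => (hrinf x).mono fun x' (hx' : dist (q x) (q' x') < r x) =>
      show dist (q x) (q' x') < max (r x) (r' x') from lt_max_of_lt_left hx')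
    (fun x' => (hrinf' x').mono fun x (hx : dist (q' x') (q x) < r' x') =>
      show dist (q x) (q' x') < max (r x) (r' x') from lt_max_of_lt_right (dist_comm _ (q x) ▸ hx))
  refine ⟨e, squeeze_zero (fun _ => dist_nonneg) (fun x => (he x).le) ?_⟩
  have := hr.max (hr'.comp e.injective.tendsto_cofinite)
  rwa [max_self] at this

/-! ### Asymptotic control and tree-like families -/

/-- Outside a finite set of indices, the points of the second family are close whenever those of
the first one are. -/
def AsympControl {ι X X' : Type*} [Dist X] [Dist X'] (s : ι → X) (s' : ι → X') : Prop :=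
  ∀ ε > 0, ∃ δ > 0, ∃ F : Set ι, F.Finite ∧
    ∀ x ∉ F, ∀ y ∉ F, dist (s x) (s y) < δ → dist (s' x) (s' y) < ε

namespace AsympControl

variable {ι X X' X'' : Type*} [PseudoMetricSpace X] [PseudoMetricSpace X'] [PseudoMetricSpace X'']

theorem trans {s : ι → X} {s' : ι → X'} {s'' : ι → X''} (h : AsympControl s s')
    (h' : AsympControl s' s'') : AsympControl s s'' := by
  intro ε hε
  obtain ⟨δ', hδ', F', hF', h'⟩ := h' ε hε
  obtain ⟨δ, hδ, F, hF, h⟩ := h δ' hδ'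
  refine ⟨δ, hδ, F ∪ F', hF.union hF', fun x hx y hy hxy => ?_⟩
  exact h' x (fun h => hx (Or.inr h)) y (fun h => hy (Or.inr h))
    (h x (fun h => hx (Or.inl h)) y (fun h => hy (Or.inl h)) hxy)

theorem of_tendsto {s t : ι → X} (h : Tendsto (fun i => dist (s i) (t i)) cofinite (𝓝 0)) :
    AsympControl s t := by
  intro ε hε
  have h1 := h.eventually (gt_mem_nhds (by positivity : (0 : ℝ) < ε / 3))
  refine ⟨ε / 3, by positivity, _, h1, fun x hx y hy hxy => ?_⟩
  have hx : dist (s x) (t x) < ε / 3 := not_not.1 hx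
  have hy : dist (s y) (t y) < ε / 3 := not_not.1 hy
  have h2 := dist_triangle4 (t x) (s x) (s y) (t y)
  rw [dist_comm (t x) (s x)] at h2
  linarith

theorem of_tendsto' {s t : ι → X} (h : Tendsto (fun i => dist (s i) (t i)) cofinite (𝓝 0)) :
    AsympControl t s :=
  of_tendsto (h.congr fun _ => dist_comm _ _)

theorem of_lipschitz {s : ι → X} {s' : ι → X'} {C : ℝ} (hC : 0 < C)
    (h : ∀ x y, dist (s' x) (s' y) ≤ C * dist (s x) (s y)) : AsympControl s s' := by
  intro ε hε
  refine ⟨ε / C, by positivity, ∅, finite_empty, fun x _ y _ hxy => (h x y).trans_lt ?_⟩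
  rwa [lt_div_iff₀' hC] at hxy

theorem comp {κ : Type*} {s : ι → X} {s' : ι → X'} (h : AsympControl s s') (e : κ → ι)
    (he : Function.Injective e) : AsympControl (s ∘ e) (s' ∘ e) := by
  intro ε hε
  obtain ⟨δ, hδ, F, hF, h⟩ := h ε hε
  exact ⟨δ, hδ, e ⁻¹' F, hF.preimage he.injOn, fun x hx y hy hxy => h _ hx _ hy hxy⟩

end AsympControl

/-- A family of points indexed by the nonempty words in a prefix-closed language such that the
sets of points whose words have a given prefix become small and are uniformly separated from
their complements. -/
structure IsTreeLike {Λ X : Type*} [Dist X] (V : Set (List Λ)) (p : List Λ → X) : Prop where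
  small : ∀ ε > 0, {v | v ∈ V ∧ v ≠ [] ∧ ∃ w ∈ V, v <+: w ∧ ε ≤ dist (p v) (p w)}.Finite
  sep : ∀ v ∈ V, v ≠ [] → ∃ δ > 0, ∀ w ∈ V, ∀ w' ∈ V, w' ≠ [] → v <+: w → ¬ v <+: w' →
    δ ≤ dist (p w) (p w')
  inj : ∀ w ∈ V, ∀ w' ∈ V, w ≠ [] → w' ≠ [] → p w = p w' → w = w'

theorem Set.Finite.exists_pos_le {α : Type*} {s : Set α} (hs : s.Finite) (δ : α → ℝ)
    (hδ : ∀ a ∈ s, 0 < δ a) : ∃ c > 0, ∀ a ∈ s, c ≤ δ a := by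
  rcases s.eq_empty_or_nonempty with rfl | h
  · exact ⟨1, one_pos, by simp⟩
  · obtain ⟨a, ha, hmin⟩ := exists_min_image s δ hs h
    exact ⟨δ a, hδ a ha, hmin⟩

/-- Two tree-like families indexed by the same words are uniformly equivalent if they are so
on the sets of one-letter extensions of words. -/
theorem IsTreeLike.uniform_comparison {Λ X X' : Type*} [PseudoMetricSpace X]
    [PseudoMetricSpace X'] {p : List Λ → X} {p' : List Λ → X'} (hp : IsTreeLike univ p)
    (hp' : IsTreeLike univ p') (hiso : ∀ x : X, ∃ δ > 0, ∀ y, dist x y < δ → x = y)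
    (hc : ∀ v, AsympControl (fun x => p (v ++ [x])) (fun x => p' (v ++ [x]))) :
    ∀ ε > 0, ∃ δ > 0, ∀ w w', w ≠ [] → w' ≠ [] → dist (p w) (p w') < δ →
      dist (p' w) (p' w') < ε := by
  intro ε hε
  have hε3 : 0 < ε / 3 := by positivity
  choose d hd A hA hdA using fun v => hc v (ε / 3) hε3
  -- `F` contains every word with an extension at distance at least `ε / 3` in the second family.
  -- The empty word is added so that every word has a prefix in `F`.
  set F : Set (List Λ) := insert [] (⋃ u ∈ {v | v ∈ univ ∧ v ≠ [] ∧
    ∃ w ∈ univ, v <+: w ∧ ε / 3 ≤ dist (p' v) (p' w)}, {v | v <+: u}) with hF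
  have hFfin : F.Finite := by
    refine Finite.insert _ ((hp'.small _ hε3).biUnion fun u _ => ?_)
    exact (List.finite_toSet u.inits).subset fun v hv => (List.mem_inits v u).2 hv
  have hFsmall : ∀ v w, v ≠ [] → v ∉ F → v <+: w → dist (p' v) (p' w) < ε / 3 := by
    intro v w hv hvF hvw
    by_contra hlt
    refine hvF (Or.inr (mem_iUnion₂.2 ⟨v, ⟨mem_univ _, hv, w, mem_univ _, hvw, not_lt.1 hlt⟩, ?_⟩))
    exact List.prefix_refl v
  obtain ⟨η, hη, hηd⟩ := hFfin.exists_pos_le d fun v _ => hd v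
  have hη3 : 0 < η / 3 := by positivity
  -- `G` adds the words with far extensions in the first family, on the scale `η / 3`, and the
  -- letters after words of `F` at which the asymptotic control is not available.
  set G : Set (List Λ) := (F ∪ {v | v ∈ univ ∧ v ≠ [] ∧
    ∃ w ∈ univ, v <+: w ∧ η / 3 ≤ dist (p v) (p w)}) ∪ ⋃ v ∈ F, (fun x => v ++ [x]) '' A v with hG
  have hGfin : G.Finite :=
    (hFfin.union (hp.small _ hη3)).union (hFfin.biUnion fun v _ => (hA v).image _)
  have hGsmall : ∀ v w, v ≠ [] → v ∉ G → v <+: w → dist (p v) (p w) < η / 3 := by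
    intro v w hv hvG hvw
    by_contra hlt
    exact hvG (Or.inl (Or.inr ⟨mem_univ _, hv, w, mem_univ _, hvw, not_lt.1 hlt⟩))
  -- `κ v` serves both to separate the shadow of `v` from its complement and to isolate the point of
  -- `v` itself.
  have hsep : ∀ v : List Λ, ∃ δ > 0, v ≠ [] → (∀ w w', w' ≠ [] → v <+: w → ¬ v <+: w' →
      δ ≤ dist (p w) (p w')) ∧ ∀ w, w ≠ [] → dist (p v) (p w) < δ → v = w := by
    intro v
    by_cases hv : v = []
    · exact ⟨1, one_pos, fun h => absurd hv h⟩
    · obtain ⟨δ, hδ, h⟩ := hp.sep v (mem_univ v) hv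
      obtain ⟨δ', hδ', h'⟩ := hiso (p v)
      refine ⟨min δ δ', lt_min hδ hδ', fun _ => ⟨fun w w' hw' h1 h2 => ?_, fun w hw hvw => ?_⟩⟩
      · exact (min_le_left _ _).trans (h w (mem_univ _) w' (mem_univ _) hw' h1 h2)
      · exact hp.inj v (mem_univ _) w (mem_univ _) hv hw
          (h' _ (hvw.trans_le (min_le_right _ _)))
  choose κ hκ hκG using hsep
  obtain ⟨c, hcpos, hcκ⟩ := hGfin.exists_pos_le κ fun v _ => hκ v
  refine ⟨min (η / 3) c, lt_min hη3 hcpos, fun w w' hw hw' hww' => ?_⟩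
  have hwc := hww'.trans_le (min_le_right _ _)
  have hwη := hww'.trans_le (min_le_left _ _)
  -- Closer than all separation constants of `G`, two words have the same prefixes in `G`. It
  -- remains to compare them beyond their longest common prefix `v` in `F`.
  have hsame : ∀ v ∈ G, v ≠ [] → (v <+: w ↔ v <+: w') := by
    intro v hvG hv
    constructor
    · intro h
      by_contra h'
      exact absurd ((hcκ v hvG).trans ((hκG v hv).1 w w' hw' h h')) (not_le.2 hwc)
    · intro h
      by_contra h'
      rw [dist_comm] at hwc
      exact absurd ((hcκ v hvG).trans ((hκG v hv).1 w' w hw h h')) (not_le.2 hwc)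
  have hFG : F ⊆ G := fun v hv => Or.inl (Or.inl hv)
  obtain ⟨v, ⟨hvF, hvw⟩, hmax⟩ := exists_max_image {v | v ∈ F ∧ v <+: w} List.length
    (hFfin.subset fun v hv => hv.1) ⟨[], Or.inl rfl, List.nil_prefix⟩
  by_cases heq : w = w'
  · rw [heq, dist_self]; exact hε
  have hvw' : v <+: w' := by
    by_cases hv : v = []
    · rw [hv]; exact List.nil_prefix
    · exact (hsame v (hFG hvF) hv).1 hvw
  obtain ⟨t, rfl⟩ := hvw
  obtain ⟨t', rfl⟩ := hvw'
  -- Isolation excludes that one of the two distinct words is `v` itself, unless `v` is empty, which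
  -- is not allowed for either.
  have hnv : ∀ u, u ≠ [] → dist (p v) (p (v ++ u)) < c → v ≠ [] → False := by
    intro u hu hlt hv
    have := (hκG v hv).2 (v ++ u) (by simp [hv]) (hlt.trans_le (hcκ v (hFG hvF)))
    exact hu (by simpa using this.symm)
  cases t with
  | nil =>
    cases t' with
    | nil => exact absurd rfl heq
    | cons y t' =>
      rw [List.append_nil] at hw hwc
      exact absurd hw (fun h => hnv _ (by simp) hwc h)
  | cons x t =>
    cases t' with
    | nil =>
      rw [List.append_nil] at hw' hwc
      rw [dist_comm] at hwc
      exact absurd hw' (fun h => hnv _ (by simp) hwc h)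
    | cons y t' =>
      have hpre : ∀ (z z' : Λ) (u : List Λ), v ++ [z] <+: v ++ z' :: u ↔ z = z' := by
        intro z z' u
        rw [List.prefix_append_right_inj]
        simp [List.cons_prefix_cons]
      have hx : v ++ [x] ∉ F := by
        intro h
        have := hmax _ ⟨h, (hpre x x t).2 rfl⟩
        simp at this
      have hd1 := hFsmall _ _ (by simp) hx ((hpre x x t).2 rfl)
      have hy : v ++ [y] ∉ F := by
        intro h
        have h1 := (hsame _ (hFG h) (by simp)).2 ((hpre y y t').2 rfl)
        have := hmax _ ⟨h, h1⟩
        simp at this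
      have hd2 := hFsmall _ _ (by simp) hy ((hpre y y t').2 rfl)
      have htri := dist_triangle4 (p' (v ++ x :: t)) (p' (v ++ [x])) (p' (v ++ [y]))
        (p' (v ++ y :: t'))
      rw [dist_comm (p' (v ++ x :: t)) (p' (v ++ [x]))] at htri
      by_cases hxy : x = y
      · rw [hxy, dist_self] at htri
        subst hxy
        linarith
      -- With different next letters neither extension can be in `G`. So the points of `v ++ [x]`
      -- and `v ++ [y]` are closer than `η` in the first family, and the control at `v` applies.
      · have hxG : v ++ [x] ∉ G := fun h => hxy
          ((hpre x y t').1 ((hsame _ h (by simp)).1 ((hpre x x t).2 rfl)))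
        have hyG : v ++ [y] ∉ G := fun h => hxy
          ((hpre y x t).1 ((hsame _ h (by simp)).2 ((hpre y y t').2 rfl))).symm
        have hxA : x ∉ A v := fun h => hxG (Or.inr (mem_iUnion₂.2 ⟨v, hvF, x, h, rfl⟩))
        have hyA : y ∉ A v := fun h => hyG (Or.inr (mem_iUnion₂.2 ⟨v, hvF, y, h, rfl⟩))
        have h1 := hGsmall _ _ (by simp) hxG ((hpre x x t).2 rfl)
        have h2 := hGsmall _ _ (by simp) hyG ((hpre y y t').2 rfl)
        have h3 := dist_triangle4 (p (v ++ [x])) (p (v ++ x :: t)) (p (v ++ y :: t'))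
          (p (v ++ [y]))
        rw [dist_comm (p (v ++ y :: t')) (p (v ++ [y]))] at h3
        have h4 := hdA v x hxA y hyA (by linarith [hηd v hvF])
        linarith

/-! ### Remainders of completions -/

section Remainder

open UniformSpace

/-- The points of the completion that are not in the space itself. -/
abbrev CompletionRemainder (X : Type*) [UniformSpace X] : Type _ :=
  {x : Completion X // x ∉ range ((↑) : X → Completion X)}

variable {X X' : Type*} [MetricSpace X] [MetricSpace X']

/-- A finite subset of `X` is closed in the completion and misses `ξ`, so asymptotic statements on
`X` hold near `ξ`. -/
theorem comap_nhds_remainder_le (ξ : Completion X) (hξ : ξ ∉ range ((↑) : X → Completion X)) :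
    comap ((↑) : X → Completion X) (𝓝 ξ) ≤ cofinite := by
  intro s hs
  have hcl : IsClosed (((↑) : X → Completion X) '' sᶜ) :=
    ((show sᶜ.Finite from hs).image _).isClosed
  refine ⟨(((↑) : X → Completion X) '' sᶜ)ᶜ, hcl.isOpen_compl.mem_nhds ?_, fun x hx => ?_⟩
  · rintro ⟨x, -, rfl⟩
    exact hξ ⟨x, rfl⟩
  · by_contra hxs
    exact hx ⟨x, hxs, rfl⟩

instance comap_nhds_neBot (ξ : Completion X) :
    (comap ((↑) : X → Completion X) (𝓝 ξ)).NeBot :=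
  Completion.isDenseInducing_coe.comap_nhds_neBot ξ

/-- If the image were a point `y` of the space, isolation of `y` would force `φ x = y` for all `x`
near `ξ`, against finiteness of the fibres. -/
theorem completion_map_notMem_range (hiso : ∀ x : X', ∃ δ > 0, ∀ y, dist x y < δ → x = y)
    {φ : X → X'} (hφ : UniformContinuous φ) (hφ' : Tendsto φ cofinite cofinite)
    (ξ : Completion X) (hξ : ξ ∉ range ((↑) : X → Completion X)) :
    Completion.map φ ξ ∉ range ((↑) : X' → Completion X') := by
  rintro ⟨y, hy⟩
  obtain ⟨δ, hδ, h⟩ := hiso y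
  have h1 : Tendsto (fun x : X => (φ x : Completion X')) (comap (↑) (𝓝 ξ)) (𝓝 (y : _)) := by
    have := ((Completion.continuous_map (f := φ)).tendsto ξ).comp
      (tendsto_comap : Tendsto ((↑) : X → Completion X) _ (𝓝 ξ))
    rw [← hy] at this
    exact this.congr fun x => Completion.map_coe hφ x
  have h2 := h1.eventually (Metric.ball_mem_nhds _ hδ)
  have h3 : ∀ᶠ x in comap ((↑) : X → Completion X) (𝓝 ξ), φ x ≠ y :=
    (hφ'.mono_left (comap_nhds_remainder_le ξ hξ)).eventually (eventually_cofinite_ne y)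
  obtain ⟨x, hx, hne⟩ := (h2.and h3).exists
  refine hne (h _ ?_).symm
  rwa [dist_comm, Completion.dist_eq] at hx

/-- Near `ξ` the composite is asymptotic to the identity, so both have the same limit there. -/
theorem completion_map_map_eq {φ : X → X'} {ψ : X' → X} (hφ : UniformContinuous φ)
    (hψ : UniformContinuous ψ)
    (h : Tendsto (fun x => dist (ψ (φ x)) x) cofinite (𝓝 0)) (ξ : Completion X)
    (hξ : ξ ∉ range ((↑) : X → Completion X)) : Completion.map ψ (Completion.map φ ξ) = ξ := by
  have h1 : Tendsto ((↑) : X → Completion X) (comap (↑) (𝓝 ξ)) (𝓝 ξ) := tendsto_comap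
  have h2 := (((Completion.continuous_map (f := ψ)).comp
    (Completion.continuous_map (f := φ))).tendsto ξ).comp h1
  refine tendsto_nhds_unique (h2.congr_dist ?_) h1
  refine (h.mono_left (comap_nhds_remainder_le ξ hξ)).congr fun x => ?_
  simp only [Function.comp_apply]
  rw [Completion.map_coe hφ, Completion.map_coe hψ, Completion.dist_eq]

/-- Mutually asymptotically inverse uniformly continuous maps induce a homeomorphism of the
remainders of the completions. -/
theorem nonempty_homeomorph_remainder (hiso : ∀ x : X, ∃ δ > 0, ∀ y, dist x y < δ → x = y)
    (hiso' : ∀ x : X', ∃ δ > 0, ∀ y, dist x y < δ → x = y)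
    {φ : X → X'} {ψ : X' → X} (hφ : UniformContinuous φ) (hψ : UniformContinuous ψ)
    (hφ' : Tendsto φ cofinite cofinite) (hψ' : Tendsto ψ cofinite cofinite)
    (h : Tendsto (fun x => dist (ψ (φ x)) x) cofinite (𝓝 0))
    (h' : Tendsto (fun x => dist (φ (ψ x)) x) cofinite (𝓝 0)) :
    Nonempty (CompletionRemainder X ≃ₜ CompletionRemainder X') := by
  refine ⟨⟨⟨fun ξ => ⟨Completion.map φ ξ.1, completion_map_notMem_range hiso' hφ hφ' _ ξ.2⟩,
    fun ξ => ⟨Completion.map ψ ξ.1, completion_map_notMem_range hiso hψ hψ' _ ξ.2⟩,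
    fun ξ => Subtype.ext (completion_map_map_eq hφ hψ h _ ξ.2),
    fun ξ => Subtype.ext (completion_map_map_eq hψ hφ h' _ ξ.2)⟩, ?_, ?_⟩⟩
  · exact (Completion.continuous_map.comp continuous_subtype_val).subtype_mk _
  · exact (Completion.continuous_map.comp continuous_subtype_val).subtype_mk _

/-- Almost all points of the fibre over `w` are so close to the isolated point `p w` that they equal
it. -/
theorem tendsto_cofinite_of_tendsto_dist {W : Type*} {p : W → X}
    (hiso : ∀ x : X, ∃ δ > 0, ∀ y, dist x y < δ → x = y) {r : X → W}
    (hr : Tendsto (fun x => dist (p (r x)) x) cofinite (𝓝 0)) : Tendsto r cofinite cofinite := by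
  refine Tendsto.cofinite_of_finite_preimage_singleton fun w => ?_
  obtain ⟨δ, hδ, h⟩ := hiso (p w)
  have := hr.eventually (gt_mem_nhds hδ)
  refine (Set.Finite.union this (finite_singleton (p w))).subset fun x hx => ?_
  by_cases hd : dist (p (r x)) x < δ
  · right
    rw [show r x = w from hx] at hd
    exact (h x hd).symm
  · exact Or.inl hd

/-- Off a finite set `p ∘ r` is almost the identity, and the uniform comparison applies. The
finitely many other points are isolated with a common radius `c`. -/
theorem uniformContinuous_comp_of_tendsto_dist {W : Type*} {p : W → X} {p' : W → X'}
    (hiso : ∀ x : X, ∃ δ > 0, ∀ y, dist x y < δ → x = y)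
    (hpp' : ∀ ε > 0, ∃ δ > 0, ∀ w w', dist (p w) (p w') < δ → dist (p' w) (p' w') < ε)
    {r : X → W} (hr : Tendsto (fun x => dist (p (r x)) x) cofinite (𝓝 0)) :
    UniformContinuous (p' ∘ r) := by
  refine Metric.uniformContinuous_iff.2 fun ε hε => ?_
  obtain ⟨δ, hδ, h⟩ := hpp' ε hε
  have hfin := hr.eventually (gt_mem_nhds (by positivity : 0 < δ / 3))
  choose d hd hdi using hiso
  obtain ⟨c, hc, hcd⟩ := Set.Finite.exists_pos_le hfin d fun x _ => hd x
  refine ⟨min c (δ / 3), lt_min hc (by positivity), fun {x y} hxy => ?_⟩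
  have hxc := hxy.trans_le (min_le_left _ _)
  have hxδ := hxy.trans_le (min_le_right _ _)
  by_cases hx : dist (p (r x)) x < δ / 3
  · by_cases hy : dist (p (r y)) y < δ / 3
    · refine h _ _ ?_
      have := dist_triangle4 (p (r x)) x y (p (r y))
      rw [dist_comm y] at this
      linarith
    · have := hdi y x (by rw [dist_comm]; exact hxc.trans_le (hcd y hy))
      rw [this, dist_self]
      exact hε
  · have := hdi x y (hxc.trans_le (hcd x hx))
    rw [this, dist_self]
    exact hε

/-- The word `r' (p' (r x))` has almost the same `p'`-image as `r x`, hence almost the same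
`p`-image, which is close to `x`. -/
theorem tendsto_dist_of_family {W : Type*} {p : W → X} {p' : W → X'}
    (hp' : Function.Injective p')
    (h : ∀ ε > 0, ∃ δ > 0, ∀ w w', dist (p' w) (p' w') < δ → dist (p w) (p w') < ε)
    {r : X → W} (hr : Tendsto r cofinite cofinite)
    (hpr : Tendsto (fun x => dist (p (r x)) x) cofinite (𝓝 0))
    {r' : X' → W} (hpr' : Tendsto (fun x => dist (p' (r' x)) x) cofinite (𝓝 0)) :
    Tendsto (fun x => dist ((p ∘ r') ((p' ∘ r) x)) x) cofinite (𝓝 0) := by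
  have h1 : Tendsto (fun x => dist (p (r' (p' (r x)))) (p (r x))) cofinite (𝓝 0) := by
    refine Metric.tendsto_nhds.2 fun ε hε => ?_
    obtain ⟨δ, hδ, hlt⟩ := h ε hε
    have h2 := ((hpr'.comp hp'.tendsto_cofinite).comp hr).eventually (gt_mem_nhds hδ)
    filter_upwards [h2] with x hx
    rw [Real.dist_0_eq_abs, abs_of_nonneg dist_nonneg]
    exact hlt _ _ hx
  have h2 := h1.add hpr
  rw [add_zero] at h2
  exact squeeze_zero (fun _ => dist_nonneg) (fun x => dist_triangle _ _ _) h2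

/-- Two spaces with asymptotically dense, uniformly equivalent families of points have homeomorphic
remainders. -/
theorem nonempty_homeomorph_remainder_of_family {W : Type*} {p : W → X} {p' : W → X'}
    (hiso : ∀ x : X, ∃ δ > 0, ∀ y, dist x y < δ → x = y)
    (hiso' : ∀ x : X', ∃ δ > 0, ∀ y, dist x y < δ → x = y)
    (hp : Function.Injective p) (hp' : Function.Injective p')
    (hpp' : ∀ ε > 0, ∃ δ > 0, ∀ w w', dist (p w) (p w') < δ → dist (p' w) (p' w') < ε)
    (hp'p : ∀ ε > 0, ∃ δ > 0, ∀ w w', dist (p' w) (p' w') < δ → dist (p w) (p w') < ε)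
    (hr : ∃ r : X → W, Tendsto (fun x => dist (p (r x)) x) cofinite (𝓝 0))
    (hr' : ∃ r' : X' → W, Tendsto (fun x => dist (p' (r' x)) x) cofinite (𝓝 0)) :
    Nonempty (CompletionRemainder X ≃ₜ CompletionRemainder X') := by
  obtain ⟨r, hr⟩ := hr
  obtain ⟨r', hr'⟩ := hr'
  have hrc := tendsto_cofinite_of_tendsto_dist hiso hr
  have hrc' := tendsto_cofinite_of_tendsto_dist hiso' hr'
  exact nonempty_homeomorph_remainder hiso hiso'
    (uniformContinuous_comp_of_tendsto_dist hiso hpp' hr)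
    (uniformContinuous_comp_of_tendsto_dist hiso' hp'p hr')
    (hp'.tendsto_cofinite.comp hrc) (hp.tendsto_cofinite.comp hrc')
    (tendsto_dist_of_family hp' hp'p hrc hr hr')
    (tendsto_dist_of_family hp hpp' hrc' hr' hr)

end Remainder

/-! ### Normal forms in amalgamated products -/

/-- The words whose `i`-th letter belongs to `D i`. -/
def IsWord {Λ : Type*} (D : ℕ → Set Λ) (w : List Λ) : Prop :=
  ∀ i (h : i < w.length), w[i] ∈ D i

namespace IsWord

variable {Λ : Type*} {D : ℕ → Set Λ}

theorem nil : IsWord D [] := fun _ h => absurd h (Nat.not_lt_zero _)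

theorem append_singleton {u : List Λ} {z : Λ} :
    IsWord D (u ++ [z]) ↔ IsWord D u ∧ z ∈ D u.length := by
  refine ⟨fun h => ⟨fun i hi => ?_, ?_⟩, fun h i hi => ?_⟩
  · have := h i (by simp; omega)
    rwa [List.getElem_append_left hi] at this
  · simpa using h u.length (by simp)
  · rcases Nat.lt_or_ge i u.length with hlt | hge
    · rw [List.getElem_append_left hlt]
      exact h.1 i hlt
    · have : i = u.length := by simp at hi; omega
      subst this
      simpa using h.2

theorem of_prefix {v w : List Λ} (hw : IsWord D w) (hvw : v <+: w) : IsWord D v := by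
  intro i hi
  rw [hvw.getElem hi]
  exact hw i _

theorem cons {x : Λ} {l : List Λ} :
    IsWord D (x :: l) ↔ x ∈ D 0 ∧ IsWord (fun n => D (n + 1)) l := by
  refine ⟨fun h => ⟨h 0 (by simp), fun i hi => ?_⟩, fun h i hi => ?_⟩
  · exact h (i + 1) (by simpa using hi)
  · cases i with
    | zero => exact h.1
    | succ i => exact h.2 i (by simpa using hi)

end IsWord

section Words

variable {K : Type*} [Group K]

/-- The common subgroup of two subgroups. -/
def core (P : Bool → Subgroup K) : Subgroup K := P true ⊓ P false

theorem core_le (P : Bool → Subgroup K) (b : Bool) : core P ≤ P b := by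
  cases b
  · exact inf_le_right
  · exact inf_le_left

/-- The letters of the list are alternately taken from the two subgroups, but not from the
common subgroup. -/
def IsAlternating (P : Bool → Subgroup K) : Bool → List K → Prop
  | _, [] => True
  | b, x :: l => (x ∈ P b ∧ x ∉ core P) ∧ IsAlternating P (!b) l

/-- The group is the amalgamated product of two subgroups over their intersection. -/
structure IsAmalgam (P : Bool → Subgroup K) : Prop where
  closure_eq : Subgroup.closure ((P true : Set K) ∪ P false) = ⊤
  notMem : ∀ b l, IsAlternating P b l → l ≠ [] → l.prod ∉ core P

/-- `T b` is a set of representatives of the left cosets of the common subgroup in `P b`. -/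
structure IsTransversalPair (P : Bool → Subgroup K) (T : Bool → Set K) : Prop where
  subset : ∀ b, T b ⊆ P b
  one_mem : ∀ b, 1 ∈ T b
  exists_mem : ∀ b, ∀ g ∈ P b, ∃ t ∈ T b, t⁻¹ * g ∈ core P
  unique : ∀ b, ∀ t ∈ T b, ∀ t' ∈ T b, t⁻¹ * t' ∈ core P → t = t'

theorem exists_isTransversalPair (P : Bool → Subgroup K) : ∃ T, IsTransversalPair P T := by
  classical
  -- One representative for each coset in `K`, normalised to be 1 on the core; it serves both
  -- factors, because the coset of an element of `P b` lies in `P b`.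
  let rep : K → K := fun g => if g ∈ core P then 1 else Quotient.out (g : K ⧸ core P)
  have hrep : ∀ g, g⁻¹ * rep g ∈ core P := by
    intro g
    by_cases hg : g ∈ core P
    · simp only [rep, if_pos hg, mul_one]
      exact inv_mem hg
    · simp only [rep, if_neg hg]
      exact QuotientGroup.eq.1 (Quotient.out_eq (g : K ⧸ core P)).symm
  have hcongr : ∀ g h, g⁻¹ * h ∈ core P → rep g = rep h := by
    intro g h hgh
    have h1 : g ∈ core P ↔ h ∈ core P := by
      constructor
      · intro hg; simpa using mul_mem hg hgh
      · intro hh; simpa using mul_mem hh (inv_mem hgh)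
    have h2 : (g : K ⧸ core P) = h := QuotientGroup.eq.2 hgh
    simp only [rep, h1, h2]
  refine ⟨fun b => {x | x ∈ P b ∧ rep x = x}, fun b x hx => hx.1,
    fun b => ⟨one_mem _, by simp [rep, one_mem]⟩, fun b g hg => ⟨rep g, ⟨?_, ?_⟩, ?_⟩, ?_⟩
  · simpa using mul_mem hg (core_le P b (hrep g))
  · exact (hcongr _ _ (hrep g)).symm
  · simpa using inv_mem (hrep g)
  · intro b t ht t' ht' h
    rw [← ht.2, ← ht'.2]
    exact hcongr _ _ h

/-- The side of the `n`-th letter of an alternating word whose first letter is on side `b`. -/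
def side : Bool → ℕ → Bool
  | b, 0 => b
  | b, n + 1 => side (!b) n

theorem side_succ (b : Bool) (n : ℕ) : side b (n + 1) = !side b n := by
  induction n generalizing b with
  | zero => rfl
  | succ n ih => exact ih (!b)

/-- The letters allowed at the `n`-th place of a normal form: representatives of the cosets,
nontrivial except at the first place. -/
def letters (T : Bool → Set K) (b : Bool) : ℕ → Set K
  | 0 => T b
  | n + 1 => T (side b (n + 1)) \ {1}

variable {P : Bool → Subgroup K} {T : Bool → Set K}

theorem letters_subset (b : Bool) (n : ℕ) : letters T b n ⊆ T (side b n) := by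
  cases n
  · exact le_rfl
  · exact sdiff_subset

theorem IsTransversalPair.notMem_core (hT : IsTransversalPair P T) {b : Bool} {t : K}
    (ht : t ∈ T b) (h1 : t ≠ 1) : t ∉ core P := fun h =>
  h1 (hT.unique b 1 (hT.one_mem b) t ht (by simpa using h)).symm

theorem IsTransversalPair.isAlternating (hT : IsTransversalPair P T) {b : Bool} {l : List K}
    (hl : IsWord (fun n => T (side b n) \ {1}) l) : IsAlternating P b l := by
  induction l generalizing b with
  | nil => trivial
  | cons x l ih =>
    obtain ⟨h1, h2⟩ := IsWord.cons.1 hl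
    exact ⟨⟨hT.subset b h1.1, hT.notMem_core h1.1 h1.2⟩, ih h2⟩

/-- The inverse of `l` ends with a letter from the side opposite to the first letter of `m`, so the
alternation continues across the junction. -/
theorem IsAlternating.exists_append {b : Bool} {l m : List K} (hm : IsAlternating P b m)
    (hl : IsAlternating P (!b) l) :
    ∃ c, IsAlternating P c ((l.map (·⁻¹)).reverse ++ m) := by
  induction l generalizing b m with
  | nil => exact ⟨b, by simpa using hm⟩
  | cons y l ih =>
    obtain ⟨⟨hy, hy'⟩, hl⟩ := hl
    rw [List.map_cons, List.reverse_cons, List.append_assoc]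
    refine ih (b := !b) (m := y⁻¹ :: m) ⟨⟨inv_mem hy, fun h => hy' (by simpa using h)⟩, ?_⟩ hl
    rwa [Bool.not_not]

/-- Different representatives leave the letter `x⁻¹ * x'` outside the core in the middle, so there
is no cancellation. -/
theorem IsAmalgam.notMem_of_ne (hP : IsAmalgam P) (hT : IsTransversalPair P T) {b : Bool}
    {x x' : K} {l l' : List K} (hx : x ∈ T b) (hx' : x' ∈ T b) (hne : x ≠ x')
    (hl : IsAlternating P (!b) l) (hl' : IsAlternating P (!b) l') :
    (x :: l).prod⁻¹ * (x' :: l').prod ∉ core P := by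
  have hm : IsAlternating P b (x⁻¹ * x' :: l') :=
    ⟨⟨mul_mem (inv_mem (hT.subset b hx)) (hT.subset b hx'), fun h =>
      hne (hT.unique b x hx x' hx' h)⟩, hl'⟩
  obtain ⟨c, hc⟩ := hm.exists_append hl
  have := hP.notMem c _ hc (by simp)
  have heq : ((l.map (·⁻¹)).reverse ++ (x⁻¹ * x' :: l')).prod =
      (x :: l).prod⁻¹ * (x' :: l').prod := by
    rw [List.prod_append, ← List.prod_inv_reverse]
    simp only [List.prod_cons, mul_inv_rev, mul_assoc]
  rwa [heq] at this

theorem IsAmalgam.eq_of_mem_core_tail (hP : IsAmalgam P) (hT : IsTransversalPair P T) {b : Bool}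
    {l l' : List K} (hl : IsWord (fun n => T (side b n) \ {1}) l)
    (hl' : IsWord (fun n => T (side b n) \ {1}) l') (h : l.prod⁻¹ * l'.prod ∈ core P) :
    l = l' := by
  induction l generalizing l' b with
  | nil =>
    by_contra hne
    refine hP.notMem b l' (hT.isAlternating hl') (fun h => hne h.symm) (by simpa using h)
  | cons x l ih =>
    cases l' with
    | nil =>
      refine absurd ?_ (hP.notMem b _ (hT.isAlternating hl) (by simp))
      simpa only [List.prod_nil, mul_one, inv_mem_iff] using h
    | cons x' l' =>
      obtain ⟨hx, hm⟩ := IsWord.cons.1 hl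
      obtain ⟨hx', hm'⟩ := IsWord.cons.1 hl'
      by_cases hxx' : x = x'
      · subst hxx'
        rw [ih (b := !b) hm hm' (by simpa [mul_assoc] using h)]
      · exact absurd h (hP.notMem_of_ne hT hx.1 hx'.1 hxx' (hT.isAlternating (b := !b) hm)
          (hT.isAlternating (b := !b) hm'))

/-- Normal forms are unique. -/
theorem IsAmalgam.eq_of_mem_core (hP : IsAmalgam P) (hT : IsTransversalPair P T) {b : Bool}
    {w w' : List K} (hw : IsWord (letters T b) w) (hw' : IsWord (letters T b) w') (hne : w ≠ [])
    (hne' : w' ≠ []) (h : w.prod⁻¹ * w'.prod ∈ core P) : w = w' := by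
  cases w with
  | nil => exact absurd rfl hne
  | cons x l =>
    cases w' with
    | nil => exact absurd rfl hne'
    | cons x' l' =>
      obtain ⟨hx, hl⟩ := IsWord.cons.1 hw
      obtain ⟨hx', hl'⟩ := IsWord.cons.1 hw'
      by_cases hxx' : x = x'
      · subst hxx'
        rw [hP.eq_of_mem_core_tail hT (b := !b) hl hl' (by simpa [mul_assoc] using h)]
      · exact absurd h (hP.notMem_of_ne hT hx hx' hxx' (hT.isAlternating (b := !b) hl)
          (hT.isAlternating (b := !b) hl'))

/-- Right multiplication by an element of one of the two subgroups changes at most the last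
letter of a normal form or appends one letter. -/
theorem IsTransversalPair.exists_mul (hT : IsTransversalPair P T) {b c : Bool} {w : List K}
    (hw : IsWord (letters T b) w) (hne : w ≠ []) {k s : K} (hk : w.prod⁻¹ * k ∈ core P)
    (hs : s ∈ P c) : ∃ w', IsWord (letters T b) w' ∧ w' ≠ [] ∧ w.dropLast <+: w' ∧
      w'.prod⁻¹ * (k * s) ∈ core P := by
  obtain ⟨u, z, rfl⟩ : ∃ u z, w = u ++ [z] := ⟨_, _, (List.dropLast_append_getLast hne).symm⟩
  rw [List.dropLast_concat]
  obtain ⟨hu, hz⟩ := IsWord.append_singleton.1 hw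
  have hzP := hT.subset _ (letters_subset b _ hz)
  set h := (u ++ [z]).prod⁻¹ * k with hh
  have hk' : k = u.prod * z * h := by rw [hh]; simp [mul_assoc]
  by_cases hc : c = side b u.length
  · subst hc
    obtain ⟨t, ht, hth⟩ := hT.exists_mem _ (z * h * s) (mul_mem (mul_mem hzP (core_le P _ hk)) hs)
    -- The last letter is replaced by `t`. It disappears if `t = 1`, except at the first place,
    -- where 1 is an allowed letter.
    by_cases ht1 : t = 1 ∧ u ≠ []
    · refine ⟨u, hu, ht1.2, List.prefix_refl _, ?_⟩
      rw [ht1.1] at hth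
      simpa [hk', mul_assoc] using hth
    · refine ⟨u ++ [t], IsWord.append_singleton.2 ⟨hu, ?_⟩, by simp, List.prefix_append _ _, ?_⟩
      · cases u with
        | nil => exact ht
        | cons a u => exact ⟨ht, fun h1 => ht1 ⟨h1, by simp⟩⟩
      · simpa [hk', mul_assoc] using hth
  · have hc' : c = side b (u ++ [z]).length := by
      rw [List.length_append, List.length_singleton, side_succ]
      exact Bool.eq_not.2 hc
    -- On the other side, `t` becomes an additional last letter unless it is trivial.
    obtain ⟨t, ht, hth⟩ := hT.exists_mem _ (h * s) (mul_mem (core_le P _ hk) hs)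
    by_cases ht1 : t = 1
    · refine ⟨u ++ [z], hw, hne, List.prefix_append _ _, ?_⟩
      rw [ht1] at hth
      simpa [hk', mul_assoc] using hth
    · refine ⟨u ++ [z] ++ [t], IsWord.append_singleton.2 ⟨hw, ?_⟩, by simp,
        by rw [List.append_assoc]; exact List.prefix_append _ _, ?_⟩
      · subst hc'
        rw [List.length_append, List.length_singleton] at ht ⊢
        exact ⟨ht, ht1⟩
      · simpa [hk', mul_assoc] using hth

theorem IsAmalgam.induction (hP : IsAmalgam P) {motive : K → Prop} (one : motive 1)
    (mul : ∀ x c, ∀ s ∈ P c, motive x → motive (x * s)) (k : K) : motive k := by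
  have hk : k ∈ Subgroup.closure ((P true : Set K) ∪ P false) := by rw [hP.closure_eq]; trivial
  induction hk using Subgroup.closure_induction_right with
  | one => exact one
  | mul_right x hx y hy ih =>
    rcases hy with hy | hy
    · exact mul x true y hy ih
    · exact mul x false y hy ih
  | mul_inv_cancel x hx y hy ih =>
    rcases hy with hy | hy
    · exact mul x true _ (inv_mem hy) ih
    · exact mul x false _ (inv_mem hy) ih

/-- Every element has a normal form. -/
theorem IsAmalgam.exists_word (hP : IsAmalgam P) (hT : IsTransversalPair P T) (b : Bool) (k : K) :
    ∃ w, IsWord (letters T b) w ∧ w ≠ [] ∧ w.prod⁻¹ * k ∈ core P := by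
  induction k using hP.induction with
  | one =>
    refine ⟨[1], ?_, by simp, by simp [one_mem]⟩
    exact IsWord.cons.2 ⟨hT.one_mem b, IsWord.nil⟩
  | mul x c s hs ih =>
    obtain ⟨w, hw, hne, hwx⟩ := ih
    obtain ⟨w', hw', hne', -, h⟩ := hT.exists_mul hw hne hwx hs
    exact ⟨w', hw', hne', h⟩

/-! ### Shadows and the tree-like structure -/

/-- The elements whose normal form has the prefix `v`. -/
def shadow (P : Bool → Subgroup K) (T : Bool → Set K) (b : Bool) (v : List K) : Set K :=
  {k | ∃ w, IsWord (letters T b) w ∧ v <+: w ∧ w.prod⁻¹ * k ∈ core P}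

/-- Only the last letter of the normal form can be lost, so the prefix `v` survives unless `v` is
the whole normal form. -/
theorem IsTransversalPair.mul_mem_shadow_or (hT : IsTransversalPair P T) {b c : Bool}
    {v : List K} (hv : v ≠ []) {k s : K} (hk : k ∈ shadow P T b v) (hs : s ∈ P c) :
    k * s ∈ shadow P T b v ∨ v.prod⁻¹ * k ∈ core P := by
  obtain ⟨w, hw, ⟨u, rfl⟩, hwk⟩ := hk
  by_cases hu : u = []
  · subst hu
    rw [List.append_nil] at hwk
    exact Or.inr hwk
  · obtain ⟨w', hw', -, hpre, h⟩ := hT.exists_mul hw (by simp [hv]) hwk hs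
    refine Or.inl ⟨w', hw', ?_, h⟩
    rw [List.dropLast_append_of_ne_nil hu] at hpre
    exact (List.prefix_append _ _).trans hpre

/-- Right multiplication by a fixed element leaves or enters a shadow only in a bounded
neighbourhood of its base point. -/
theorem IsAmalgam.exists_crossing_finite (hP : IsAmalgam P) (hT : IsTransversalPair P T)
    (hfin : (core P : Set K).Finite) (b : Bool) (s : K) :
    ∃ Q : Set K, Q.Finite ∧ ∀ v ≠ [], ∀ k,
      ¬ (k ∈ shadow P T b v ↔ k * s ∈ shadow P T b v) → v.prod⁻¹ * k ∈ Q := by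
  induction s using hP.induction with
  | one => exact ⟨∅, finite_empty, fun v _ k h => absurd (by rw [mul_one]) h⟩
  | mul x c s hs ih =>
    obtain ⟨Q, hQ, h⟩ := ih
    -- A change of shadow at the last factor `s` means that `k * x` or `k * x * s` lies in the core
    -- translated by the product of `v`. The resulting set does not depend on `v`.
    refine ⟨Q ∪ ((fun q => q * x⁻¹) '' (core P) ∪ (fun q => q * (x * s)⁻¹) '' (core P)),
      hQ.union ((hfin.image _).union (hfin.image _)), fun v hv k hk => ?_⟩
    by_cases h1 : k ∈ shadow P T b v ↔ k * x ∈ shadow P T b v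
    · rw [h1, ← mul_assoc] at hk
      right
      by_cases h2 : k * x ∈ shadow P T b v
      · rcases hT.mul_mem_shadow_or hv h2 hs with h3 | h3
        · exact absurd (iff_of_true h2 h3) hk
        · exact Or.inl ⟨_, h3, by group⟩
      · have h3 : k * x * s ∈ shadow P T b v := by
          by_contra h3
          exact hk (iff_of_false h2 h3)
        rcases hT.mul_mem_shadow_or hv h3 (inv_mem hs) with h4 | h4
        · rw [mul_inv_cancel_right] at h4
          exact absurd h4 h2
        · exact Or.inr ⟨_, h4, by group⟩
    · exact Or.inl (h v hv k h1)

theorem IsAmalgam.prod_mem_shadow_iff (hP : IsAmalgam P) (hT : IsTransversalPair P T) {b : Bool}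
    {v w : List K} (hv : v ≠ []) (hw : IsWord (letters T b) w) (hne : w ≠ []) :
    w.prod ∈ shadow P T b v ↔ v <+: w := by
  constructor
  · rintro ⟨w', hw', hvw', h⟩
    have hne' : w' ≠ [] := fun h => hv (List.prefix_nil.1 (h ▸ hvw'))
    exact hP.eq_of_mem_core hT hw' hw hne' hne h ▸ hvw'
  · exact fun h => ⟨w, hw, h, by simp [one_mem]⟩

/-- The normal form of the identity is `[1]`, the first place being allowed the trivial letter. So
geodesics from `1` have to enter all other proper shadows. -/
theorem IsAmalgam.one_notMem_shadow (hP : IsAmalgam P) (hT : IsTransversalPair P T) {b : Bool}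
    {v : List K} (hv : v ≠ []) (hv1 : v ≠ [1]) : (1 : K) ∉ shadow P T b v := by
  have h1 : IsWord (letters T b) [1] := IsWord.cons.2 ⟨hT.one_mem b, IsWord.nil⟩
  intro h
  have := (hP.prod_mem_shadow_iff hT hv h1 (by simp)).1 (by simpa using h)
  rcases List.prefix_concat_iff (l₂ := []).1 this with h | h
  · exact hv1 h
  · exact hv (List.prefix_nil.1 h)

/-- The elements of an amalgamated product over a finite group, indexed by normal forms, form a
tree-like family in the Floyd metric of any generating set. -/
theorem IsAmalgam.isTreeLike (hP : IsAmalgam P) (hT : IsTransversalPair P T)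
    (hfin : (core P : Set K).Finite) (b : Bool) (f : FloydFunction) (S : FinGenSet K) :
    IsTreeLike {w | IsWord (letters T b) w} (fun w => FloydSpace.of f S w.prod) := by
  have hinj : ∀ w, IsWord (letters T b) w → ∀ w', IsWord (letters T b) w' → w ≠ [] → w' ≠ [] →
      w.prod = w'.prod → w = w' := fun w hw w' hw' hne hne' h =>
    hP.eq_of_mem_core hT hw hw' hne hne' (by simp [h, one_mem])
  -- All edges across the boundary of a shadow are uniformly near its base point, because there are
  -- finitely many generators.
  have hQ : ∃ Q : Set K, Q.Finite ∧ ∀ v ≠ [], ∀ k k', S.cayley.Adj k k' →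
      ¬ (k ∈ shadow P T b v ↔ k' ∈ shadow P T b v) → v.prod⁻¹ * k ∈ Q := by
    choose Q hQ h using hP.exists_crossing_finite hT hfin b
    refine ⟨⋃ s ∈ S.carrier, (Q s ∪ Q s⁻¹), S.finite.biUnion fun s _ => (hQ s).union (hQ _),
      fun v hv k k' hkk' hne => ?_⟩
    obtain ⟨-, s, hs, rfl | rfl⟩ := S.cayley_adj.1 hkk'
    · exact mem_iUnion₂.2 ⟨s, hs, Or.inl (h s v hv k hne)⟩
    · exact mem_iUnion₂.2 ⟨s, hs, Or.inr (h s⁻¹ v hv _ (by simpa using hne))⟩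
  obtain ⟨Q, hQfin, hQ⟩ := hQ
  obtain ⟨m, hm⟩ := (hQfin.image S.len).bddAbove
  have hm : ∀ q ∈ Q, S.len q ≤ m := fun q hq => hm ⟨q, hq, rfl⟩
  refine ⟨fun ε hε => ?_, fun v hvV hv => ?_, fun w hw w' hw' hne hne' h =>
    hinj w hw w' hw' hne hne' h⟩
  · obtain ⟨C, hC, hd⟩ := S.exists_floydDist_le f m
    -- The first term bounds the way from the base point to the entrance of the shadow, the second
    -- one the way from the entrance to any word product in it.
    have hlim : Tendsto (fun n => C * f n + f.tail (n - m)) atTop (𝓝 0) := by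
      have := (f.tendsto_zero.const_mul C).add (f.tendsto_tail.comp (tendsto_sub_atTop_nat m))
      simpa using this
    have hev := S.tendsto_len.eventually (hlim.eventually (gt_mem_nhds hε))
    have hinj' : InjOn List.prod {v : List K | IsWord (letters T b) v ∧ v ≠ []} :=
      fun w hw w' hw' h => hinj w hw.1 w' hw'.1 hw.2 hw'.2 h
    have hpre : ({v : List K | IsWord (letters T b) v ∧ v ≠ []} ∩ List.prod ⁻¹'
        {k | ¬ (C * f (S.len k) + f.tail (S.len k - m) < ε)}).Finite := by
      refine Set.Finite.of_finite_image (hev.subset ?_) (hinj'.mono inter_subset_left)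
      rintro _ ⟨v, hv, rfl⟩
      exact hv.2
    refine (hpre.union (finite_singleton [1])).subset fun v hv => ?_
    obtain ⟨hvV, hv, w, hw, hvw, hε'⟩ := hv
    by_cases hv1 : v = [1]
    · exact Or.inr hv1
    · refine Or.inl ⟨⟨hvV, hv⟩, fun hlt => ?_⟩
      have hne : w ≠ [] := fun h => hv (List.prefix_nil.1 (h ▸ hvw))
      obtain ⟨k, hk, k', hk', hadj, hlen, hdist⟩ := S.exists_entrance f _
        (hP.one_notMem_shadow hT hv hv1) ((hP.prod_mem_shadow_iff hT hv hw hne).2 hvw)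
      have hkQ := hQ v hv k k' hadj.symm (fun h => hk' (h.1 hk))
      have h1 := S.dist_self_mul v.prod (v.prod⁻¹ * k)
      rw [mul_inv_cancel_left] at h1
      have h2 := hm _ hkQ
      have h3 := hd v.prod k (h1.trans_le h2)
      have h4 := S.len_le_add_dist k v.prod
      rw [SimpleGraph.dist_comm, h1] at h4
      have h5 := f.tail_anti (show S.len v.prod - m ≤ S.len k by omega)
      have h6 := S.floydDist_triangle f v.prod k w.prod
      have h7 : ε ≤ S.floydDist f v.prod w.prod := hε'
      have hlt : C * f (S.len v.prod) + f.tail (S.len v.prod - m) < ε := hlt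
      linarith
  -- The edges that leave the shadow start in the finite set `v.prod * Q`, so their lengths have a
  -- positive lower bound.
  · obtain ⟨c, hc, hcf⟩ := (hQfin.image (fun q => v.prod * q)).exists_pos_le
      (fun k => f (S.len k + 1)) fun k _ => f.pos_all _
    refine ⟨c, hc, fun w hw w' hw' hne' hvw hvw' => ?_⟩
    have hne : w ≠ [] := fun h => hv (List.prefix_nil.1 (h ▸ hvw))
    refine S.le_floydDist_of_crossing f (shadow P T b v) c (fun g h hg hh hgh => ?_)
      ((hP.prod_mem_shadow_iff hT hv hw hne).2 hvw)
      (fun h => hvw' ((hP.prod_mem_shadow_iff hT hv hw' hne').1 h))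
    have := hQ v hv g h hgh (fun hiff => hh (hiff.1 hg))
    refine (hcf g ⟨_, this, mul_inv_cancel_left _ _⟩).trans (f.antitone ?_)
    exact (min_le_left _ _).trans (Nat.le_succ _)

end Words

/-! ### Retraction onto a factor and the Floyd metric of the factor -/

section Retraction

variable {K : Type*} [Group K] {P : Bool → Subgroup K} {T : Bool → Set K}

theorem IsAmalgam.exists_word_cons (hP : IsAmalgam P) (hT : IsTransversalPair P T) (b : Bool)
    (k : K) : ∃ x l, IsWord (letters T b) (x :: l) ∧ (x :: l).prod⁻¹ * k ∈ core P := by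
  obtain ⟨w, hw, hne, h⟩ := hP.exists_word hT b k
  cases w with
  | nil => exact absurd rfl hne
  | cons x l => exact ⟨x, l, hw, h⟩

/-- A factor of an amalgamated product is a retract of the set of its elements, in such a way
that right multiplication by an element of a factor moves the image only at the factor. -/
theorem IsAmalgam.exists_retraction (hP : IsAmalgam P) (b : Bool) :
    ∃ r : K → K, (∀ k ∈ P b, r k = k) ∧ (∀ k, r k ∈ P b) ∧ ∀ k c, ∀ s ∈ P c,
      r k = r (k * s) ∨ (k ∈ P b ∧ k * s ∈ P b) ∨
        ((k ∈ P b ∨ k * s ∈ P b) ∧ (r k)⁻¹ * r (k * s) ∈ core P) := by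
  classical
  obtain ⟨T, hT⟩ := exists_isTransversalPair P
  choose x l hword hcore using hP.exists_word_cons hT b
  have hxT : ∀ k, x k ∈ T b := fun k => (IsWord.cons.1 (hword k)).1
  have huniq : ∀ k y m, IsWord (letters T b) (y :: m) → (y :: m).prod⁻¹ * k ∈ core P →
      x k = y ∧ l k = m := by
    intro k y m hw h
    have := hP.eq_of_mem_core hT (hword k) hw (by simp) (by simp)
      (by simpa [mul_assoc] using mul_mem (hcore k) (inv_mem h))
    exact List.cons.inj this
  -- An element `s` leading out of `P b` is from the other side. It appends a letter to the
  -- representative `t` of `k`, so the first letter after the step is still `t`, in the coset of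
  -- `k`.
  have hleave : ∀ k c, ∀ s ∈ P c, k ∈ P b → k * s ∉ P b → k⁻¹ * x (k * s) ∈ core P := by
    intro k c s hs hk hks
    have hc : c = !b := by
      by_contra h
      have : c = b := by simpa using Bool.eq_not_of_ne h
      exact hks (mul_mem hk (this ▸ hs))
    subst hc
    obtain ⟨t, ht, htk⟩ := hT.exists_mem b k hk
    obtain ⟨t', ht', ht'k⟩ := hT.exists_mem (!b) (t⁻¹ * k * s) (mul_mem (core_le P _ htk) hs)
    have ht'1 : t' ≠ 1 := by
      rintro rfl
      refine hks ?_
      have h1 := mul_mem (hT.subset b ht) (core_le P b ht'k)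
      simpa [mul_assoc] using h1
    have hw : IsWord (letters T b) [t, t'] :=
      IsWord.cons.2 ⟨ht, IsWord.cons.2 ⟨⟨ht', ht'1⟩, IsWord.nil⟩⟩
    rw [(huniq (k * s) t [t'] hw (by simpa [mul_assoc] using ht'k)).1]
    simpa using inv_mem htk
  -- Outside the factor, the retraction reads off the first letter of the normal form.
  refine ⟨fun k => if k ∈ P b then k else x k, fun k hk => if_pos hk, fun k => ?_,
    fun k c s hs => ?_⟩
  · by_cases hk : k ∈ P b
    · simpa only [if_pos hk] using hk
    · simpa only [if_neg hk] using! hT.subset b (hxT k)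
  · by_cases hk : k ∈ P b
    · by_cases hks : k * s ∈ P b
      · exact Or.inr (Or.inl ⟨hk, hks⟩)
      · simp only [if_pos hk, if_neg hks]
        exact Or.inr (Or.inr ⟨Or.inl hk, hleave k c s hs hk hks⟩)
    · by_cases hks : k * s ∈ P b
      · simp only [if_neg hk, if_pos hks]
        have := hleave (k * s) c s⁻¹ (inv_mem hs) hks (by simpa using hk)
        rw [mul_inv_cancel_right] at this
        exact Or.inr (Or.inr ⟨Or.inr hks, by simpa [mul_assoc] using inv_mem this⟩)
      · simp only [if_neg hk, if_neg hks]
        left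
        -- Outside the factor normal forms have at least two letters, and multiplication preserves
        -- all but the last.
        have hl : l k ≠ [] := by
          intro hl
          have h1 := hcore k
          rw [hl, List.prod_singleton] at h1
          refine hk ?_
          simpa using mul_mem (hT.subset b (hxT k)) (core_le P b h1)
        obtain ⟨w', hw', hne, hpre, h⟩ := hT.exists_mul (hword k) (by simp) (hcore k) hs
        cases w' with
        | nil => exact absurd rfl hne
        | cons y m =>
          rw [List.dropLast_cons_of_ne_nil hl, List.cons_prefix_cons] at hpre
          rw [(huniq _ y m hw' h).1, hpre.1]

end Retraction

theorem FinGenSet.dist_map_le {G G' : Type*} [Group G] [Group G'] (S : FinGenSet G)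
    (S' : FinGenSet G') (φ : G → G')
    (hφ : ∀ g h, S.cayley.Adj g h → φ g = φ h ∨ S'.cayley.Adj (φ g) (φ h)) (g h : G) :
    S'.cayley.dist (φ g) (φ h) ≤ S.cayley.dist g h := by
  generalize hn : S.cayley.dist g h = n
  induction n generalizing h with
  | zero => rw [S.connected.dist_eq_zero_iff.1 hn, SimpleGraph.dist_self]
  | succ n ih =>
    obtain ⟨w, hw, hd⟩ := S.connected.exists_adj_dist_eq hn
    have h1 := S'.connected.dist_triangle (u := φ g) (v := φ w) (w := φ h)
    have h3 := ih w hd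
    rcases hφ w h hw with heq | hadj
    · rw [heq] at h3
      omega
    · have h2 := SimpleGraph.dist_eq_one_iff_adj.2 hadj
      omega

/-- The Floyd metric of a factor of an amalgamated product is equivalent to the restriction of
the Floyd metric of the amalgamated product. -/
theorem IsAmalgam.floydDist_factor {A K : Type*} [Group A] [Group K] {P : Bool → Subgroup K}
    (hP : IsAmalgam P) (b : Bool) (f : FloydFunction) (SA : FinGenSet A) (S : FinGenSet K)
    (α : A →* K) (hα : Function.Injective α) (hrange : α.range = P b)
    (hS : ∀ s ∈ S.carrier, ∃ c, s ∈ P c) (hSA : ∀ a ∈ SA.carrier, α a ∈ S.carrier)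
    (hSb : ∀ s ∈ S.carrier, s ∈ P b → s ∉ core P → s ∈ α '' SA.carrier)
    (hcore : ∀ h ∈ core P, h ≠ 1 → h ∈ α '' SA.carrier) :
    (∀ a, S.len (α a) = SA.len a) ∧
    (∀ a a', S.floydDist f (α a) (α a') ≤ SA.floydDist f a a') ∧
    ∃ C : ℝ, 0 < C ∧ ∀ a a', SA.floydDist f a a' ≤ C * S.floydDist f (α a) (α a') := by
  obtain ⟨r, hr, hrP, hrs⟩ := hP.exists_retraction b
  have hpre : ∀ k, ∃ a, α a = r k := fun k => by
    have := hrP k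
    rw [← hrange] at this
    exact this
  choose ρ hρ using hpre
  have hρα : ∀ a, ρ (α a) = a := fun a => hα (by rw [hρ, hr _ (hrange ▸ ⟨a, rfl⟩)])
  have hαadj : ∀ a a', SA.cayley.Adj a a' → S.cayley.Adj (α a) (α a') := by
    intro a a' h
    obtain ⟨hne, h⟩ := SA.adj_iff_inv_mul.1 h
    refine S.adj_iff_inv_mul.2 ⟨fun h => hne (hα h), h.imp (fun h => ?_) fun h => ?_⟩
    · simpa using hSA _ h
    · simpa using hSA _ h
  have hmemP : ∀ s ∈ P b, s ∈ S.carrier ∨ s ∈ core P → s = 1 ∨ s ∈ α '' SA.carrier := by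
    intro s hs h
    by_cases hs1 : s = 1
    · exact Or.inl hs1
    · by_cases hsc : s ∈ core P
      · exact Or.inr (hcore s hsc hs1)
      · exact Or.inr (hSb s (h.resolve_right hsc) hs hsc)
  have hstep : ∀ a a' : A, (α a)⁻¹ * α a' = 1 ∨ (α a)⁻¹ * α a' ∈ α '' SA.carrier →
      a = a' ∨ SA.cayley.Adj a a' := by
    rintro a a' (h | ⟨s, hs, h⟩)
    · exact Or.inl (hα (inv_mul_eq_one.1 h))
    · by_cases hne : a = a'
      · exact Or.inl hne
      · refine Or.inr (SA.adj_iff_inv_mul.2 ⟨hne, Or.inl ?_⟩)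
        rw [← map_inv, ← map_mul] at h
        rwa [← hα h]
  -- The retraction collapses an edge or maps it to an edge with an end in the factor as its source.
  -- Crossing the border moves the image by a core element, and nontrivial core elements are
  -- generators.
  have hmul : ∀ k, ∀ s ∈ S.carrier, ρ k = ρ (k * s) ∨
      (SA.cayley.Adj (ρ k) (ρ (k * s)) ∧ (k ∈ P b ∨ k * s ∈ P b)) := by
    intro k s hs
    obtain ⟨c, hc⟩ := hS s hs
    rcases hrs k c s hc with h | ⟨hk, hks⟩ | ⟨hk, hmem⟩
    · exact Or.inl (hα (by rw [hρ, hρ, h]))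
    · have h1 : (α (ρ k))⁻¹ * α (ρ (k * s)) = s := by
        rw [hρ, hρ, hr k hk, hr _ hks, inv_mul_cancel_left]
      refine (hstep (ρ k) (ρ (k * s)) ?_).imp id fun h => ⟨h, Or.inl hk⟩
      rw [h1]
      exact hmemP s (by simpa using mul_mem (inv_mem hk) hks) (Or.inl hs)
    · refine (hstep (ρ k) (ρ (k * s)) ?_).imp id fun h => ⟨h, hk⟩
      rw [hρ, hρ]
      exact hmemP _ (core_le P b hmem) (Or.inr hmem)
  have hρadj : ∀ k k', S.cayley.Adj k k' → ρ k = ρ k' ∨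
      (SA.cayley.Adj (ρ k) (ρ k') ∧ (k ∈ P b ∨ k' ∈ P b)) := by
    intro k k' h
    obtain ⟨-, s, hs, rfl | rfl⟩ := S.cayley_adj.1 h
    · exact hmul k s hs
    · exact (hmul k' s hs).imp Eq.symm fun h => ⟨h.1.symm, h.2.symm⟩
  have hlen : ∀ a, S.len (α a) = SA.len a := by
    intro a
    have h1 := SA.dist_map_le S α (fun g h hgh => Or.inr (hαadj g h hgh)) 1 a
    have h2 := S.dist_map_le SA ρ (fun g h hgh => (hρadj g h hgh).imp id And.left) (α 1) (α a)
    rw [hρα, hρα] at h2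
    rw [map_one] at h1 h2
    exact le_antisymm h1 h2
  obtain ⟨C, hC, hsh⟩ := f.exists_shift_le 1
  refine ⟨hlen, fun a a' => ?_, C, hC, fun a a' => ?_⟩
  · have := SA.floydDist_map_le f f S α 1 (fun g h hgh => by
      rw [one_mul]
      refine (S.floydDist_le_edgeLength f (hαadj g h hgh)).trans (le_of_eq ?_)
      rw [FinGenSet.edgeLength, FinGenSet.edgeLength, hlen, hlen]) one_pos a a'
    rwa [one_mul] at this
  -- An edge that is not collapsed has an end in the factor, where the retraction preserves the
  -- length; the other end of the image is at distance 1, whence the shift by 1.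
  · have hkey : ∀ k k', SA.cayley.Adj (ρ k) (ρ k') → k ∈ P b →
        SA.floydDist f (ρ k) (ρ k') ≤ C * S.edgeLength f k k' := by
      intro k k' hadj hk
      have h1 : SA.len (ρ k) = S.len k := by rw [← hlen, hρ, hr k hk]
      have h2 := SA.len_le_succ_of_adj hadj.symm
      calc SA.floydDist f (ρ k) (ρ k') ≤ SA.edgeLength f (ρ k) (ρ k') :=
            SA.floydDist_le_edgeLength f hadj
        _ ≤ f (S.len k - 1) := f.antitone (by omega)
        _ ≤ C * f (S.len k) := hsh _
        _ ≤ _ := by gcongr; exact S.edgeLength_le_left f k k'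
    have := S.floydDist_map_le f f SA ρ C (fun k k' h => by
      rcases hρadj k k' h with heq | ⟨hadj, hk | hk⟩
      · rw [heq, SA.floydDist_self]
        exact mul_nonneg hC.le (f.pos_all _).le
      · exact hkey k k' hadj hk
      · rw [SA.floydDist_comm, FinGenSet.edgeLength, min_comm]
        exact hkey k' k hadj.symm hk) hC (α a) (α a')
    rwa [hρα, hρα] at this

/-! ### Normal form theorem via the pushout -/

section Pushout

universe u v w

/-- Two groups as a family in a common universe. -/
def pairFamily (A : Type u) (B : Type v) : Bool → Type (max u v)
  | true => ULift.{v} A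
  | false => ULift.{u} B

instance pairFamily.group (A : Type u) (B : Type v) [Group A] [Group B] (b : Bool) :
    Group (pairFamily A B b) :=
  match b with
  | true => inferInstanceAs (Group (ULift.{v} A))
  | false => inferInstanceAs (Group (ULift.{u} B))

variable {A : Type u} {B : Type v} {H : Type w} {K : Type*} [Group A] [Group B] [Group H] [Group K]

/-- Two homomorphisms from a group as a family. -/
def pairMap (i : H →* A) (j : H →* B) : ∀ b, H →* pairFamily A B b
  | true => (MulEquiv.ulift : ULift.{v} A ≃* A).symm.toMonoidHom.comp i
  | false => (MulEquiv.ulift : ULift.{u} B ≃* B).symm.toMonoidHom.comp j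

/-- The inclusion of the left group in the family. -/
def pairInl (A : Type u) (B : Type v) [Group A] [Group B] : A →* pairFamily A B true :=
  (MulEquiv.ulift : ULift.{v} A ≃* A).symm.toMonoidHom

/-- The inclusion of the right group in the family. -/
def pairInr (A : Type u) (B : Type v) [Group A] [Group B] : B →* pairFamily A B false :=
  (MulEquiv.ulift : ULift.{u} B ≃* B).symm.toMonoidHom

theorem pairInl_bijective : Function.Bijective (pairInl A B) := MulEquiv.ulift.symm.bijective

theorem pairInr_bijective : Function.Bijective (pairInr A B) := MulEquiv.ulift.symm.bijective

/-- The ranges of two homomorphisms as a family of subgroups. -/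
def rangePair (α : A →* K) (β : B →* K) : Bool → Subgroup K
  | true => α.range
  | false => β.range

open Monoid in
/-- A group generated by two subgroups and mapping compatibly to the pushout is an amalgamated
product. -/
theorem isAmalgam_rangePair {i : H →* A} {j : H →* B} (hi : Function.Injective i)
    (hj : Function.Injective j) {α : A →* K} {β : B →* K} (hcomm : ∀ h, α (i h) = β (j h))
    (hgen : α.range ⊔ β.range = ⊤) (Ψ : K →* PushoutI (pairMap i j))
    (hΨα : ∀ a, Ψ (α a) = PushoutI.of true (pairInl A B a))
    (hΨβ : ∀ b, Ψ (β b) = PushoutI.of false (pairInr A B b)) :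
    IsAmalgam (rangePair α β) ∧ Function.Injective α ∧ Function.Injective β ∧
      ∀ x, x ∈ core (rangePair α β) ↔ ∃ h, α (i h) = x := by
  have hφ : ∀ b, Function.Injective (pairMap i j b) := by
    rintro (_ | _)
    · exact pairInr_bijective.injective.comp hj
    · exact pairInl_bijective.injective.comp hi
  have hαinj : Function.Injective α := fun a a' h => by
    have : Ψ (α a) = Ψ (α a') := by rw [h]
    rw [hΨα, hΨα] at this
    exact pairInl_bijective.injective (PushoutI.of_injective hφ true this)
  have hβinj : Function.Injective β := fun a a' h => by
    have : Ψ (β a) = Ψ (β a') := by rw [h]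
    rw [hΨβ, hΨβ] at this
    exact pairInr_bijective.injective (PushoutI.of_injective hφ false this)
  have hΨbase : ∀ h, Ψ (α (i h)) = PushoutI.base (pairMap i j) h := fun h => by
    rw [hΨα, ← PushoutI.of_apply_eq_base (pairMap i j) true h]
    rfl
  have hcore : ∀ x, x ∈ core (rangePair α β) ↔ ∃ h, α (i h) = x := by
    intro x
    constructor
    · rintro ⟨⟨a, rfl⟩, ⟨b, hb⟩⟩
      have h1 : Ψ (α a) ∈ (PushoutI.of true).range ⊓ (PushoutI.of false).range :=
        ⟨⟨_, (hΨα a).symm⟩, ⟨_, by rw [← hb, hΨβ]⟩⟩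
      rw [PushoutI.inf_of_range_eq_base_range hφ (by simp)] at h1
      obtain ⟨h, hh⟩ := h1
      refine ⟨h, ?_⟩
      rw [← hΨbase, hΨα, hΨα] at hh
      rw [pairInl_bijective.injective (PushoutI.of_injective hφ true hh)]
    · rintro ⟨h, rfl⟩
      exact ⟨⟨i h, rfl⟩, ⟨j h, (hcomm h).symm⟩⟩
  have hletter : ∀ b, ∀ x ∈ rangePair α β b, ∃ g : pairFamily A B b, PushoutI.of b g = Ψ x ∧
      (g ∈ (pairMap i j b).range → x ∈ core (rangePair α β)) := by
    rintro (_ | _) x ⟨a, rfl⟩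
    · refine ⟨pairInr A B a, (hΨβ a).symm, ?_⟩
      rintro ⟨h, hh⟩
      have : j h = a := pairInr_bijective.injective hh
      exact (hcore _).2 ⟨h, by rw [hcomm, this]⟩
    · refine ⟨pairInl A B a, (hΨα a).symm, ?_⟩
      rintro ⟨h, hh⟩
      have : i h = a := pairInl_bijective.injective hh
      exact (hcore _).2 ⟨h, by rw [this]⟩
  refine ⟨⟨?_, fun b l hl hne hmem => ?_⟩, hαinj, hβinj, hcore⟩
  · rw [← Subgroup.sup_eq_closure]
    exact hgen
  -- The index of the first letter is carried along so that the next letter can be put in front.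
  · have hword : ∀ l b, IsAlternating (rangePair α β) b l →
        ∃ w : CoprodI.Word (pairFamily A B), PushoutI.Reduced (pairMap i j) w ∧
          PushoutI.ofCoprodI w.prod = Ψ l.prod ∧
          w.fstIdx = l.head?.map fun _ => b := by
      intro l
      induction l with
      | nil =>
        intro b _
        exact ⟨CoprodI.Word.empty, by simp [PushoutI.Reduced, CoprodI.Word.empty], by simp,
          by simp [CoprodI.Word.fstIdx, CoprodI.Word.empty]⟩
      | cons x l ih =>
        rintro b ⟨⟨hx, hxc⟩, hl⟩
        obtain ⟨w, hw, hprod, hidx⟩ := ih _ hl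
        obtain ⟨g, hg, hgr⟩ := hletter b x hx
        have hne : w.fstIdx ≠ some b := by
          rw [hidx]
          cases l <;> simp
        have hg1 : g ≠ 1 := by
          rintro rfl
          exact hxc (hgr (one_mem _))
        refine ⟨CoprodI.Word.cons g w hne hg1, ?_, ?_, ?_⟩
        · intro y hy
          rcases List.mem_cons.1 hy with rfl | hy
          · exact fun h => hxc (hgr h)
          · exact hw y hy
        · rw [CoprodI.Word.prod_cons, map_mul, hprod, PushoutI.ofCoprodI_of, hg, List.prod_cons,
            map_mul]
        · rw [CoprodI.Word.fstIdx_cons]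
          rfl
    obtain ⟨w, hw, hprod, hidx⟩ := hword l b hl
    obtain ⟨h, hh⟩ := (hcore _).1 hmem
    -- By the normal form theorem for `PushoutI`, a reduced word with product in the base is empty.
    have := hw.eq_empty_of_mem_range hφ ⟨h, by rw [hprod, ← hh, hΨbase]⟩
    rw [this] at hidx
    cases l with
    | nil => exact hne rfl
    | cons x l => simp [CoprodI.Word.fstIdx, CoprodI.Word.empty] at hidx

theorem Amalgam.inl_eq_inr (i : H →* A) (j : H →* B) (h : H) :
    Amalgam.inl i j (i h) = Amalgam.inr i j (j h) := by
  have : (Monoid.Coprod.inl (i h) : Monoid.Coprod A B) * (Monoid.Coprod.inr (j h))⁻¹ ∈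
      Subgroup.normalClosure (range fun h : H =>
        (Monoid.Coprod.inl (i h) : Monoid.Coprod A B) * (Monoid.Coprod.inr (j h))⁻¹) :=
    Subgroup.subset_normalClosure ⟨h, rfl⟩
  have h1 := (QuotientGroup.eq_one_iff _).2 this
  rw [QuotientGroup.mk_mul, QuotientGroup.mk_inv, mul_inv_eq_one] at h1
  exact h1

open Monoid in
-- The relators die in the pushout, so the quotient of the free product maps to it compatibly with
-- both factors.
theorem Amalgam.isAmalgam {i : H →* A} {j : H →* B} (hi : Function.Injective i)
    (hj : Function.Injective j) :
    IsAmalgam (rangePair (Amalgam.inl i j) (Amalgam.inr i j)) ∧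
      Function.Injective (Amalgam.inl i j) ∧ Function.Injective (Amalgam.inr i j) ∧
      ∀ x, x ∈ core (rangePair (Amalgam.inl i j) (Amalgam.inr i j)) ↔
        ∃ h, Amalgam.inl i j (i h) = x := by
  let Ψ₀ : Coprod A B →* PushoutI (pairMap i j) :=
    Coprod.lift ((PushoutI.of true).comp (pairInl A B)) ((PushoutI.of false).comp (pairInr A B))
  have hker : Subgroup.normalClosure (range fun h : H =>
      (Coprod.inl (i h) : Coprod A B) * (Coprod.inr (j h))⁻¹) ≤ Ψ₀.ker := by
    refine Subgroup.normalClosure_le_normal ?_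
    rintro _ ⟨h, rfl⟩
    rw [SetLike.mem_coe, MonoidHom.mem_ker, map_mul, map_inv, mul_inv_eq_one]
    have h1 := PushoutI.of_apply_eq_base (pairMap i j) true h
    have h2 := PushoutI.of_apply_eq_base (pairMap i j) false h
    exact h1.trans h2.symm
  exact isAmalgam_rangePair hi hj (Amalgam.inl_eq_inr i j) (Amalgam.range_sup_range i j)
    (QuotientGroup.lift _ Ψ₀ hker) (fun a => rfl) (fun b => rfl)

open Monoid in
-- The free product is treated as the amalgam over the trivial group, so that both sides of the
-- comparison have the same normal forms.
theorem coprod_isAmalgam (A : Type u) (B : Type v) [Group A] [Group B] :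
    IsAmalgam (rangePair (Coprod.inl : A →* Coprod A B) (Coprod.inr : B →* Coprod A B)) ∧
      Function.Injective (Coprod.inl : A →* Coprod A B) ∧
      Function.Injective (Coprod.inr : B →* Coprod A B) ∧
      ∀ x, x ∈ core (rangePair (Coprod.inl : A →* Coprod A B) (Coprod.inr : B →* Coprod A B)) ↔
        x = 1 := by
  have := isAmalgam_rangePair (i := (1 : PUnit.{1} →* A)) (j := (1 : PUnit.{1} →* B))
    (fun x y _ => Subsingleton.elim x y) (fun x y _ => Subsingleton.elim x y)
    (α := (Coprod.inl : A →* Coprod A B)) (β := Coprod.inr)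
    (fun h => by simp) Coprod.range_inl_sup_range_inr
    (Coprod.lift ((PushoutI.of true).comp (pairInl A B)) ((PushoutI.of false).comp (pairInr A B)))
    (fun a => rfl) (fun b => rfl)
  refine ⟨this.1, this.2.1, this.2.2.1, fun x => (this.2.2.2 x).trans ?_⟩
  simp [eq_comm]

end Pushout

/-! ### Coding of words by words over the natural numbers -/

section Coding

variable {Λ : Type*}

theorem IsWord.append {D : ℕ → Set Λ} {u z : List Λ} :
    IsWord D (u ++ z) ↔ IsWord D u ∧ IsWord (fun n => D (u.length + n)) z := by
  refine ⟨fun h => ⟨h.of_prefix (List.prefix_append _ _), fun i hi => ?_⟩, fun h i hi => ?_⟩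
  · have := h (u.length + i) (by simpa using hi)
    rwa [List.getElem_append_right (Nat.le_add_right _ _), getElem_congr_idx
      (Nat.add_sub_cancel_left (n := u.length) (m := i))] at this
  · rcases Nat.lt_or_ge i u.length with hlt | hge
    · rw [List.getElem_append_left hlt]
      exact h.1 i hlt
    · rw [List.getElem_append_right hge]
      have := h.2 (i - u.length) (by rw [List.length_append] at hi; omega)
      simp only [Nat.add_sub_cancel' hge] at this
      exact this

/-- The concatenation of the code words of the letters of a word. -/
def decode (e : ℕ → ℕ → List Λ) : ℕ → List ℕ → List Λ
  | _, [] => []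
  | i, x :: w => e i x ++ decode e (i + 1) w

theorem decode_append (e : ℕ → ℕ → List Λ) (i : ℕ) (v u : List ℕ) :
    decode e i (v ++ u) = decode e i v ++ decode e (i + v.length) u := by
  induction v generalizing i with
  | nil => simp [decode]
  | cons x v ih =>
    simp only [List.cons_append, decode, ih, List.append_assoc, List.length_cons]
    rw [Nat.add_assoc, Nat.add_comm 1]

/-- The code words for the `i`-th letter are all the words of length `l` that may stand at the
places from `l * i` on. -/
structure IsCoding (D : ℕ → Set Λ) (l : ℕ) (e : ℕ → ℕ → List Λ) : Prop where
  pos : 0 < l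
  inj : ∀ i, Function.Injective (e i)
  range : ∀ i, range (e i) = {c | c.length = l ∧ IsWord (fun n => D (l * i + n)) c}

namespace IsCoding

variable {D : ℕ → Set Λ} {l : ℕ} {e : ℕ → ℕ → List Λ}

theorem length (h : IsCoding D l e) (i x : ℕ) : (e i x).length = l := by
  have : e i x ∈ Set.range (e i) := ⟨x, rfl⟩
  rw [h.range] at this
  exact this.1

theorem isWord_code (h : IsCoding D l e) (i x : ℕ) : IsWord (fun n => D (l * i + n)) (e i x) := by
  have : e i x ∈ Set.range (e i) := ⟨x, rfl⟩
  rw [h.range] at this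
  exact this.2

theorem isWord_decode (h : IsCoding D l e) (i : ℕ) (w : List ℕ) :
    IsWord (fun n => D (l * i + n)) (decode e i w) := by
  induction w generalizing i with
  | nil => exact IsWord.nil
  | cons x w ih =>
    refine IsWord.append.2 ⟨h.isWord_code i x, ?_⟩
    have := ih (i + 1)
    rw [h.length i x]
    simp only [Nat.mul_add, Nat.mul_one, Nat.add_assoc] at this ⊢
    exact this

theorem decode_eq_nil_iff (h : IsCoding D l e) (i : ℕ) (w : List ℕ) :
    decode e i w = [] ↔ w = [] := by
  cases w with
  | nil => simp [decode]
  | cons x w =>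
    have h1 := h.length i x
    have h2 := h.pos
    simp only [decode, List.append_eq_nil_iff, reduceCtorEq, iff_false, not_and]
    intro h3
    rw [h3, List.length_nil] at h1
    omega

/-- Code words at all places have the same length and are distinct at each place, so a concatenation
can be parsed uniquely from the left. -/
theorem prefix_iff (h : IsCoding D l e) (i : ℕ) (v w : List ℕ) :
    decode e i v <+: decode e i w ↔ v <+: w := by
  induction v generalizing i w with
  | nil => simp [decode]
  | cons x v ih =>
    cases w with
    | nil =>
      have := (h.decode_eq_nil_iff i (x :: v)).not.2 (by simp)
      simp only [decode] at this ⊢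
      simp [List.prefix_nil, this]
    | cons y w =>
      rw [List.cons_prefix_cons, ← ih (i + 1)]
      simp only [decode]
      constructor
      · rintro ⟨t, ht⟩
        rw [List.append_assoc] at ht
        obtain ⟨h1, h2⟩ := List.append_inj ht (by rw [h.length, h.length])
        exact ⟨h.inj i h1, t, h2⟩
      · rintro ⟨rfl, h2⟩
        exact (List.prefix_append_right_inj _).2 h2

/-- A word of length `l * n` is cut into blocks of length `l`, each of which is a code word. -/
theorem exists_decode_eq (h : IsCoding D l e) (n i : ℕ) (u : List Λ) (hu : u.length = l * n)
    (hw : IsWord (fun n => D (l * i + n)) u) : ∃ w, decode e i w = u := by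
  induction n generalizing i u with
  | zero => exact ⟨[], by simpa [decode, eq_comm] using hu⟩
  | succ n ih =>
    rw [← List.take_append_drop l u] at hw ⊢
    have hlen : (u.take l).length = l := by
      rw [List.length_take, hu]
      exact min_eq_left (Nat.le_mul_of_pos_right l (Nat.succ_pos n))
    obtain ⟨h1, h2⟩ := IsWord.append.1 hw
    obtain ⟨x, hx⟩ : u.take l ∈ Set.range (e i) := by
      rw [h.range]
      exact ⟨hlen, h1⟩
    rw [hlen] at h2
    obtain ⟨w, hw⟩ := ih (i + 1) (u.drop l)
      (by rw [List.length_drop, hu, Nat.mul_succ, Nat.add_sub_cancel])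
      (by simp only [Nat.mul_add, Nat.mul_one, Nat.add_assoc]; exact h2)
    exact ⟨x :: w, by rw [decode, hx, hw]⟩

/-- Tree-like families can be re-indexed by a coding. -/
theorem isTreeLike {X : Type*} [Dist X] (h : IsCoding D l e) {p : List Λ → X}
    (hp : IsTreeLike {w | IsWord D w} p) : IsTreeLike univ fun w => p (decode e 0 w) := by
  have hV : ∀ w, IsWord D (decode e 0 w) := fun w => by simpa using h.isWord_decode 0 w
  have hinj : Function.Injective (decode e 0) := fun v w hvw =>
    ((h.prefix_iff 0 v w).1 (hvw ▸ List.prefix_refl _)).eq_of_length_le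
      ((h.prefix_iff 0 w v).1 (hvw ▸ List.prefix_refl _)).length_le
  refine ⟨fun ε hε => ?_, fun v _ hv => ?_, fun w _ w' _ hne hne' heq => ?_⟩
  · refine ((hp.small ε hε).preimage hinj.injOn).subset ?_
    rintro v ⟨-, hv, w, -, hvw, hd⟩
    exact ⟨hV v, (h.decode_eq_nil_iff 0 v).not.2 hv, _, hV w, (h.prefix_iff 0 v w).2 hvw, hd⟩
  · obtain ⟨δ, hδ, hsep⟩ := hp.sep _ (hV v) ((h.decode_eq_nil_iff 0 v).not.2 hv)
    exact ⟨δ, hδ, fun w _ w' _ hw' h1 h2 => hsep _ (hV w) _ (hV w')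
      ((h.decode_eq_nil_iff 0 w').not.2 hw') ((h.prefix_iff 0 v w).2 h1)
      ((h.prefix_iff 0 v w').not.2 h2)⟩
  · exact hinj (hp.inj _ (hV w) _ (hV w') ((h.decode_eq_nil_iff 0 w).not.2 hne)
      ((h.decode_eq_nil_iff 0 w').not.2 hne') heq)

end IsCoding

end Coding

/-! ### Comparison of two groups letter by letter -/

section Comparison

/-- Left translations are Lipschitz, so the one-letter extensions of a word need only be compared
after translation to the identity. -/
theorem AsympControl.mul_left {ι K K' : Type*} [Group K] [Group K'] {f f' : FloydFunction}
    {S : FinGenSet K} {S' : FinGenSet K'} {s : ι → K} {s' : ι → K'}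
    (h : AsympControl (fun x => FloydSpace.of f S (s x)) (fun x => FloydSpace.of f' S' (s' x)))
    (g : K) (g' : K') : AsympControl (fun x => FloydSpace.of f S (g * s x))
      (fun x => FloydSpace.of f' S' (g' * s' x)) := by
  obtain ⟨C, hC, h1⟩ := S.exists_floydDist_mul_left_le f g⁻¹
  obtain ⟨C', hC', h2⟩ := S'.exists_floydDist_mul_left_le f' g'
  refine (AsympControl.of_lipschitz hC fun x y => ?_).trans
    (h.trans (AsympControl.of_lipschitz hC' fun x y => h2 _ _))
  simpa [FloydSpace.dist_of] using h1 (g * s x) (g * s y)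

/-- Every element is at bounded distance from the family. -/
def IsCobounded {W K : Type*} [Group K] (p : W → K) : Prop :=
  ∃ Q : Set K, Q.Finite ∧ ∀ k, ∃ w, (p w)⁻¹ * k ∈ Q

/-- Points at bounded word distance become arbitrarily close in the Floyd metric far out. -/
theorem IsCobounded.exists_tendsto {W K : Type*} [Group K] {p : W → K} (h : IsCobounded p)
    (f : FloydFunction) (S : FinGenSet K) : ∃ r : FloydSpace f S → W,
      Tendsto (fun x => dist (FloydSpace.of f S (p (r x))) x) cofinite (𝓝 0) := by
  obtain ⟨Q, hQ, h⟩ := h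
  choose r hr using h
  obtain ⟨m, hm⟩ := (hQ.image S.len).bddAbove
  refine ⟨r, ?_⟩
  have := FloydSpace.tendsto_dist_of_bounded (f := f) (S := S) (s := id) (t := fun k => p (r k))
    tendsto_id m fun k => by
      rw [SimpleGraph.dist_comm]
      have := S.dist_self_mul (p (r k)) ((p (r k))⁻¹ * k)
      rw [mul_inv_cancel_left] at this
      exact this.trans_le (hm ⟨_, hr k, rfl⟩)
  exact this.congr fun k => dist_comm _ _

/-- Groups with tree-like families of elements that are asymptotically equivalent letter by letter
have homeomorphic Floyd boundaries. -/
theorem nonempty_homeomorph_of_isTreeLike {K K' : Type*} [Group K] [Group K'] {f : FloydFunction}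
    {S : FinGenSet K} {S' : FinGenSet K'} {p : List ℕ → K} {p' : List ℕ → K'}
    (hp : IsTreeLike univ fun w => FloydSpace.of f S (p w))
    (hp' : IsTreeLike univ fun w => FloydSpace.of f S' (p' w))
    {s : ℕ → ℕ → K} {s' : ℕ → ℕ → K'} (hs : ∀ v x, p (v ++ [x]) = p v * s v.length x)
    (hs' : ∀ v x, p' (v ++ [x]) = p' v * s' v.length x)
    (hcob : IsCobounded fun w : {w : List ℕ // w ≠ []} => p w)
    (hcob' : IsCobounded fun w : {w : List ℕ // w ≠ []} => p' w)
    (h : ∀ i, AsympControl (fun x => FloydSpace.of f S (s i x))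
      (fun x => FloydSpace.of f S' (s' i x)))
    (h' : ∀ i, AsympControl (fun x => FloydSpace.of f S' (s' i x))
      (fun x => FloydSpace.of f S (s i x))) :
    Nonempty (FloydBoundary f S ≃ₜ FloydBoundary f S') := by
  have h1 := hp.uniform_comparison hp' FloydSpace.exists_isolated fun v => by
    simp only [hs, hs']
    exact (h v.length).mul_left (p v) (p' v)
  have h2 := hp'.uniform_comparison hp FloydSpace.exists_isolated fun v => by
    simp only [hs, hs']
    exact (h' v.length).mul_left (p' v) (p v)
  refine nonempty_homeomorph_remainder_of_family (W := {w : List ℕ // w ≠ []})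
    (p := fun w => FloydSpace.of f S (p w)) (p' := fun w => FloydSpace.of f S' (p' w))
    FloydSpace.exists_isolated FloydSpace.exists_isolated
    (fun w w' hww' => Subtype.ext (hp.inj _ (mem_univ _) _ (mem_univ _) w.2 w'.2 hww'))
    (fun w w' hww' => Subtype.ext (hp'.inj _ (mem_univ _) _ (mem_univ _) w.2 w'.2 hww'))
    (fun ε hε => ?_) (fun ε hε => ?_) (hcob.exists_tendsto f S) (hcob'.exists_tendsto f S')
  · obtain ⟨δ, hδ, h⟩ := h1 ε hε
    exact ⟨δ, hδ, fun w w' => h w w' w.2 w'.2⟩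
  · obtain ⟨δ, hδ, h⟩ := h2 ε hε
    exact ⟨δ, hδ, fun w w' => h w w' w.2 w'.2⟩

/-- The family `s` of elements of `K` is asymptotically equivalent to a finite-to-one,
asymptotically dense family of elements of `A`. -/
def IsFactorLike {ι A K : Type*} [Group A] [Group K] (f : FloydFunction) (SA : FinGenSet A)
    (S : FinGenSet K) (s : ι → K) : Prop :=
  ∃ q : ι → A, Tendsto q cofinite cofinite ∧
    (∃ m, ∀ᶠ a in cofinite, ∃ x, SA.cayley.dist a (q x) ≤ m) ∧
    AsympControl (fun x => FloydSpace.of f S (s x)) (fun x => FloydSpace.of f SA (q x)) ∧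
    AsympControl (fun x => FloydSpace.of f SA (q x)) (fun x => FloydSpace.of f S (s x))

theorem eventually_exists_dist_lt {ι A : Type*} [Group A] {f : FloydFunction} {SA : FinGenSet A}
    {q : ι → A} {m : ℕ} (h : ∀ᶠ a in cofinite, ∃ x, SA.cayley.dist a (q x) ≤ m) :
    ∀ ε > 0, ∀ᶠ y : FloydSpace f SA in cofinite, ∃ x, dist (FloydSpace.of f SA (q x)) y < ε := by
  intro ε hε
  obtain ⟨C, hC, hd⟩ := SA.exists_floydDist_le f m
  have h1 : Tendsto (fun a => C * f (SA.len a)) cofinite (𝓝 (C * 0)) :=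
    (f.tendsto_zero.comp SA.tendsto_len).const_mul C
  rw [mul_zero] at h1
  have h2 : ∀ᶠ a : A in cofinite, ∃ x, SA.floydDist f (q x) a < ε := by
    filter_upwards [h, h1.eventually (gt_mem_nhds hε)] with a ⟨x, hx⟩ ha
    exact ⟨x, by rw [SA.floydDist_comm]; exact (hd a (q x) hx).trans_lt ha⟩
  exact h2

/-- Finitely many balls of radius `m` are finite and cannot cover almost all of an infinite group.
-/
theorem infinite_of_eventually_exists {ι A : Type*} [Group A] [Infinite A] {SA : FinGenSet A}
    {q : ι → A} {m : ℕ} (h : ∀ᶠ a in cofinite, ∃ x, SA.cayley.dist a (q x) ≤ m) :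
    Infinite ι := by
  by_contra hfin
  rw [not_infinite_iff_finite] at hfin
  have h1 : (⋃ x, {a | SA.len ((q x)⁻¹ * a) ≤ m}).Finite := finite_iUnion fun x => by
    refine (SA.finite_len_le m).preimage (f := fun a => (q x)⁻¹ * a) ?_
    exact (mul_right_injective _).injOn
  refine (infinite_univ (α := A)) ((Set.Finite.union h h1).subset fun a _ => ?_)
  by_cases ha : ∃ x, SA.cayley.dist a (q x) ≤ m
  · obtain ⟨x, hx⟩ := ha
    refine Or.inr (mem_iUnion.2 ⟨x, ?_⟩)
    have := SA.dist_self_mul (q x) ((q x)⁻¹ * a)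
    rw [mul_inv_cancel_left, SimpleGraph.dist_comm] at this
    exact this.symm.trans_le hx
  · exact Or.inl ha

/-- Families that are asymptotically equivalent to families in the same group can be enumerated
such that the enumerations are asymptotically equivalent. -/
theorem IsFactorLike.exists_enumeration {ι ι' A K K' : Type*} [Group A] [Group K] [Group K']
    [Infinite A] [Countable ι] [Countable ι'] {f : FloydFunction} {SA : FinGenSet A}
    {S : FinGenSet K} {S' : FinGenSet K'} {s : ι → K} {s' : ι' → K'}
    (h : IsFactorLike f SA S s) (h' : IsFactorLike f SA S' s') :
    ∃ (e : ℕ ≃ ι) (e' : ℕ ≃ ι'),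
      AsympControl (fun n => FloydSpace.of f S (s (e n)))
        (fun n => FloydSpace.of f S' (s' (e' n))) ∧
      AsympControl (fun n => FloydSpace.of f S' (s' (e' n)))
        (fun n => FloydSpace.of f S (s (e n))) := by
  obtain ⟨q, hq, ⟨m, hm⟩, h1, h2⟩ := h
  obtain ⟨q', hq', ⟨m', hm'⟩, h1', h2'⟩ := h'
  have := infinite_of_eventually_exists hm
  have := infinite_of_eventually_exists hm'
  -- The matching takes place in the common model group `A` and is carried over to both families.
  obtain ⟨σ, hσ⟩ := exists_equiv_tendsto_dist (FloydSpace.totallyBounded (f := f) (S := SA))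
    FloydSpace.exists_isolated (fun x => FloydSpace.of f SA (q x))
    (fun x => FloydSpace.of f SA (q' x)) hq hq' (eventually_exists_dist_lt hm)
    (eventually_exists_dist_lt hm')
  obtain ⟨e⟩ : Nonempty (ℕ ≃ ι) := nonempty_equiv_of_countable
  refine ⟨e, e.trans σ, ?_, ?_⟩
  · exact ((h1.trans (AsympControl.of_tendsto hσ)).trans (h2'.comp σ σ.injective)).comp e
      e.injective
  · exact (((h1'.comp σ σ.injective).trans (AsympControl.of_tendsto' hσ)).trans h2).comp e
      e.injective

end Comparison

/-! ### Blocks of letters as points of a factor -/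

section Factor

variable {A K : Type*} [Group A] [Group K] {P : Bool → Subgroup K} {T : Bool → Set K}

/-- The compatibility of the generating sets of an amalgamated product and of a factor. -/
structure IsCompatible (P : Bool → Subgroup K) (b : Bool) (SA : FinGenSet A) (S : FinGenSet K)
    (α : A →* K) : Prop where
  injective : Function.Injective α
  range_eq : α.range = P b
  exists_mem : ∀ s ∈ S.carrier, ∃ c, s ∈ P c
  map_mem : ∀ a ∈ SA.carrier, α a ∈ S.carrier
  mem_image : ∀ s ∈ S.carrier, s ∈ P b → s ∉ core P → s ∈ α '' SA.carrier
  core_mem : ∀ h ∈ core P, h ≠ 1 → h ∈ α '' SA.carrier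

/-- The code words with a fixed first place and finitely many possible remainders are equivalent
to the factor to which their first letters belong. -/
theorem IsAmalgam.isFactorLike (hP : IsAmalgam P) (hT : IsTransversalPair P T)
    (hfin : (core P : Set K).Finite) {b : Bool} {n : ℕ} (f : FloydFunction) {SA : FinGenSet A}
    {S : FinGenSet K} {α : A →* K} (hα : IsCompatible P (side b n) SA S α)
    (C : Set (List K)) {R : Set (List K)} (hR : R.Finite)
    (hC : ∀ c ∈ C, ∃ x ∈ letters T b n, ∃ u ∈ R, c = x :: u)
    (hC' : ∀ x ∈ letters T b n, ∃ u, x :: u ∈ C) :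
    IsFactorLike f SA S fun c : C => c.1.prod := by
  obtain ⟨-, hle, D, hD, hge⟩ := hP.floydDist_factor (side b n) f SA S α hα.injective hα.range_eq
    hα.exists_mem hα.map_mem hα.mem_image hα.core_mem
  have hex : ∀ c : C, ∃ a, ∃ u ∈ R, α a ∈ letters T b n ∧ c.1 = α a :: u := by
    rintro ⟨c, hc⟩
    obtain ⟨x, hx, u, hu, rfl⟩ := hC c hc
    have hxP := hT.subset _ (letters_subset b n hx)
    rw [← hα.range_eq] at hxP
    obtain ⟨a, rfl⟩ := hxP
    exact ⟨a, u, hu, hx, rfl⟩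
  -- The model point of a block is its first letter, read in `A`; the remaining letters take
  -- finitely many values and move the product by a bounded amount.
  choose q u hu hq hcu using hex
  have hqfin : Tendsto q cofinite cofinite := by
    refine Tendsto.cofinite_of_finite_preimage_singleton fun a => ?_
    refine Set.Finite.of_finite_image (f := fun c : C => c.1)
      ((hR.image fun v => α a :: v).subset ?_) Subtype.val_injective.injOn
    rintro _ ⟨c, hc, rfl⟩
    exact ⟨u c, hu c, by rw [← show q c = a from hc]; exact (hcu c).symm⟩
  obtain ⟨m, hm⟩ := (hR.image fun v => S.len v.prod).bddAbove
  have hclose : Tendsto (fun c : C => dist (FloydSpace.of f S (α (q c)))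
      (FloydSpace.of f S c.1.prod)) cofinite (𝓝 0) := by
    refine FloydSpace.tendsto_dist_of_bounded (hα.injective.tendsto_cofinite.comp hqfin) m ?_
    intro c
    rw [hcu c, List.prod_cons]
    exact (S.dist_self_mul _ _).trans_le (hm ⟨_, hu c, rfl⟩)
  have hcoreA : (α ⁻¹' (core P : Set K)).Finite := hfin.preimage hα.injective.injOn
  obtain ⟨m', hm'⟩ := (hcoreA.image SA.len).bddAbove
  refine ⟨q, hqfin, ⟨m', ?_⟩, ?_, ?_⟩
  -- Only elements of the core can lack a nearby letter, as their representative 1 is excluded after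
  -- the first place.
  · refine hcoreA.subset fun a ha => ?_
    by_contra hac
    refine ha ?_
    obtain ⟨t, ht, hta⟩ := hT.exists_mem (side b n) (α a) (hα.range_eq ▸ ⟨a, rfl⟩)
    have ht1 : t ≠ 1 := by
      rintro rfl
      exact hac (by simpa using hta)
    have htl : t ∈ letters T b n := by
      cases n with
      | zero => exact ht
      | succ n => exact ⟨ht, ht1⟩
    obtain ⟨v, hv⟩ := hC' t htl
    refine ⟨⟨_, hv⟩, ?_⟩
    have h1 : α (q ⟨_, hv⟩) = t := (List.cons.inj (hcu ⟨_, hv⟩)).1.symm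
    have h2 := SA.dist_self_mul (q ⟨_, hv⟩) ((q ⟨_, hv⟩)⁻¹ * a)
    rw [mul_inv_cancel_left, SimpleGraph.dist_comm] at h2
    refine h2.trans_le (hm' ⟨_, ?_, rfl⟩)
    rw [mem_preimage, map_mul, map_inv, h1]
    exact hta
  · exact (AsympControl.of_tendsto' hclose).trans
      (AsympControl.of_lipschitz hD fun x y => hge (q x) (q y))
  · refine (AsympControl.of_lipschitz one_pos fun x y => ?_).trans (AsympControl.of_tendsto hclose)
    rw [one_mul]
    exact hle (q x) (q y)

end Factor

section Codes

variable {K : Type*} [Group K] {P : Bool → Subgroup K} {T : Bool → Set K}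

/-- The words of length `l` that may stand at the places from `l * i` on. -/
def codes {Λ : Type*} (D : ℕ → Set Λ) (l i : ℕ) : Set (List Λ) :=
  {c | c.length = l ∧ IsWord (fun n => D (l * i + n)) c}

theorem side_two_mul (b : Bool) (i : ℕ) : side b (2 * i) = b := by
  induction i with
  | zero => rfl
  | succ i ih => rw [Nat.mul_succ, side_succ, side_succ, ih, Bool.not_not]

theorem IsTransversalPair.exists_ne_one (hT : IsTransversalPair P T) {b : Bool} {x : K}
    (hx : x ∈ P b) (hxc : x ∉ core P) : ∃ t ∈ T b, t ≠ 1 := by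
  obtain ⟨t, ht, h⟩ := hT.exists_mem b x hx
  refine ⟨t, ht, ?_⟩
  rintro rfl
  exact hxc (by simpa using h)

/-- The products of the normal forms whose length is divisible by `l` are cobounded. -/
def HasCoboundedWords (T : Bool → Set K) (b : Bool) (l : ℕ) : Prop :=
  ∃ Q : Set K, Q.Finite ∧ ∀ k, ∃ w, IsWord (letters T b) w ∧ w ≠ [] ∧ l ∣ w.length ∧
    w.prod⁻¹ * k ∈ Q

theorem IsAmalgam.hasCoboundedWords_one (hP : IsAmalgam P) (hT : IsTransversalPair P T)
    (hfin : (core P : Set K).Finite) (b : Bool) : HasCoboundedWords T b 1 :=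
  ⟨core P, hfin, fun k => by
    obtain ⟨w, hw, hne, h⟩ := hP.exists_word hT b k
    exact ⟨w, hw, hne, one_dvd _, h⟩⟩

/-- A normal form of odd length ends on side `b`, and a fixed nontrivial letter from the other side
completes it at bounded cost. -/
theorem IsAmalgam.hasCoboundedWords_two (hP : IsAmalgam P) (hT : IsTransversalPair P T)
    (hfin : (core P : Set K).Finite) (b : Bool) (hne1 : ∃ t ∈ T (!b), t ≠ 1) :
    HasCoboundedWords T b 2 := by
  obtain ⟨t, ht, ht1⟩ := hne1
  refine ⟨core P ∪ (fun x => t⁻¹ * x) '' core P, hfin.union (hfin.image _), fun k => ?_⟩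
  obtain ⟨w, hw, hne, h⟩ := hP.exists_word hT b k
  rcases Nat.even_or_odd' w.length with ⟨n, hn | hn⟩
  · exact ⟨w, hw, hne, ⟨n, hn⟩, Or.inl h⟩
  · refine ⟨w ++ [t], IsWord.append_singleton.2 ⟨hw, ?_⟩, by simp, ⟨n + 1, ?_⟩,
      Or.inr ⟨_, h, ?_⟩⟩
    · rw [hn]
      refine ⟨?_, ht1⟩
      rwa [side_succ, side_two_mul]
    · rw [List.length_append, hn, List.length_singleton]
      ring
    · simp [mul_assoc]

theorem IsAmalgam.isFactorLike_codes_one {A : Type*} [Group A] (hP : IsAmalgam P)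
    (hT : IsTransversalPair P T) (hfin : (core P : Set K).Finite) {b : Bool} {i : ℕ}
    (f : FloydFunction) {SA : FinGenSet A} {S : FinGenSet K} {α : A →* K}
    (hα : IsCompatible P (side b i) SA S α) :
    IsFactorLike f SA S fun c : codes (letters T b) 1 i => c.1.prod := by
  refine hP.isFactorLike hT hfin f hα _ (finite_singleton []) ?_ ?_
  · rintro c ⟨hlen, hc⟩
    obtain ⟨x, rfl⟩ := List.length_eq_one_iff.1 hlen
    have := (IsWord.cons.1 hc).1
    rw [Nat.one_mul, Nat.add_zero] at this
    exact ⟨x, this, [], rfl, rfl⟩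
  · intro x hx
    refine ⟨[], rfl, IsWord.cons.2 ⟨?_, IsWord.nil⟩⟩
    rwa [Nat.one_mul, Nat.add_zero]

/-- Every block of length two starts on side `b` and ends with one of finitely many letters, so it
behaves like its first letter. -/
theorem IsAmalgam.isFactorLike_codes_two {A : Type*} [Group A] (hP : IsAmalgam P)
    (hT : IsTransversalPair P T) (hfin : (core P : Set K).Finite) {b : Bool} {i : ℕ}
    (hTfin : (T (!b)).Finite) (hne1 : ∃ t ∈ T (!b), t ≠ 1)
    (f : FloydFunction) {SA : FinGenSet A} {S : FinGenSet K} {α : A →* K}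
    (hα : IsCompatible P b SA S α) :
    IsFactorLike f SA S fun c : codes (letters T b) 2 i => c.1.prod := by
  have hs : side b (2 * i + 1) = !b := by rw [side_succ, side_two_mul]
  rw [← side_two_mul b i] at hα
  refine hP.isFactorLike hT hfin f hα _ (hTfin.image fun y => [y]) ?_ ?_
  · rintro c ⟨hlen, hc⟩
    obtain ⟨x, y, rfl⟩ := List.length_eq_two.1 hlen
    obtain ⟨hx, hc⟩ := IsWord.cons.1 hc
    have hy := (IsWord.cons.1 hc).1
    have hy := letters_subset b _ hy
    refine ⟨x, hx, [y], ⟨y, ?_, rfl⟩, rfl⟩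
    rw [← hs]
    exact hy
  · obtain ⟨t, ht, ht1⟩ := hne1
    intro x hx
    refine ⟨[t], rfl, IsWord.cons.2 ⟨hx, IsWord.cons.2 ⟨⟨?_, ht1⟩, IsWord.nil⟩⟩⟩
    rw [← hs] at ht
    exact ht

/-- Two amalgamated products over finite groups have homeomorphic Floyd boundaries if the code
words can be enumerated in an asymptotically equivalent way. -/
theorem IsAmalgam.nonempty_homeomorph {K' : Type*} [Group K'] {P' : Bool → Subgroup K'}
    {T' : Bool → Set K'} (hP : IsAmalgam P) (hT : IsTransversalPair P T)
    (hfin : (core P : Set K).Finite) (hP' : IsAmalgam P') (hT' : IsTransversalPair P' T')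
    (hfin' : (core P' : Set K').Finite) {b b' : Bool} {l l' : ℕ} (hl : 0 < l) (hl' : 0 < l')
    (hcob : HasCoboundedWords T b l) (hcob' : HasCoboundedWords T' b' l')
    {f : FloydFunction} {S : FinGenSet K} {S' : FinGenSet K'}
    (h : ∀ i, ∃ (e : ℕ ≃ codes (letters T b) l i) (e' : ℕ ≃ codes (letters T' b') l' i),
      AsympControl (fun n => FloydSpace.of f S (e n).1.prod)
        (fun n => FloydSpace.of f S' (e' n).1.prod) ∧
      AsympControl (fun n => FloydSpace.of f S' (e' n).1.prod)
        (fun n => FloydSpace.of f S (e n).1.prod)) :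
    Nonempty (FloydBoundary f S ≃ₜ FloydBoundary f S') := by
  choose e e' h1 h2 using h
  have hcod : IsCoding (letters T b) l fun i n => (e i n).1 :=
    ⟨hl, fun i => Subtype.val_injective.comp (e i).injective, fun i => by
      change range (Subtype.val ∘ e i) = _
      rw [(e i).surjective.range_comp, Subtype.range_coe]
      rfl⟩
  have hcod' : IsCoding (letters T' b') l' fun i n => (e' i n).1 :=
    ⟨hl', fun i => Subtype.val_injective.comp (e' i).injective, fun i => by
      change range (Subtype.val ∘ e' i) = _
      rw [(e' i).surjective.range_comp, Subtype.range_coe]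
      rfl⟩
  refine nonempty_homeomorph_of_isTreeLike
    (hcod.isTreeLike (hP.isTreeLike hT hfin b f S))
    (hcod'.isTreeLike (hP'.isTreeLike hT' hfin' b' f S'))
    (s := fun i n => (e i n).1.prod) (s' := fun i n => (e' i n).1.prod) ?_ ?_ ?_ ?_ h1 h2
  · intro v x
    rw [decode_append, Nat.zero_add]
    simp [decode]
  · intro v x
    rw [decode_append, Nat.zero_add]
    simp [decode]
  · obtain ⟨Q, hQ, hc⟩ := hcob
    refine ⟨Q, hQ, fun k => ?_⟩
    obtain ⟨w, hw, hne, ⟨n, hn⟩, hk⟩ := hc k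
    obtain ⟨u, rfl⟩ := hcod.exists_decode_eq n 0 w hn (by simpa using hw)
    exact ⟨⟨u, (hcod.decode_eq_nil_iff 0 u).not.1 hne⟩, hk⟩
  · obtain ⟨Q, hQ, hc⟩ := hcob'
    refine ⟨Q, hQ, fun k => ?_⟩
    obtain ⟨w, hw, hne, ⟨n, hn⟩, hk⟩ := hc k
    obtain ⟨u, rfl⟩ := hcod'.exists_decode_eq n 0 w hn (by simpa using hw)
    exact ⟨⟨u, (hcod'.decode_eq_nil_iff 0 u).not.1 hne⟩, hk⟩

end Codes

/-! ### Generating sets -/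

theorem isCompatible_union_left {A B K : Type*} [Group A] [Group B] [Group K] {α : A →* K}
    {β : B →* K} (hgen : α.range ⊔ β.range = ⊤) {SA : FinGenSet A} {SB : FinGenSet B}
    (hα : Function.Injective α)
    (hcore : ∀ x ∈ core (rangePair α β), x ≠ 1 → x ∈ α '' SA.carrier) :
    IsCompatible (rangePair α β) true SA (FinGenSet.union α β hgen SA SB) α where
  injective := hα
  range_eq := rfl
  exists_mem := by
    rintro s (⟨a, -, rfl⟩ | ⟨a, -, rfl⟩)
    · exact ⟨true, a, rfl⟩
    · exact ⟨false, a, rfl⟩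
  map_mem := fun a ha => Or.inl ⟨a, ha, rfl⟩
  mem_image := by
    rintro s (hs | ⟨a, -, rfl⟩) h hc
    · exact hs
    · exact absurd ⟨h, a, rfl⟩ hc
  core_mem := hcore

theorem isCompatible_union_right {A B K : Type*} [Group A] [Group B] [Group K] {α : A →* K}
    {β : B →* K} (hgen : α.range ⊔ β.range = ⊤) {SA : FinGenSet A} {SB : FinGenSet B}
    (hβ : Function.Injective β)
    (hcore : ∀ x ∈ core (rangePair α β), x ≠ 1 → x ∈ β '' SB.carrier) :
    IsCompatible (rangePair α β) false SB (FinGenSet.union α β hgen SA SB) β where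
  injective := hβ
  range_eq := rfl
  exists_mem := by
    rintro s (⟨a, -, rfl⟩ | ⟨a, -, rfl⟩)
    · exact ⟨true, a, rfl⟩
    · exact ⟨false, a, rfl⟩
  map_mem := fun a ha => Or.inr ⟨a, ha, rfl⟩
  mem_image := by
    rintro s (⟨a, -, rfl⟩ | hs) h hc
    · exact absurd ⟨⟨a, rfl⟩, h⟩ hc
    · exact hs
  core_mem := hcore

/-- For a doubling Floyd function, the Floyd boundary does not depend on the generating set. -/
theorem FloydFunction.IsDoubling.nonempty_homeomorph {G : Type*} [Group G] {f : FloydFunction}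
    (hf : f.IsDoubling) (S S' : FinGenSet G) :
    Nonempty (FloydBoundary f S ≃ₜ FloydBoundary f S') := by
  have key : ∀ S S' : FinGenSet G, UniformContinuous
      (fun g : FloydSpace f S => FloydSpace.of f S' g) := fun S S' => by
    obtain ⟨C, hC, h⟩ := S.exists_floydDist_le_of_isDoubling f hf S'
    have hlip : LipschitzWith ⟨C, hC.le⟩ (fun g : FloydSpace f S => FloydSpace.of f S' g) :=
      LipschitzWith.of_dist_le_mul fun x y => h x y
    exact hlip.uniformContinuous
  refine nonempty_homeomorph_remainder FloydSpace.exists_isolated FloydSpace.exists_isolated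
    (key S S') (key S' S) tendsto_id tendsto_id ?_ ?_
  · exact tendsto_const_nhds.congr fun x => (dist_self x).symm
  · exact tendsto_const_nhds.congr fun x => (dist_self x).symm

theorem exists_finGenSet {A H : Type*} [Group A] [Group H] [Group.FG A] [Finite H] (i : H →* A) :
    ∃ SA : FinGenSet A, ∀ h, i h ∈ SA.carrier := by
  obtain ⟨s, hs, hfin⟩ := Group.fg_iff.1 ‹Group.FG A›
  refine ⟨⟨s ∪ range i, hfin.union (finite_range _), ?_⟩, fun h => Or.inr ⟨h, rfl⟩⟩
  rw [eq_top_iff, ← hs]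
  exact Subgroup.closure_mono subset_union_left

/-! ### Amalgams with an infinite factor -/

section Infinite

variable {A B H : Type*} [Group A] [Group B] [Group H]

theorem Amalgam.finite_core [Finite H] {i : H →* A} {j : H →* B} (hi : Function.Injective i)
    (hj : Function.Injective j) :
    (core (rangePair (Amalgam.inl i j) (Amalgam.inr i j)) : Set (Amalgam i j)).Finite :=
  (finite_range fun h => Amalgam.inl i j (i h)).subset fun _ hx =>
    ((Amalgam.isAmalgam hi hj).2.2.2 _).1 hx

theorem coprod_finite_core (A B : Type*) [Group A] [Group B] :
    (core (rangePair (Monoid.Coprod.inl : A →* Monoid.Coprod A B)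
      (Monoid.Coprod.inr : B →* Monoid.Coprod A B)) : Set (Monoid.Coprod A B)).Finite :=
  (finite_singleton 1).subset fun x hx => ((coprod_isAmalgam A B).2.2.2 x).1 hx

theorem Amalgam.isCompatible_left {i : H →* A} {j : H →* B} (hi : Function.Injective i)
    (hj : Function.Injective j) {SA : FinGenSet A} {SB : FinGenSet B}
    (hSA : ∀ h : H, h ≠ 1 → i h ∈ SA.carrier) :
    IsCompatible (rangePair (Amalgam.inl i j) (Amalgam.inr i j)) true SA
      (FinGenSet.amalgam i j SA SB) (Amalgam.inl i j) := by
  obtain ⟨-, hα, -, hcore⟩ := Amalgam.isAmalgam hi hj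
  refine isCompatible_union_left _ hα fun x hx hx1 => ?_
  obtain ⟨h, rfl⟩ := (hcore x).1 hx
  refine ⟨i h, hSA h ?_, rfl⟩
  rintro rfl
  exact hx1 (by simp)

theorem Amalgam.isCompatible_right {i : H →* A} {j : H →* B} (hi : Function.Injective i)
    (hj : Function.Injective j) {SA : FinGenSet A} {SB : FinGenSet B}
    (hSB : ∀ h : H, h ≠ 1 → j h ∈ SB.carrier) :
    IsCompatible (rangePair (Amalgam.inl i j) (Amalgam.inr i j)) false SB
      (FinGenSet.amalgam i j SA SB) (Amalgam.inr i j) := by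
  obtain ⟨-, -, hβ, hcore⟩ := Amalgam.isAmalgam hi hj
  refine isCompatible_union_right _ hβ fun x hx hx1 => ?_
  obtain ⟨h, rfl⟩ := (hcore x).1 hx
  refine ⟨j h, hSB h ?_, (Amalgam.inl_eq_inr i j h).symm⟩
  rintro rfl
  exact hx1 (by simp)

theorem coprod_isCompatible_left (SA : FinGenSet A) (SB : FinGenSet B) :
    IsCompatible (rangePair (Monoid.Coprod.inl : A →* Monoid.Coprod A B) Monoid.Coprod.inr) true SA
      (FinGenSet.coprod SA SB) Monoid.Coprod.inl :=
  isCompatible_union_left _ (coprod_isAmalgam A B).2.1 fun x hx hx1 =>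
    absurd (((coprod_isAmalgam A B).2.2.2 x).1 hx) hx1

theorem coprod_isCompatible_right (SA : FinGenSet A) (SB : FinGenSet B) :
    IsCompatible (rangePair (Monoid.Coprod.inl : A →* Monoid.Coprod A B) Monoid.Coprod.inr) false SB
      (FinGenSet.coprod SA SB) Monoid.Coprod.inr :=
  isCompatible_union_right _ (coprod_isAmalgam A B).2.2.1 fun x hx hx1 =>
    absurd (((coprod_isAmalgam A B).2.2.2 x).1 hx) hx1

/-- The Floyd boundary of the amalgamated product of two infinite groups over a finite group is
that of the free product. -/
theorem floydBoundary_amalgam_infinite_infinite [Finite H] [Infinite A] [Infinite B]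
    (f : FloydFunction) {i : H →* A} {j : H →* B} (hi : Function.Injective i) (hj : Function.Injective j)
    (SA : FinGenSet A) (SB : FinGenSet B) (hSA : ∀ h : H, h ≠ 1 → i h ∈ SA.carrier)
    (hSB : ∀ h : H, h ≠ 1 → j h ∈ SB.carrier) :
    Nonempty (FloydBoundary f (FinGenSet.amalgam i j SA SB) ≃ₜ
      FloydBoundary f (FinGenSet.coprod SA SB)) := by
  have hP := (Amalgam.isAmalgam hi hj).1
  have hP' := (coprod_isAmalgam A B).1
  have hfin := Amalgam.finite_core hi hj
  have hfin' := coprod_finite_core A B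
  have hc1 := Amalgam.isCompatible_left (SB := SB) hi hj hSA
  have hc2 := Amalgam.isCompatible_right (SA := SA) hi hj hSB
  have hc1' := coprod_isCompatible_left SA SB
  have hc2' := coprod_isCompatible_right SA SB
  obtain ⟨T, hT⟩ := exists_isTransversalPair (rangePair (Amalgam.inl i j) (Amalgam.inr i j))
  obtain ⟨T', hT'⟩ := exists_isTransversalPair
    (rangePair (Monoid.Coprod.inl : A →* Monoid.Coprod A B) Monoid.Coprod.inr)
  have := (FinGenSet.amalgam i j SA SB).countable
  have := (FinGenSet.coprod SA SB).countable
  refine hP.nonempty_homeomorph hT hfin hP' hT' hfin' one_pos one_pos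
    (hP.hasCoboundedWords_one hT hfin true) (hP'.hasCoboundedWords_one hT' hfin' true) fun n => ?_
  -- At each place the letters of both groups come from the same factor, `B` or `A`, which serves as
  -- the common model.
  cases hside : side true n
  · rw [← hside] at hc2 hc2'
    exact (hP.isFactorLike_codes_one hT hfin f hc2).exists_enumeration
      (hP'.isFactorLike_codes_one hT' hfin' f hc2')
  · rw [← hside] at hc1 hc1'
    exact (hP.isFactorLike_codes_one hT hfin f hc1).exists_enumeration
      (hP'.isFactorLike_codes_one hT' hfin' f hc1')

/-- The Floyd boundary of the amalgamated product of an infinite group `A` and a finite group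
over a proper subgroup of the latter is that of the free product of two copies of `A`. -/
theorem floydBoundary_amalgam_infinite_finite [Finite H] [Infinite A] [Finite B] (f : FloydFunction)
    {i : H →* A} {j : H →* B} (hi : Function.Injective i) (hj : Function.Injective j)
    (hjs : ¬ Function.Surjective j) (SA : FinGenSet A) (SB : FinGenSet B)
    (hSA : ∀ h : H, h ≠ 1 → i h ∈ SA.carrier) :
    Nonempty (FloydBoundary f (FinGenSet.amalgam i j SA SB) ≃ₜ
      FloydBoundary f (FinGenSet.coprod SA SA)) := by
  obtain ⟨hP, -, hβ, hcore⟩ := Amalgam.isAmalgam hi hj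
  have hP' := (coprod_isAmalgam A A).1
  have hfin := Amalgam.finite_core hi hj
  have hfin' := coprod_finite_core A A
  have hc := Amalgam.isCompatible_left (SB := SB) hi hj hSA
  have hc1' := coprod_isCompatible_left SA SA
  have hc2' := coprod_isCompatible_right SA SA
  obtain ⟨T, hT⟩ := exists_isTransversalPair (rangePair (Amalgam.inl i j) (Amalgam.inr i j))
  obtain ⟨T', hT'⟩ := exists_isTransversalPair
    (rangePair (Monoid.Coprod.inl : A →* Monoid.Coprod A A) Monoid.Coprod.inr)
  have := (FinGenSet.amalgam i j SA SB).countable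
  have := (FinGenSet.coprod SA SA).countable
  have hTfin : (T (!true)).Finite := (finite_range (Amalgam.inr i j)).subset (hT.subset false)
  have hne : ∃ t ∈ T (!true), t ≠ 1 := by
    obtain ⟨b, hb⟩ := not_forall.1 hjs
    refine hT.exists_ne_one (b := false) (x := Amalgam.inr i j b) ⟨b, rfl⟩ fun h => hb ?_
    obtain ⟨h, hh⟩ := (hcore _).1 h
    exact ⟨h, hβ (by rw [← hh, Amalgam.inl_eq_inr])⟩
  -- Blocks of length two on the left, single letters on the right: both are modelled on `A`,
  -- whichever copy of `A` the letter of the free product comes from.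
  refine hP.nonempty_homeomorph hT hfin hP' hT' hfin' two_pos one_pos
    (hP.hasCoboundedWords_two hT hfin true hne) (hP'.hasCoboundedWords_one hT' hfin' true)
    fun n => ?_
  have h1 := hP.isFactorLike_codes_two hT hfin (i := n) hTfin hne f hc
  cases hside : side true n
  · rw [← hside] at hc2'
    exact h1.exists_enumeration (hP'.isFactorLike_codes_one hT' hfin' f hc2')
  · rw [← hside] at hc1'
    exact h1.exists_enumeration (hP'.isFactorLike_codes_one hT' hfin' f hc1')

end Infinite

/-! ### Brouwer's characterization of the Cantor set -/

section Cantor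

open TopologicalSpace

variable {Z : Type*} [TopologicalSpace Z]

/-- A set splits another one if it meets both it and its complement. -/
def Splits (V C : Set Z) : Prop := (C ∩ V).Nonempty ∧ (C \ V).Nonempty

theorem exists_clopen_splits [T2Space Z] [CompactSpace Z] [TotallyDisconnectedSpace Z]
    (hperf : ∀ U : Set Z, IsOpen U → U.Nonempty → U.Nontrivial) {C : Set Z} (hC : IsClopen C)
    (hne : C.Nonempty) : ∃ V, IsClopen V ∧ Splits V C := by
  obtain ⟨x, hx, y, hy, hxy⟩ := hperf C hC.isOpen hne
  obtain ⟨V, hV, hxV, hVy⟩ := exists_isClopen_of_totally_separated hxy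
  exact ⟨V, hV, ⟨x, hx, hxV⟩, ⟨y, hy, hVy⟩⟩

open Classical in
/-- Brouwer's characterization of the Cantor set. -/
theorem nonempty_homeomorph_natToBool [T2Space Z] [CompactSpace Z] [TotallyDisconnectedSpace Z]
    [SecondCountableTopology Z] [Nonempty Z]
    (hperf : ∀ U : Set Z, IsOpen U → U.Nonempty → U.Nontrivial) :
    Nonempty (Z ≃ₜ (ℕ → Bool)) := by
  have : Countable (Clopens Z) := Clopens.countable_iff_secondCountable.2 inferInstance
  obtain ⟨U, hU⟩ := exists_surjective_nat (Clopens Z)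
  -- Each nonempty clopen cell is split at stage `n`, which keeps all cells nonempty; `U n` itself
  -- is used whenever it splits the cell, so that in the end points are separated by every clopen
  -- set.
  have hex : ∀ (n : ℕ) (C : Set Z), ∃ V, IsClopen V ∧ (IsClopen C → C.Nonempty → Splits V C) ∧
      (Splits (U n : Set Z) C → V = U n) := by
    intro n C
    by_cases h : Splits (U n : Set Z) C
    · exact ⟨U n, (U n).isClopen, fun _ _ => h, fun _ => rfl⟩
    · by_cases hC : IsClopen C ∧ C.Nonempty
      · obtain ⟨V, hV, hs⟩ := exists_clopen_splits hperf hC.1 hC.2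
        exact ⟨V, hV, fun _ _ => hs, fun h' => absurd h' h⟩
      · exact ⟨∅, isClopen_empty, fun h1 h2 => absurd ⟨h1, h2⟩ hC, fun h' => absurd h' h⟩
  choose V hV hsplit hVU using hex
  let cell : (ℕ → Bool) → ℕ → Set Z := fun β n => Nat.rec univ
    (fun n C => if β n then C ∩ V n C else C \ V n C) n
  -- The cell of `z` is defined without reference to its code, which in turn is read off from it.
  let pcell : Z → ℕ → Set Z := fun z n => Nat.rec univ
    (fun n C => if z ∈ V n C then C ∩ V n C else C \ V n C) n
  let code : Z → ℕ → Bool := fun z n => decide (z ∈ V n (pcell z n))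
  have hcell : ∀ β n, cell β (n + 1) =
      if β n then cell β n ∩ V n (cell β n) else cell β n \ V n (cell β n) := fun _ _ => rfl
  have hpcell : ∀ z n, pcell z n = cell (code z) n := by
    intro z n
    induction n with
    | zero => rfl
    | succ n ih =>
      rw [hcell, ← ih]
      simp only [code, decide_eq_true_eq]
      rfl
  have hclopen : ∀ β n, IsClopen (cell β n) := by
    intro β n
    induction n with
    | zero => exact isClopen_univ
    | succ n ih =>
      rw [hcell]
      split
      · exact ih.inter (hV _ _)
      · exact ih.diff (hV _ _)
  have hnonempty : ∀ β n, (cell β n).Nonempty := by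
    intro β n
    induction n with
    | zero => exact univ_nonempty
    | succ n ih =>
      rw [hcell]
      split
      · exact (hsplit n _ (hclopen β n) ih).1
      · exact (hsplit n _ (hclopen β n) ih).2
  have hmem : ∀ z n, z ∈ cell (code z) n := by
    intro z n
    induction n with
    | zero => exact mem_univ z
    | succ n ih =>
      rw [hcell]
      by_cases h : z ∈ V n (pcell z n)
      · rw [if_pos (by simpa only [code, decide_eq_true_eq] using h)]
        exact ⟨ih, hpcell z n ▸ h⟩
      · rw [if_neg (by simpa only [code, decide_eq_true_eq] using h)]
        exact ⟨ih, hpcell z n ▸ h⟩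
  have hagree : ∀ z β n, z ∈ cell β n → cell (code z) n = cell β n ∧ ∀ m < n, code z m = β m := by
    intro z β n
    induction n with
    | zero => exact fun _ => ⟨rfl, fun m hm => absurd hm (Nat.not_lt_zero m)⟩
    | succ n ih =>
      intro hz
      have hzn : z ∈ cell β n := by
        rw [hcell] at hz
        split at hz
        · exact hz.1
        · exact hz.1
      obtain ⟨h1, h2⟩ := ih hzn
      have h3 : code z n = β n := by
        simp only [code]
        rw [hpcell, h1]
        rw [hcell] at hz
        split at hz
        · next hβ => rw [hβ]; exact decide_eq_true hz.2
        · next hβ => rw [Bool.not_eq_true] at hβ; rw [hβ]; exact decide_eq_false hz.2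
      refine ⟨by rw [hcell, hcell, h1, h3], fun m hm => ?_⟩
      rcases Nat.lt_succ_iff_lt_or_eq.1 hm with hm | rfl
      · exact h2 m hm
      · exact h3
  have hanti : ∀ β n, cell β (n + 1) ⊆ cell β n := by
    intro β n
    rw [hcell]
    split
    · exact inter_subset_left
    · exact sdiff_subset
  have hcont : Continuous code := by
    refine continuous_pi fun n => ?_
    refine (IsLocallyConstant.iff_exists_open _).2 (fun z => ?_) |>.continuous
    exact ⟨cell (code z) (n + 1), (hclopen (code z) (n + 1)).isOpen, hmem z (n + 1), fun z' hz' =>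
      (hagree z' _ _ hz').2 n (Nat.lt_succ_self n)⟩
  have hinj : Function.Injective code := by
    intro z z' h
    by_contra hne
    obtain ⟨W, hW, hzW, hz'W⟩ := exists_isClopen_of_totally_separated hne
    obtain ⟨n, hn⟩ := hU ⟨W, hW⟩
    -- With equal codes, `z` and `z'` are in the same cell when the clopen set separating them comes
    -- up in the enumeration, and this set splits the cell.
    have hs : Splits (U n : Set Z) (cell (code z) n) := by
      rw [hn]
      exact ⟨⟨z, hmem z n, hzW⟩, ⟨z', h ▸ hmem z' n, hz'W⟩⟩
    have hVW : V n (cell (code z) n) = W := by rw [hVU n _ hs, hn]; rfl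
    have h1 : code z n = true := by
      simp only [code, decide_eq_true_eq]
      rw [hpcell, hVW]
      exact hzW
    have h2 : code z' n = false := by
      simp only [code, decide_eq_false_iff_not]
      rw [hpcell, ← h, hVW]
      exact hz'W
    rw [h, h2] at h1
    exact absurd h1 (by simp)
  have hsurj : Function.Surjective code := by
    intro β
    obtain ⟨z, hz⟩ := IsCompact.nonempty_iInter_of_sequence_nonempty_isCompact_isClosed (cell β)
      (hanti β) (hnonempty β) isCompact_univ (fun n => (hclopen β n).isClosed)
    rw [mem_iInter] at hz
    exact ⟨z, funext fun n => (hagree z β (n + 1) (hz (n + 1))).2 n (Nat.lt_succ_self n)⟩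
  exact ⟨hcont.homeoOfEquivCompactToT2 (f := Equiv.ofBijective code ⟨hinj, hsurj⟩)⟩

/-- A basic open set restricts only finitely many coordinates, so a later coordinate with two values
yields a second point. -/
theorem pi_nonempty_homeomorph_natToBool {E : ℕ → Type*} [∀ n, TopologicalSpace (E n)]
    [∀ n, DiscreteTopology (E n)] [∀ n, Finite (E n)] [∀ n, Nonempty (E n)]
    (hE : ∀ N, ∃ n ≥ N, Nontrivial (E n)) : Nonempty ((∀ n, E n) ≃ₜ (ℕ → Bool)) := by
  refine nonempty_homeomorph_natToBool fun U hU ⟨s, hs⟩ => ?_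
  obtain ⟨I, u, hu, hIU⟩ := isOpen_pi_iff.1 hU s hs
  obtain ⟨n, hn, hnt⟩ := hE (I.sup id + 1)
  have hnI : n ∉ I := fun h => by
    have : id n ≤ I.sup id := Finset.le_sup h
    simp only [id] at this
    omega
  obtain ⟨y, hy⟩ := exists_ne (s n)
  refine ⟨s, hs, Function.update s n y, hIU fun i hi => ?_, fun h => hy ?_⟩
  · rw [Function.update_of_ne (fun h => hnI (by rw [← h]; exact hi))]
    exact (hu i hi).2
  · have := congrFun h n
    rw [Function.update_self] at this
    exact this.symm

end Cantor

/-! ### The remainder as a space of infinite words -/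

section Branches

open UniformSpace

variable {Λ : Type*} {D : ℕ → Set Λ}

/-- The word formed by the first letters of a sequence. -/
def initialWord (s : ∀ n, D n) (n : ℕ) : List Λ := List.ofFn fun i : Fin n => (s i : Λ)

theorem length_initialWord (s : ∀ n, D n) (n : ℕ) : (initialWord s n).length = n :=
  List.length_ofFn

theorem getElem_initialWord (s : ∀ n, D n) (n i : ℕ) (h : i < (initialWord s n).length) :
    (initialWord s n)[i] = s i := List.getElem_ofFn _

theorem isWord_initialWord (s : ∀ n, D n) (n : ℕ) : IsWord D (initialWord s n) := fun i h => by
  rw [getElem_initialWord]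
  exact (s i).2

theorem initialWord_prefix (s : ∀ n, D n) {m n : ℕ} (h : m ≤ n) :
    initialWord s m <+: initialWord s n := by
  rw [List.prefix_iff_eq_take]
  refine List.ext_getElem ?_ fun i h1 h2 => ?_
  · simp [length_initialWord, h]
  · rw [List.getElem_take, getElem_initialWord, getElem_initialWord]

theorem finite_isWord_length_le (hD : ∀ n, (D n).Finite) (N : ℕ) :
    {w | IsWord D w ∧ w.length ≤ N}.Finite := by
  induction N with
  | zero =>
    refine (finite_singleton []).subset fun w hw => ?_
    exact List.length_eq_zero_iff.1 (Nat.le_zero.1 hw.2)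
  | succ N ih =>
    refine (ih.union (Set.Finite.image2 (fun u z => u ++ [z]) ih (hD N))).subset fun w hw => ?_
    rcases Nat.lt_or_ge N w.length with hlt | hle
    · right
      have hne : w ≠ [] := fun h => by simp [h] at hlt
      obtain ⟨u, z, rfl⟩ : ∃ u z, w = u ++ [z] := ⟨_, _, (List.dropLast_append_getLast hne).symm⟩
      obtain ⟨hu, hz⟩ := IsWord.append_singleton.1 hw.1
      have hlen : u.length = N := by
        have := hw.2
        simp at this hlt
        omega
      exact ⟨u, ⟨hu, hlen.le⟩, z, hlen ▸ hz, rfl⟩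
    · exact Or.inl ⟨hw.1, hle⟩

theorem exists_initialWord_eq (hne : ∀ n, (D n).Nonempty) {w : List Λ} (hw : IsWord D w) :
    ∃ s : ∀ n, D n, initialWord s w.length = w := by
  classical
  refine ⟨fun n => if h : n < w.length then ⟨w[n], hw n h⟩ else ⟨_, (hne n).some_mem⟩, ?_⟩
  refine List.ext_getElem (length_initialWord _ _) fun i h1 h2 => ?_
  rw [getElem_initialWord, dif_pos h2]

/-- If there are finitely many letters for each place, the remainder of a space with an
asymptotically dense tree-like family is the space of infinite words. -/
theorem IsTreeLike.nonempty_homeomorph_pi {X : Type*} [MetricSpace X]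
    [∀ n, TopologicalSpace (D n)] [∀ n, DiscreteTopology (D n)] (hD : ∀ n, (D n).Finite)
    (hne : ∀ n, (D n).Nonempty) {p : List Λ → X} (hp : IsTreeLike {w | IsWord D w} p)
    (hiso : ∀ x : X, ∃ δ > 0, ∀ y, dist x y < δ → x = y)
    (hr : ∃ r : X → {w : List Λ // IsWord D w ∧ w ≠ []},
      Tendsto (fun x => dist (p (r x)) x) cofinite (𝓝 0)) :
    Nonempty (CompletionRemainder X ≃ₜ ∀ n, D n) := by
  have hfinD : ∀ n, Finite (D n) := fun n => (hD n).to_subtype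
  -- Only finitely many words have far extensions, so their lengths are bounded.
  have hsmall : ∀ ε > 0, ∃ N ≥ 1, ∀ v w, IsWord D v → IsWord D w → N ≤ v.length → v <+: w →
      dist (p v) (p w) < ε := by
    intro ε hε
    obtain ⟨N, hN⟩ := ((hp.small ε hε).image List.length).bddAbove
    refine ⟨N + 1, by omega, fun v w hv hw hlen hvw => ?_⟩
    by_contra hlt
    have hv0 : v ≠ [] := fun h => by simp [h] at hlen
    have : v.length ≤ N := hN ⟨v, ⟨hv, hv0, w, hw, hvw, not_lt.1 hlt⟩, rfl⟩
    omega
  have hcauchy : ∀ s : ∀ n, D n, CauchySeq fun n => p (initialWord s n) := by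
    intro s
    refine Metric.cauchySeq_iff'.2 fun ε hε => ?_
    obtain ⟨N, -, hN⟩ := hsmall ε hε
    refine ⟨N, fun n hn => ?_⟩
    rw [dist_comm]
    exact hN _ _ (isWord_initialWord s N) (isWord_initialWord s n) (length_initialWord s N).ge
      (initialWord_prefix s hn)
  have hlim : ∀ s : ∀ n, D n, ∃ ξ : Completion X,
      Tendsto (fun n => (p (initialWord s n) : Completion X)) atTop (𝓝 ξ) := fun s =>
    cauchySeq_tendsto_of_complete ((hcauchy s).map (Completion.uniformContinuous_coe X))
  choose θ hθ using hlim
  have hdist : ∀ ε > 0, ∃ N ≥ 1, ∀ s n, N ≤ n →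
      dist (p (initialWord s n) : Completion X) (θ s) ≤ ε := by
    intro ε hε
    obtain ⟨N, hN1, hN⟩ := hsmall ε hε
    refine ⟨N, hN1, fun s n hn => ?_⟩
    refine le_of_tendsto (tendsto_const_nhds.dist (hθ s))
      ((eventually_ge_atTop n).mono fun m hm => ?_)
    rw [Completion.dist_eq]
    exact (hN _ _ (isWord_initialWord s n) (isWord_initialWord s m)
      (by rwa [length_initialWord]) (initialWord_prefix s hm)).le
  have hcont : Continuous θ := by
    refine Metric.continuous_iff'.2 fun s ε hε => ?_
    obtain ⟨N, -, hN⟩ := hdist (ε / 3) (by positivity)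
    have hopen : IsOpen (⋂ i ∈ Finset.range N, {t : ∀ n, D n | t i = s i}) :=
      isOpen_biInter_finset fun i _ => (isOpen_discrete {s i}).preimage (continuous_apply i)
    filter_upwards [hopen.mem_nhds (mem_iInter₂.2 fun i _ => rfl)] with t ht
    have heq : initialWord t N = initialWord s N := by
      refine List.ext_getElem (by simp [length_initialWord]) fun i h1 h2 => ?_
      rw [getElem_initialWord, getElem_initialWord]
      rw [length_initialWord] at h1
      exact congrArg Subtype.val (mem_iInter₂.1 ht i (Finset.mem_range.2 h1))
    have h1 := hN t N le_rfl
    have h2 := hN s N le_rfl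
    rw [heq] at h1
    have h3 := dist_triangle_left (θ t) (θ s) (p (initialWord s N) : Completion X)
    linarith
  have hinjw : ∀ s : ∀ n, D n, ∀ m n, 1 ≤ m → 1 ≤ n →
      p (initialWord s m) = p (initialWord s n) → m = n := by
    intro s m n hm hn h
    have hne0 : ∀ k, 1 ≤ k → initialWord s k ≠ [] := fun k hk h => by
      have := length_initialWord s k
      rw [h, List.length_nil] at this
      omega
    have := hp.inj _ (isWord_initialWord s m) _ (isWord_initialWord s n) (hne0 m hm) (hne0 n hn) h
    rw [← length_initialWord s m, this, length_initialWord]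
  -- A limit in the isolated set of vertices would make the sequence eventually constant, but
  -- different initial words give different points.
  have hrange : ∀ s, θ s ∉ range ((↑) : X → Completion X) := by
    rintro s ⟨x, hx⟩
    obtain ⟨δ, hδ, h⟩ := hiso x
    have h1 := (hθ s).eventually (Metric.ball_mem_nhds _ hδ)
    obtain ⟨N, hN⟩ := eventually_atTop.1 h1
    have h2 : ∀ n ≥ N, x = p (initialWord s n) := fun n hn => h _ (by
      have := hN n hn
      rw [← hx, Completion.dist_eq, dist_comm] at this
      exact this)
    have := hinjw s (N + 1) (N + 2) (by omega) (by omega)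
      ((h2 (N + 1) (by omega)).symm.trans (h2 (N + 2) (by omega)))
    omega
  have hinj : Function.Injective θ := by
    intro s t hst
    by_contra hne'
    obtain ⟨n, hn⟩ := Function.ne_iff.1 hne'
    obtain ⟨δ, hδ, hsep⟩ := hp.sep (initialWord s (n + 1)) (isWord_initialWord s _) (fun h => by
      have := length_initialWord s (n + 1)
      simp [h] at this)
    have h1 : δ ≤ dist (θ s) (θ t) := by
      refine ge_of_tendsto ((hθ s).dist (hθ t)) ((eventually_ge_atTop (n + 1)).mono fun m hm => ?_)
      rw [Completion.dist_eq]
      refine hsep _ (isWord_initialWord s m) _ (isWord_initialWord t m) (fun h => ?_)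
        (initialWord_prefix s hm) (fun h => hn ?_)
      · have := length_initialWord t m
        rw [h, List.length_nil] at this
        omega
      · have h2 := h.getElem (i := n) (by rw [length_initialWord]; omega)
        rw [getElem_initialWord, getElem_initialWord] at h2
        exact Subtype.ext h2
    rw [hst, dist_self] at h1
    exact absurd h1 (not_le.2 hδ)
  have hsurj : ∀ ξ : Completion X, ξ ∉ range ((↑) : X → Completion X) → ξ ∈ range θ := by
    intro ξ hξ
    obtain ⟨r, hr⟩ := hr
    have hrc : Tendsto r cofinite cofinite :=
      tendsto_cofinite_of_tendsto_dist (p := fun w : {w : List Λ // IsWord D w ∧ w ≠ []} => p w)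
        hiso hr
    -- Since the image of the compact product is closed, it suffices to approximate `ξ`. Near `ξ`
    -- there are vertices close to products of long words, and such products are close to the limits
    -- of infinite extensions of these words.
    rw [← (isCompact_range hcont).isClosed.closure_eq]
    refine Metric.mem_closure_iff.2 fun ε hε => ?_
    obtain ⟨N, -, hN⟩ := hdist (ε / 4) (by positivity)
    have hlong : ∀ᶠ x in cofinite, N ≤ (r x).1.length := by
      refine hrc.eventually (p := fun w => N ≤ w.1.length) ?_
      refine ((finite_isWord_length_le hD N).preimage Subtype.val_injective.injOn).subset ?_
      intro w hw
      exact ⟨w.2.1, (Nat.lt_of_not_le hw).le⟩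
    have hle := comap_nhds_remainder_le ξ hξ
    have hnear : ∀ᶠ x : X in comap (↑) (𝓝 ξ), dist (x : Completion X) ξ < ε / 4 :=
      tendsto_comap.eventually (Metric.ball_mem_nhds ξ (by positivity : 0 < ε / 4))
    obtain ⟨x, ⟨hx1, hx2⟩, hx3⟩ := ((hnear.and (hle (hr.eventually
      (gt_mem_nhds (by positivity : 0 < ε / 4))))).and (hle hlong)).exists
    obtain ⟨s, hs⟩ := exists_initialWord_eq hne (r x).2.1
    refine ⟨θ s, ⟨s, rfl⟩, ?_⟩
    have h1 := hN s _ hx3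
    rw [hs] at h1
    rw [← Completion.dist_eq] at hx2
    have h2 := dist_triangle4 ξ (x : Completion X) (p (r x) : Completion X) (θ s)
    rw [dist_comm ξ (x : Completion X), dist_comm (x : Completion X) (p (r x) : Completion X)] at h2
    linarith
  let e : (∀ n, D n) ≃ CompletionRemainder X := Equiv.ofBijective (fun s => ⟨θ s, hrange s⟩)
    ⟨fun s t h => hinj (congrArg Subtype.val h), fun ξ => by
      obtain ⟨s, hs⟩ := hsurj ξ.1 ξ.2
      exact ⟨s, Subtype.ext hs⟩⟩
  exact ⟨(Continuous.homeoOfEquivCompactToT2 (f := e) (hcont.subtype_mk _)).symm⟩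

end Branches

/-! ### Groups with finitely many ends -/

section Ends

variable {V : Type*} {G : SimpleGraph V}

/-- The component of the complement of `F` that an end chooses. -/
def endComponent (e : G.end) (F : Finset V) : G.ComponentCompl F := e.1 (Opposite.op F)

theorem hom_endComponent (e : G.end) {F L : Finset V} (h : F ⊆ L) :
    (endComponent e L).hom h = endComponent e F :=
  e.2 (CategoryTheory.opHomOfLE h)

theorem endComponent_anti (e : G.end) {F L : Finset V} (h : F ⊆ L) {x : V}
    (hx : x ∈ endComponent e L) : x ∈ endComponent e F := by
  rw [← hom_endComponent e h]
  exact SimpleGraph.ComponentCompl.subset_hom _ h hx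

theorem infinite_endComponent (e : G.end) (F : Finset V) :
    {x | x ∈ endComponent e F}.Infinite :=
  (endComponent e F).infinite_iff_in_all_ranges.2 fun _ h => ⟨_, hom_endComponent e h⟩

theorem end_ext {e e' : G.end} (h : ∀ F, endComponent e F = endComponent e' F) : e = e' :=
  Subtype.ext (funext fun F => h F.unop)

theorem SimpleGraph.ComponentCompl.eq_of_mem {F : Set V} {C C' : G.ComponentCompl F} {x : V}
    (h : x ∈ C) (h' : x ∈ C') : C = C' :=
  h.choose_spec.symm.trans h'.choose_spec

theorem end_finite_of_finite [Finite V] : G.end.Finite :=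
  (Set.finite_empty).subset fun e he => infinite_endComponent ⟨e, he⟩ ∅ (Set.toFinite _)

variable {K : Type*} [Group K] (S : FinGenSet K)

/-- Elements far from a finite set stay in their component under a fixed displacement. -/
theorem FinGenSet.eventually_mul_mem (F : Finset K) (r : K) :
    ∀ᶠ k in cofinite, ∀ C : S.cayley.ComponentCompl F, k ∈ C → k * r ∈ C := by
  have hF : ∀ᶠ k in cofinite, k ∉ F := F.finite_toSet.compl_mem_cofinite
  have ht : ∀ x : K, Tendsto (· * x) cofinite (cofinite : Filter K) :=
    fun x => (mul_left_injective x).tendsto_cofinite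
  have hr : r ∈ Subgroup.closure S.carrier := by rw [S.closure_eq]; trivial
  induction hr using Subgroup.closure_induction with
  | mem s hs =>
    filter_upwards [(ht s).eventually hF] with k hk C hC
    by_cases h : k = k * s
    · rwa [← h]
    · exact SimpleGraph.ComponentCompl.mem_of_adj k (k * s) hC hk
        (S.cayley_adj.2 ⟨h, s, hs, Or.inl rfl⟩)
  | one => exact Eventually.of_forall fun k C hC => by rwa [mul_one]
  | mul x y _ _ hx hy =>
    filter_upwards [hx, (ht x).eventually hy] with k h1 h2 C hC
    rw [← mul_assoc]
    exact h2 C (h1 C hC)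
  | inv x _ hx =>
    filter_upwards [(ht x⁻¹).eventually hx, (ht x⁻¹).eventually hF] with k h1 h2 C hC
    have h3 := S.cayley.componentComplMk_mem (K := (F : Set K)) h2
    have h4 := h1 _ h3
    rw [inv_mul_cancel_right] at h4
    rwa [SimpleGraph.ComponentCompl.eq_of_mem hC h4]

/-- A group covered up to bounded distance by finitely many injective sequences with bounded
steps has finitely many ends. -/
theorem FinGenSet.end_finite {J : Type*} [Finite J] (g : J → ℕ → K)
    (hg : ∀ j, Function.Injective (g j)) {R Q : Set K} (hR : R.Finite) (hQ : Q.Finite)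
    (hgR : ∀ j n, (g j n)⁻¹ * g j (n + 1) ∈ R) (hgQ : ∀ k, ∃ j n, (g j n)⁻¹ * k ∈ Q) :
    S.cayley.end.Finite := by
  classical
  have := Fintype.ofFinite J
  -- Some sequence returns to all components chosen by `e`. Otherwise all sequences eventually avoid
  -- one such component; but this is infinite, and a far element of it has a late point of some
  -- sequence nearby, in the same component.
  have hex : ∀ e : S.cayley.end, ∃ j, ∀ F, ∃ᶠ n in atTop, g j n ∈ endComponent e F := by
    intro e
    by_contra! h
    choose F hF using h
    set L : Finset K := Finset.univ.biUnion F with hL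
    have hFL : ∀ j, F j ⊆ L := fun j => Finset.subset_biUnion_of_mem F (Finset.mem_univ j)
    have h1 : ∀ j, ∀ᶠ n in atTop, g j n ∉ endComponent e L := fun j =>
      (hF j).mono fun n hn h => hn (endComponent_anti e (hFL j) h)
    have h2 : ∀ j, ∃ N, ∀ n ≥ N, g j n ∉ endComponent e L := fun j => eventually_atTop.1 (h1 j)
    choose N hN using h2
    have hfin : (⋃ j, Set.image2 (fun n q => g j n * q) (Set.Iio (N j)) Q).Finite :=
      Set.finite_iUnion fun j => (Set.finite_Iio _).image2 _ hQ
    have h3 : ∀ᶠ k in cofinite, ∀ q ∈ Q, ∀ C : S.cayley.ComponentCompl L, k ∈ C → k * q⁻¹ ∈ C :=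
      (eventually_all_finite hQ).2 fun q _ => S.eventually_mul_mem L q⁻¹
    obtain ⟨k, hk, hk3, hkf⟩ := ((frequently_cofinite_iff_infinite.2
      (infinite_endComponent e L)).and_eventually (h3.and hfin.compl_mem_cofinite)).exists
    obtain ⟨j, n, hq⟩ := hgQ k
    have h4 := hk3 _ hq _ hk
    rw [mul_inv_rev, inv_inv, mul_inv_cancel_left] at h4
    refine hkf (mem_iUnion.2 ⟨j, n, ?_, _, hq, mul_inv_cancel_left _ _⟩)
    exact not_le.1 fun hle => hN j n hle h4
  choose j hj using hex
  refine Set.finite_coe_iff.1 (Finite.of_injective j fun e e' hee => end_ext fun F => ?_)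
  -- Bounded steps far out do not change the component, so a sequence that returns to a component
  -- stays there and determines the end.
  have hstep : ∀ᶠ n in atTop, ∀ C : S.cayley.ComponentCompl F,
      g (j e) n ∈ C → g (j e) (n + 1) ∈ C := by
    have h1 : ∀ᶠ k in cofinite, ∀ r ∈ R, ∀ C : S.cayley.ComponentCompl F, k ∈ C → k * r ∈ C :=
      (eventually_all_finite hR).2 fun r _ => S.eventually_mul_mem F r
    have h2 : Tendsto (g (j e)) atTop cofinite :=
      Nat.cofinite_eq_atTop ▸ (hg (j e)).tendsto_cofinite
    filter_upwards [h2.eventually h1] with n hn C hC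
    have := hn _ (hgR (j e) n) C hC
    rwa [mul_inv_cancel_left] at this
  obtain ⟨N, hN⟩ := eventually_atTop.1 hstep
  have hev : ∀ C : S.cayley.ComponentCompl F, (∃ᶠ n in atTop, g (j e) n ∈ C) →
      ∀ᶠ n in atTop, g (j e) n ∈ C := by
    intro C hC
    obtain ⟨n, hn, hnC⟩ := frequently_atTop.1 hC N
    refine eventually_atTop.2 ⟨n, fun m hm => ?_⟩
    induction m, hm using Nat.le_induction with
    | base => exact hnC
    | succ m hm ih => exact hN m (hn.trans hm) C ih
  obtain ⟨n, h1, h2⟩ := ((hev _ (hj e F)).and (hev _ (hee ▸ hj e' F))).exists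
  exact SimpleGraph.ComponentCompl.eq_of_mem h1 h2

end Ends

/-! ### Amalgams of two finite groups -/

section Cantor

variable {K : Type*} [Group K] {P : Bool → Subgroup K} {T : Bool → Set K}

/-- Without a nontrivial letter on side `b`, that factor is contained in the other one, which is
then the whole group; a finite group has no ends. -/
theorem IsAmalgam.exists_ne_one_of_end_infinite (hP : IsAmalgam P) (hT : IsTransversalPair P T)
    (hPfin : ∀ b, (P b : Set K).Finite) {S : FinGenSet K} (hS : S.cayley.end.Infinite) (b : Bool) :
    ∃ t ∈ T b, t ≠ 1 := by
  by_contra! h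
  have hle : P b ≤ P (!b) := by
    intro g hg
    obtain ⟨t, ht, htg⟩ := hT.exists_mem b g hg
    rw [h t ht, inv_one, one_mul] at htg
    exact core_le P _ htg
  have htop : P (!b) = ⊤ := by
    rw [eq_top_iff, ← hP.closure_eq, Subgroup.closure_le]
    cases b
    · exact union_subset subset_rfl hle
    · exact union_subset hle subset_rfl
  have hfin := hPfin (!b)
  rw [htop, Subgroup.coe_top] at hfin
  have := Set.finite_univ_iff.1 hfin
  exact hS end_finite_of_finite

/-- An amalgamated product of two finite groups in which the common subgroup has index at most
two has finitely many ends. -/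
theorem IsAmalgam.end_finite (hP : IsAmalgam P) (hT : IsTransversalPair P T)
    (hPfin : ∀ b, (P b : Set K).Finite) (S : FinGenSet K) {t : Bool → K}
    (ht : ∀ b, t b ∈ T b ∧ t b ≠ 1) (htT : ∀ b, ∀ x ∈ T b, x ≠ 1 → x = t b) :
    S.cayley.end.Finite := by
  -- With a single nontrivial letter on each side, a normal form is determined by its first letter
  -- and its length. The group is thus covered by finitely many sequences up to the core.
  let wd : T true → ℕ → List K := fun x n =>
    Nat.rec [(x : K)] (fun n l => l ++ [t (side true (n + 1))]) n
  have hwd : ∀ x n, wd x (n + 1) = wd x n ++ [t (side true (n + 1))] := fun x n => rfl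
  have hlen : ∀ x n, (wd x n).length = n + 1 := by
    intro x n
    induction n with
    | zero => rfl
    | succ n ih => rw [hwd, List.length_append, ih, List.length_singleton]
  have hword : ∀ x n, IsWord (letters T true) (wd x n) := by
    intro x n
    induction n with
    | zero => exact IsWord.cons.2 ⟨x.2, IsWord.nil⟩
    | succ n ih =>
      rw [hwd, IsWord.append_singleton, hlen]
      exact ⟨ih, ht _⟩
  have hnil : ∀ x n, wd x n ≠ [] := fun x n h => by
    have := hlen x n
    rw [h] at this
    simp at this
  have hall : ∀ w, IsWord (letters T true) w → w ≠ [] → ∃ x n, wd x n = w := by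
    intro w
    induction w using List.reverseRecOn with
    | nil => exact fun _ h => absurd rfl h
    | append_singleton u z ih =>
      intro hw _
      obtain ⟨hu, hz⟩ := IsWord.append_singleton.1 hw
      rcases eq_or_ne u [] with rfl | hne
      · exact ⟨⟨z, hz⟩, 0, rfl⟩
      · obtain ⟨x, n, rfl⟩ := ih hu hne
        rw [hlen] at hz
        exact ⟨x, n + 1, by rw [hwd, htT _ z hz.1 hz.2]⟩
  have hfin : (core P : Set K).Finite := (hPfin true).subset (core_le P true)
  have : Finite (T true) := ((hPfin true).subset (hT.subset true)).to_subtype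
  refine S.end_finite (fun x n => (wd x n).prod) (fun x m n h => ?_) (Set.finite_range t) hfin
    (fun x n => ⟨side true (n + 1), ?_⟩) fun k => ?_
  · have := hP.eq_of_mem_core hT (hword x m) (hword x n) (hnil x m) (hnil x n)
      (by simp only at h; rw [h, inv_mul_cancel]; exact one_mem _)
    have := congrArg List.length this
    rw [hlen, hlen] at this
    omega
  · simp only [hwd, List.prod_append, List.prod_singleton, inv_mul_cancel_left]
  · obtain ⟨w, hw, hne, h⟩ := hP.exists_word hT true k
    obtain ⟨x, n, rfl⟩ := hall w hw hne
    exact ⟨x, n, h⟩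

/-- The Floyd boundary of an amalgamated product of two finite groups with infinitely many ends is
a Cantor set. -/
theorem IsAmalgam.nonempty_homeomorph_cantorSet (hP : IsAmalgam P) (hT : IsTransversalPair P T)
    (hPfin : ∀ b, (P b : Set K).Finite) (hends : HasInfinitelyManyEnds K) (f : FloydFunction)
    (S : FinGenSet K) : Nonempty (FloydBoundary f S ≃ₜ cantorSet) := by
  obtain ⟨S', hS'⟩ := hends
  have hne := fun b => hP.exists_ne_one_of_end_infinite hT hPfin hS' b
  choose t ht using hne
  -- Some side has two nontrivial letters, and its letters occur at every other place; this makes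
  -- the product perfect.
  obtain ⟨b, x, hx, hx1, hxt⟩ : ∃ b, ∃ x ∈ T b, x ≠ 1 ∧ x ≠ t b := by
    by_contra! h
    exact hS' (hP.end_finite hT hPfin S' ht h)
  have hfin : (core P : Set K).Finite := (hPfin true).subset (core_le P true)
  have hfinD : ∀ n, (letters T true n).Finite := fun n =>
    (hPfin _).subset ((letters_subset true n).trans (hT.subset _))
  have hneD : ∀ n, (letters T true n).Nonempty := by
    rintro (_ | n)
    · exact ⟨1, hT.one_mem true⟩
    · exact ⟨_, ht _⟩
  have hnt : ∀ N, ∃ n ≥ N, Nontrivial (letters T true n) := by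
    intro N
    obtain ⟨n, hn, rfl⟩ : ∃ n ≥ N, side true (n + 1) = b := by
      cases b
      · exact ⟨2 * N, by omega, by rw [side_succ, side_two_mul]; rfl⟩
      · exact ⟨2 * N + 1, by omega, side_two_mul true (N + 1)⟩
    exact ⟨n + 1, by omega, ⟨⟨x, hx, hx1⟩, ⟨_, ht _⟩, fun h => hxt (congrArg Subtype.val h)⟩⟩
  let _ : ∀ n, TopologicalSpace (letters T true n) := fun n => ⊥
  have : ∀ n, DiscreteTopology (letters T true n) := fun n => ⟨rfl⟩
  have : ∀ n, Finite (letters T true n) := fun n => (hfinD n).to_subtype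
  have : ∀ n, Nonempty (letters T true n) := fun n => (hneD n).to_subtype
  have hcob : IsCobounded fun w : {w : List K // IsWord (letters T true) w ∧ w ≠ []} => w.1.prod :=
    ⟨core P, hfin, fun k => by
      obtain ⟨w, hw, hne, h⟩ := hP.exists_word hT true k
      exact ⟨⟨w, hw, hne⟩, h⟩⟩
  obtain ⟨φ⟩ := (hP.isTreeLike hT hfin true f S).nonempty_homeomorph_pi hfinD hneD
    FloydSpace.exists_isolated (hcob.exists_tendsto f S)
  obtain ⟨ψ⟩ := pi_nonempty_homeomorph_natToBool hnt
  exact ⟨(φ.trans ψ).trans cantorSetHomeomorphNatToBool.symm⟩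

end Cantor

/-! ### The three cases -/

theorem theorem5p1 (f : FloydFunction) :
    -- (1) both factors infinite
    (∀ (A : Type*) (B : Type*) (H : Type*) [Group A] [Group B] [Group H]
      [Group.FG A] [Group.FG B] [Infinite A] [Infinite B] [Finite H]
      (i : H →* A) (j : H →* B), Function.Injective i → Function.Injective j →
      (∀ (SA : FinGenSet A) (SB : FinGenSet B),
        (∀ h : H, h ≠ 1 → i h ∈ SA.carrier) → (∀ h : H, h ≠ 1 → j h ∈ SB.carrier) →
        Nonempty (FloydBoundary f (FinGenSet.amalgam i j SA SB) ≃ₜ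
          FloydBoundary f (FinGenSet.coprod SA SB))) ∧
      (f.IsDoubling →
        ∀ (S : FinGenSet (Amalgam i j)) (T : FinGenSet (Monoid.Coprod A B)),
          Nonempty (FloydBoundary f S ≃ₜ FloydBoundary f T))) ∧
    -- (2) `A` infinite, `B` finite and different from `H`
    (∀ (A : Type*) (B : Type*) (H : Type*) [Group A] [Group B] [Group H]
      [Group.FG A] [Infinite A] [Finite B] [Finite H]
      (i : H →* A) (j : H →* B), Function.Injective i → Function.Injective j →
      ¬ Function.Surjective j →
      (∀ (SA : FinGenSet A) (SB : FinGenSet B),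
        (∀ h : H, h ≠ 1 → i h ∈ SA.carrier) → (∀ h : H, h ≠ 1 → j h ∈ SB.carrier) →
        Nonempty (FloydBoundary f (FinGenSet.amalgam i j SA SB) ≃ₜ
          FloydBoundary f (FinGenSet.coprod SA SA))) ∧
      (f.IsDoubling →
        ∀ (S : FinGenSet (Amalgam i j)) (T : FinGenSet (Monoid.Coprod A A)),
          Nonempty (FloydBoundary f S ≃ₜ FloydBoundary f T))) ∧
    -- (3) both factors finite
    (∀ (B : Type*) (C : Type*) (H : Type*) [Group B] [Group C] [Group H]
      [Finite B] [Finite C] [Finite H]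
      (i : H →* B) (j : H →* C), Function.Injective i → Function.Injective j →
      HasInfinitelyManyEnds (Amalgam i j) →
      ∀ S : FinGenSet (Amalgam i j), Nonempty (FloydBoundary f S ≃ₜ cantorSet)) := by
  refine ⟨?_, ?_, ?_⟩
  · intro A B H _ _ _ _ _ _ _ _ i j hi hj
    refine ⟨fun SA SB hSA hSB => floydBoundary_amalgam_infinite_infinite f hi hj SA SB hSA hSB,
      fun hf S T => ?_⟩
    -- Auxiliary generating sets containing the image of `H` are inserted; the doubling condition
    -- allows passing to and from them.
    obtain ⟨SA, hSA⟩ := exists_finGenSet i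
    obtain ⟨SB, hSB⟩ := exists_finGenSet j
    obtain ⟨φ⟩ := hf.nonempty_homeomorph S (FinGenSet.amalgam i j SA SB)
    obtain ⟨ψ⟩ := floydBoundary_amalgam_infinite_infinite f hi hj SA SB (fun h _ => hSA h)
      (fun h _ => hSB h)
    obtain ⟨χ⟩ := hf.nonempty_homeomorph (FinGenSet.coprod SA SB) T
    exact ⟨(φ.trans ψ).trans χ⟩
  · intro A B H _ _ _ _ _ _ _ i j hi hj hjs
    refine ⟨fun SA SB hSA _ => floydBoundary_amalgam_infinite_finite f hi hj hjs SA SB hSA,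
      fun hf S T => ?_⟩
    obtain ⟨SA, hSA⟩ := exists_finGenSet i
    obtain ⟨SB, -⟩ := exists_finGenSet j
    obtain ⟨φ⟩ := hf.nonempty_homeomorph S (FinGenSet.amalgam i j SA SB)
    obtain ⟨ψ⟩ := floydBoundary_amalgam_infinite_finite f hi hj hjs SA SB (fun h _ => hSA h)
    obtain ⟨χ⟩ := hf.nonempty_homeomorph (FinGenSet.coprod SA SA) T
    exact ⟨(φ.trans ψ).trans χ⟩
  · intro B C H _ _ _ _ _ _ i j hi hj hends S
    obtain ⟨T, hT⟩ := exists_isTransversalPair (rangePair (Amalgam.inl i j) (Amalgam.inr i j))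
    refine (Amalgam.isAmalgam hi hj).1.nonempty_homeomorph_cantorSet hT ?_ hends f S
    rintro (_ | _)
    · exact finite_range (Amalgam.inr i j)
    · exact finite_range (Amalgam.inl i j)
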